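/- Let $\beta>0$ be real and let $k>\beta$ be an integer. Consider on $\mathbb{S}^2=\mathbb{C}\cup\{\infty\}$ the multivalued meromorphic function $$f(z)=z^\beta\,\frac{(k-\beta)z^k-(k+\beta)}{z^k+1},$$ and the functions $$h_1=\bigl(|z|^{2k}+z^k-\bar z^k-1\bigr)+|z|^{2\beta}\bigl((k+\beta)^2-(k^2-\beta^2)\bar z^k+(k^2-\beta^2)z^k-(k-\beta)^2|z|^{2k}\bigr),$$ $$h_2=\bigl(|z|^{2k}+z^k+\bar z^k+1\bigr)+|z|^{2\beta}\bigl((k+\beta)^2-(k^2-\beta^2)\bar z^k-(k^2-\beta^2)z^k+(k-\beta)^2|z|^{2k}\bigr).$$ Then $f$ is a developing map of a spherical conical metric $g$ on $\mathbb{S}^2$: there are a finite set $\mathfrak p\subset\mathbb{S}^2$, numbers $\beta_p>0$ ($p\in\mathfrak p$) and a conformal metric $g$ of constant curvature $1$ on $\mathbb{S}^2\setminus\mathfrak p$ with a conical singularity of angle $2\pi\beta_p$ at each $p\in\mathfrak p$ (that is, $g=e^{2u}|d\zeta|^2$ in some conformal coordinate $\zeta$ centred at $p$, with $u-(\beta_p-1)\log|\zeta|$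 extending continuously to $\zeta=0$; $\beta_p=1$ is allowed), such that $f$ is defined as a multivalued meromorphic function on $\mathbb{S}^2\setminus\mathfrak p$, $g=f^*\frac{4|dw|^2}{(1+|w|^2)^2}$, the monodromy of $f$ lies in $\mathrm{PSU}(2)$, and at each $p\in\mathfrak p$ the principal singular term of the Schwarzian derivative of $f$ is $\frac{1-\beta_p^2}{2\zeta^2}$ (with $\zeta$ a local coordinate centred at $p$). Moreover $h_2$ has no zeros on $\mathbb{C}$, the function $h_1/h_2$ is bounded, and $\operatorname{Re}(h_1/h_2)$ and $\operatorname{Im}(h_1/h_2)$ are two extra eigenfunctions of $g$; more precisely, every real linear combination $x\operatorname{Re}(h_1/h_2)+y\operatorname{Im}(h_1/h_2)$ with $(x,y)\neq(0,0)$ is an extra eigenfunction of $g$. Here a real function $u$ is an extra eigenfunction of $g$ if it lies in the domain of the Friedrichs extension of the (nonnegative) Laplace--Beltrami operator $\Delta_g$ on $C_c^\infty(\mathbb{S}^2\setminus\mathfrak p)$, satisfies $\Delta_g u=2u$ (for the Friedrichs extension, and pointwise on $\mathbb{S}^2\setminus\mathfrak p$, where $u$ is smooth), and is not of the form $u=\langle\phi,s\rangle$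 with $s\in\mathbb{R}^3$ and $$\phi=\frac{1}{|F|^2+1}\bigl(2\operatorname{Re}F,\;2\operatorname{Im}F,\;|F|^2-1\bigr)$$ the stereographic projection of a developing map $F$ of $g$. -/

import Mathlib

noncomputable section

namespace SphericalConical

open Filter Topology MeasureTheory OnePoint

/-! ### The Riemann sphere

The Riemann sphere is `OnePoint ℂ`. Its complex structure is used through the affine coordinate `z`
on `ℂ` and the coordinate `1 / z` at `∞`. -/

/-- The standard holomorphic parametrization of a neighbourhood of `p`, centred at `p`:
`ζ ↦ a + ζ` if `p = a` is finite, and `ζ ↦ 1 / ζ` (with `0 ↦ ∞`) if `p = ∞`. -/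
def param (p : OnePoint ℂ) (ζ : ℂ) : OnePoint ℂ :=
  p.elim (if ζ = 0 then ∞ else ((ζ⁻¹ : ℂ) : OnePoint ℂ)) (fun a => ((a + ζ : ℂ) : OnePoint ℂ))

/-- The standard holomorphic coordinate used near the value `q`: the coordinate `w` if `q` is finite
(the value at `w = ∞` is irrelevant), and the coordinate `1 / w` if `q = ∞`. -/
def coord (q w : OnePoint ℂ) : ℂ :=
  q.elim (w.elim 0 (fun b => b⁻¹)) (fun _ => w.elim 0 (fun b => b))

/-- A map `B` from (an open subset of) `ℂ` to the Riemann sphere is holomorphic near `ζ`, that is,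
`B` is a meromorphic function there. -/
def IsHolomorphicAt (B : ℂ → OnePoint ℂ) (ζ : ℂ) : Prop :=
  ContinuousAt B ζ ∧ AnalyticAt ℂ (fun η => coord (B ζ) (B η)) ζ

/-- The density at `ζ` of the pull-back by `B` of the metric `4 |dw|² / (1 + |w|²)²`; the formula for
this metric is the same in the coordinate `1 / w`. -/
def pullbackRound (B : ℂ → OnePoint ℂ) (ζ : ℂ) : ℝ :=
  4 * ‖deriv (fun η => coord (B ζ) (B η)) ζ‖ ^ 2 / (1 + ‖coord (B ζ) (B ζ)‖ ^ 2) ^ 2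

/-- The Schwarzian derivative `h''' / h' - (3 / 2) (h'' / h')²`, where `h = B` where `B` is finite
and `h = 1 / B` at a pole of `B` (the Schwarzian derivatives of `B` and `1 / B` agree). -/
def schwarzian (B : ℂ → OnePoint ℂ) (ζ : ℂ) : ℂ :=
  let h : ℂ → ℂ := fun η => coord (B ζ) (B η)
  iteratedDeriv 3 h ζ / deriv h ζ - 3 / 2 * (iteratedDeriv 2 h ζ / deriv h ζ) ^ 2

/-- Inverse stereographic projection `w ↦ (2 Re w, 2 Im w, |w|² - 1) / (|w|² + 1)`, `∞ ↦ (0, 0, 1)`. -/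
def stereo (w : OnePoint ℂ) : Fin 3 → ℝ :=
  w.elim ![0, 0, 1] (fun b =>
    ![2 * b.re / (‖b‖ ^ 2 + 1), 2 * b.im / (‖b‖ ^ 2 + 1), (‖b‖ ^ 2 - 1) / (‖b‖ ^ 2 + 1)])

/-! ### Spherical conical metrics

A conformal metric is given by `g : OnePoint ℂ → ℝ`: at the point `p` the metric is `g p |dζ|²` in the
coordinate `ζ` of `param p`. So on `ℂ` it is `g z |dz|²`. Values at cone points carry no meaning. -/

/-- The density of the metric `g` in the coordinate `ζ` of `param p`, as a function of `ζ`. -/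
def density (g : OnePoint ℂ → ℝ) (p : OnePoint ℂ) (ζ : ℂ) : ℝ :=
  p.elim (if ζ = 0 then g ∞ else g ((ζ⁻¹ : ℂ) : OnePoint ℂ) / ‖ζ‖ ^ 4)
    (fun a => g ((a + ζ : ℂ) : OnePoint ℂ))

/-- `g` is a smooth conformal metric of constant curvature one near `p`: the curvature of `r |dζ|²`
is `- Δ (log r) / (2 r)`. -/
def IsSphericalAt (g : OnePoint ℂ → ℝ) (p : OnePoint ℂ) : Prop :=
  ContDiffAt ℝ (⊤ : ℕ∞) (density g p) 0 ∧ 0 < density g p 0 ∧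
    - Laplacian.laplacian (fun ζ => Real.log (density g p ζ)) 0 / (2 * density g p 0) = 1

/-- `g` has a conical singularity of angle `2 π β` at `p`: in some conformal coordinate `ζ` centred at
`p` one has `g = e^{2 u} |dζ|²`, where `u - (β - 1) log |ζ|` extends continuously to `ζ = 0`.
The coordinate is given by `ψ`, which expresses the standard coordinate in terms of `ζ`. -/
def IsConicalAt (g : OnePoint ℂ → ℝ) (p : OnePoint ℂ) (β : ℝ) : Prop :=
  ∃ ψ : ℂ → ℂ, AnalyticAt ℂ ψ 0 ∧ ψ 0 = 0 ∧ deriv ψ 0 ≠ 0 ∧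
    ∃ v : ℂ → ℝ, ContinuousAt v 0 ∧
      ∀ᶠ ζ in 𝓝[≠] (0 : ℂ), density g p (ψ ζ) * ‖deriv ψ ζ‖ ^ 2 =
        Real.exp (2 * (v ζ + (β - 1) * Real.log ‖ζ‖))

/-- `g` is a spherical conical metric on the sphere with cone points `P` and cone angles `2 π b p`,
`p ∈ P`. -/
def IsSphericalConicalMetric (g : OnePoint ℂ → ℝ) (P : Finset (OnePoint ℂ)) (b : OnePoint ℂ → ℝ) :
    Prop :=
  (∀ p ∈ P, 0 < b p ∧ IsConicalAt g p (b p)) ∧ ∀ p ∉ P, IsSphericalAt g p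

/-! ### Developing maps

A multivalued map on the sphere minus `P` is a single-valued map `F` on a connected covering space
`π : E → OnePoint ℂ ∖ P`. Its branches are the maps `F ∘ s`, with `s` a local section of `π`. -/

/-- Near `ζ`, the map `s` is a local section of `π`, written in the coordinate of `param p`. -/
def IsLocalLift {E : Type} [TopologicalSpace E] (π : E → OnePoint ℂ) (p : OnePoint ℂ) (s : ℂ → E)
    (ζ : ℂ) : Prop :=
  ContinuousAt s ζ ∧ ∀ᶠ η in 𝓝 ζ, π (s η) = param p η

/-- The multivalued map on the sphere minus `P` given by `F` on the covering `π : E → OnePoint ℂ ∖ P`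
is a developing map of the metric `g` with cone points `P` and cone angles `2 π b p`, `p ∈ P`. -/
structure IsDevelopingMap (g : OnePoint ℂ → ℝ) (P : Finset (OnePoint ℂ)) (b : OnePoint ℂ → ℝ)
    {E : Type} [TopologicalSpace E] (π : E → OnePoint ℂ) (F : E → OnePoint ℂ) : Prop where
  connected : ConnectedSpace E
  range_eq : Set.range π = {p | p ∉ P}
  covering : IsCoveringMapOn π {p | p ∉ P}
  /-- All branches are meromorphic. -/
  holomorphic : ∀ p ∉ P, ∀ s : ℂ → E, IsLocalLift π p s 0 → IsHolomorphicAt (F ∘ s) 0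
  /-- `g` is the pull-back of the round metric. -/
  pullback : ∀ p ∉ P, ∀ s : ℂ → E, IsLocalLift π p s 0 → pullbackRound (F ∘ s) 0 = density g p 0
  /-- The monodromy is in `PSU(2)`: any two branches near the same point differ by an element of
  `SU(2)`, acting on the Riemann sphere by Möbius transformations. -/
  monodromy : ∀ e e' : E, π e = π e' →
    ∃ A : GL (Fin 2) ℂ, (A : Matrix (Fin 2) (Fin 2) ℂ) ∈ Matrix.specialUnitaryGroup (Fin 2) ℂ ∧
      ∀ s s' : ℂ → E, s 0 = e → s' 0 = e' →
        IsLocalLift π (π e) s 0 → IsLocalLift π (π e) s' 0 →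
          ∀ᶠ ζ in 𝓝 (0 : ℂ), F (s' ζ) = A • F (s ζ)
  /-- At `p ∈ P` the Schwarzian derivative of the branches has the principal singular term
  `(1 - β²) / (2 ζ²)`, with `β = b p`. -/
  angle : ∀ p ∈ P, ∃ S : ℂ → ℂ,
    (∀ᶠ ζ in 𝓝[≠] (0 : ℂ), ∀ s : ℂ → E, IsLocalLift π p s ζ → schwarzian (F ∘ s) ζ = S ζ) ∧
      Tendsto (fun ζ => ζ ^ 2 * S ζ) (𝓝[≠] 0) (𝓝 ((1 - (b p : ℂ) ^ 2) / 2))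

/-! ### The Friedrichs Laplacian -/

/-- The area measure of `g` (the point `∞` is a null set, so it is a measure on `ℂ`). -/
def area (g : OnePoint ℂ → ℝ) : Measure ℂ :=
  volume.withDensity (fun z => ENNReal.ofReal (g (z : OnePoint ℂ)))

/-- Smooth real functions with compact support in the sphere minus `P`. -/
def IsTestFunction (P : Finset (OnePoint ℂ)) (φ : OnePoint ℂ → ℝ) : Prop :=
  (∀ p, ContDiffAt ℝ (⊤ : ℕ∞) (fun ζ => φ (param p ζ)) 0) ∧ tsupport φ ⊆ {p | p ∉ P}

/-- The form domain: the closure of the test functions in the norm given by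
`‖u‖² + ‖∇u‖²` in `L²(g)`. The Dirichlet integral is conformally invariant, so it is computed in
the flat coordinate `z`. -/
def InFormDomain (g : OnePoint ℂ → ℝ) (P : Finset (OnePoint ℂ)) (u : OnePoint ℂ → ℝ) : Prop :=
  MemLp (fun z : ℂ => u (z : OnePoint ℂ)) 2 (area g) ∧
  ∃ φ : ℕ → OnePoint ℂ → ℝ, (∀ n, IsTestFunction P (φ n)) ∧
    Tendsto (fun n => eLpNorm (fun z : ℂ => φ n (z : OnePoint ℂ) - u (z : OnePoint ℂ)) 2 (area g))
      atTop (𝓝 0) ∧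
    Tendsto (fun mn : ℕ × ℕ => eLpNorm (fun z : ℂ => fderiv ℝ
        (fun z : ℂ => φ mn.1 (z : OnePoint ℂ) - φ mn.2 (z : OnePoint ℂ)) z) 2 volume)
      atTop (𝓝 0)

/-- `u` is in the domain of the Friedrichs extension of the (nonnegative) Laplacian of `g` on test
functions, and its image is `v`: `u` is in the form domain, `v` is in `L²(g)`, and `⟨u, Δ_g φ⟩ = ⟨v, φ⟩`
in `L²(g)` for all test functions `φ`. Here `Δ_g φ = - Δ φ / g` with the flat Laplacian `Δ`. -/
def FriedrichsLaplacian (g : OnePoint ℂ → ℝ) (P : Finset (OnePoint ℂ)) (u v : OnePoint ℂ → ℝ) :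
    Prop :=
  InFormDomain g P u ∧ MemLp (fun z : ℂ => v (z : OnePoint ℂ)) 2 (area g) ∧
  ∀ φ : OnePoint ℂ → ℝ, IsTestFunction P φ →
    ∫ z : ℂ, u (z : OnePoint ℂ) *
        (- Laplacian.laplacian (fun z : ℂ => φ (z : OnePoint ℂ)) z) =
      ∫ z : ℂ, v (z : OnePoint ℂ) * φ (z : OnePoint ℂ) * g (z : OnePoint ℂ)

/-- `u` is a 2-eigenfunction in the Friedrichs domain: `Δ_g u = 2 u` holds for the Friedrichs
Laplacian, and `u` is smooth away from the cone points and satisfies the equation pointwise there. -/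
def IsTwoEigenfunction (g : OnePoint ℂ → ℝ) (P : Finset (OnePoint ℂ)) (u : OnePoint ℂ → ℝ) : Prop :=
  FriedrichsLaplacian g P u (fun p => 2 * u p) ∧
  ∀ p ∉ P, ContDiffAt ℝ (⊤ : ℕ∞) (fun ζ => u (param p ζ)) 0 ∧
    - Laplacian.laplacian (fun ζ => u (param p ζ)) 0 / density g p 0 = 2 * u p

/-- `u` is obtained by stereographic projection of a developing map of `g`: `u = (φ, s)` for a vector
`s ∈ ℝ³`, where `φ` is the (multivalued) map to the unit sphere given by the developing map. -/
def IsFromDevelopingMap (g : OnePoint ℂ → ℝ) (P : Finset (OnePoint ℂ)) (b : OnePoint ℂ → ℝ)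
    (u : OnePoint ℂ → ℝ) : Prop :=
  ∃ (E : Type) (_ : TopologicalSpace E) (π F : E → OnePoint ℂ), IsDevelopingMap g P b π F ∧
    ∃ s : Fin 3 → ℝ, ∀ e : E, u (π e) = stereo (F e) ⬝ᵥ s

/-- Extra eigenfunctions of the spherical conical metric `g`. -/
def IsExtraEigenfunction (g : OnePoint ℂ → ℝ) (P : Finset (OnePoint ℂ)) (b : OnePoint ℂ → ℝ)
    (u : OnePoint ℂ → ℝ) : Prop :=
  IsTwoEigenfunction g P u ∧ ¬ IsFromDevelopingMap g P b u

/-! ### The explicit family -/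

/-- The covering space of the sphere minus `P` on which the developing map lives:
all `ζ` with `exp ζ` not in `P`, with covering map `exp`. -/
abbrev ExpCover (P : Finset (OnePoint ℂ)) : Type :=
  {ζ : ℂ // ((Complex.exp ζ : ℂ) : OnePoint ℂ) ∉ P}

/-- The covering map `ζ ↦ exp ζ`. -/
def expProj (P : Finset (OnePoint ℂ)) (ζ : ExpCover P) : OnePoint ℂ :=
  ((Complex.exp ζ.1 : ℂ) : OnePoint ℂ)

/-- The multivalued function `f = z^β ((k - β) z^k - (k + β)) / (z^k + 1)`, as a function of
`ζ = log z`: here `z^β = exp (β ζ)` and `z = exp ζ`. Its value is `∞` at the zeros of `z^k + 1`. -/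
def devMap (β : ℝ) (k : ℕ) (P : Finset (OnePoint ℂ)) (ζ : ExpCover P) : OnePoint ℂ :=
  let z : ℂ := Complex.exp ζ.1
  if z ^ k + 1 = 0 then ∞ else
    ((Complex.exp (β * ζ.1) * ((k - β) * z ^ k - (k + β)) / (z ^ k + 1) : ℂ) : OnePoint ℂ)

/-- The function `h₁`. -/
def h₁ (β : ℝ) (k : ℕ) (z : ℂ) : ℂ :=
  ((‖z‖ : ℂ) ^ (2 * k) + z ^ k - (starRingEnd ℂ z) ^ k - 1) +
    ((‖z‖ ^ (2 * β) : ℝ) : ℂ) * ((k + β) ^ 2 - (k ^ 2 - β ^ 2) * (starRingEnd ℂ z) ^ k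
      + (k ^ 2 - β ^ 2) * z ^ k - (k - β) ^ 2 * (‖z‖ : ℂ) ^ (2 * k))

/-- The function `h₂`. -/
def h₂ (β : ℝ) (k : ℕ) (z : ℂ) : ℂ :=
  ((‖z‖ : ℂ) ^ (2 * k) + z ^ k + (starRingEnd ℂ z) ^ k + 1) +
    ((‖z‖ ^ (2 * β) : ℝ) : ℂ) * ((k + β) ^ 2 - (k ^ 2 - β ^ 2) * (starRingEnd ℂ z) ^ k
      - (k ^ 2 - β ^ 2) * z ^ k + (k - β) ^ 2 * (‖z‖ : ℂ) ^ (2 * k))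

/-- The function `h₁ / h₂`, with its limit `-1` as value at `∞`. -/
def hQuot (β : ℝ) (k : ℕ) (p : OnePoint ℂ) : ℂ :=
  p.elim (-1) (fun z => h₁ β k z / h₂ β k z)

end SphericalConical

end

/-!
# Extra eigenfunctions of a family of spherical conical metrics

Write `D = z ^ k + 1`, `G = z ^ β N` with `N = (k - β) z ^ k - (k + β)`, so that `f = G / D`. The
pull-back of the round metric by `f` has density `4 |D G' - G D'|² / (|D|² + |G|²)²` in the coordinate
`z`, and `|D|² + |G|² = h₂` is single-valued, because only `|z ^ β|` enters. The Wronskian is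
`D G' - G D' = z ^ (β - 1) R(z ^ k)` with `R` a quadratic polynomial. So away from `0` and `∞` the
metric degenerates only at the critical points of `f`, the zeros of `R(z ^ k)`; they are simple, and
the cone angles are `4 π` there and `2 π β` at `0` and `∞` (`isSphericalConicalMetric_coneMetric`). The
point `∞` is treated by the symmetry `z ↦ 1 / z`, which replaces `β` by `-β`.

*Eigenfunctions.* With `A = z ^ k - 1` and `C = - z ^ β ((k - β) z ^ k + (k + β))` one has
`h₁ = A D̄ + C Ḡ`. For holomorphic functions `A`, `C`, `D`, `G`,
`∂̄ ((A D̄ + C Ḡ) / (|D|² + |G|²)) = (C D - A G) conj (D G' - G D') / (|D|² + |G|²)²`.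
If the Wronskians of `(D, C)` and of `(G, A)` agree, applying `4 ∂` shows that the quotient is an
eigenfunction of the pulled back metric for the eigenvalue `2` (`laplacian_herm_div`). The explicit
family has this property (`IsPowBranch.wronskian_compat`).

*The Friedrichs domain.* The function `h₁ / h₂` is continuous on the sphere, and its gradient is of
order `|z| ^ min (0, 2 β - 1)` near `0`, and likewise near `∞`, so its Dirichlet energy is finite.
Finite sets have capacity zero: there are cut-off functions vanishing near the cone points, tending
to `1`, whose energy tends to `0` (`exists_isCutoffSeq`). So bounded functions of finite energy are
limits of test functions in the form norm, and Green's formula gives the weak equation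
(`isTwoEigenfunction_of_energy`).

*Extra eigenfunctions.* A function `⟨φ, s⟩` obtained from a developing map is the composition of a
local isometry into the round sphere with a linear function, so its gradient in the coordinate `z`
satisfies `|∇u|² ≤ K g` (`IsDevelopingMap.exists_norm_fderiv_sq_le`). At a critical point of `f` the
density `g` vanishes, while `∂ (h₁ / h₂) ≠ 0` and `∂̄ (h₁ / h₂) = 0`, so the gradient of every nonzero
real combination of the real and imaginary parts of `h₁ / h₂` is nonzero there.

*The developing map.* On the covering by `exp` of the sphere minus the cone points, every branch of
`f` is a quotient `G / D` with `z ^ β` replaced by `exp (β ℓ)`, where `ℓ` is a branch of the logarithm.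
Two branches differ by the factor `exp (2 π i n β)`, a rotation of the sphere. The Schwarzian
derivative is `T' - T² / 2`, where `T = f'' / f'` has a simple pole at each cone point, with residue
the cone angle divided by `2 π` minus `1` at finite points (and `-β - 1` at `∞`), which gives its
principal singular term.
-/


noncomputable section

namespace SphericalConical

open Filter Topology MeasureTheory OnePoint

open scoped ComplexConjugate

/-! ### Wirtinger calculus -/

/-- The real-linear map `v ↦ p v + q v̄`. -/
def wirtinger (p q : ℂ) : ℂ →L[ℝ] ℂ :=
  p • ContinuousLinearMap.id ℝ ℂ + q • (Complex.conjCLE : ℂ →L[ℝ] ℂ)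

@[simp] lemma wirtinger_apply (p q v : ℂ) : wirtinger p q v = p * v + q * conj v := by
  simp [wirtinger]

/-- `F` is real differentiable at `z`, with Wirtinger derivatives `∂F = p` and `∂̄F = q`. -/
def HasWirtingerAt (F : ℂ → ℂ) (p q z : ℂ) : Prop :=
  HasFDerivAt F (wirtinger p q) z

namespace HasWirtingerAt

variable {F G : ℂ → ℂ} {p q r s z : ℂ}

lemma const (c z : ℂ) : HasWirtingerAt (fun _ => c) 0 0 z := by
  have : wirtinger 0 0 = 0 := by ext; simp
  rw [HasWirtingerAt, this]; exact hasFDerivAt_const c z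

lemma of_hasDerivAt (h : HasDerivAt F p z) : HasWirtingerAt F p 0 z := by
  have := h.hasFDerivAt.restrictScalars ℝ
  refine this.congr_fderiv ?_
  ext v; simp [mul_comm]

lemma congr_deriv (h : HasWirtingerAt F p q z) {p' q' : ℂ} (hp : p = p') (hq : q = q') :
    HasWirtingerAt F p' q' z := by subst hp hq; exact h

lemma congr_of_eventuallyEq (h : HasWirtingerAt F p q z) (hG : G =ᶠ[𝓝 z] F) :
    HasWirtingerAt G p q z :=
  HasFDerivAt.congr_of_eventuallyEq h hG

lemma star (h : HasWirtingerAt F p q z) :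
    HasWirtingerAt (fun w => conj (F w)) (conj q) (conj p) z := by
  have := ((Complex.conjCLE : ℂ →L[ℝ] ℂ).hasFDerivAt (x := F z)).comp z h
  refine HasFDerivAt.congr_fderiv (f' := (Complex.conjCLE : ℂ →L[ℝ] ℂ).comp (wirtinger p q)) ?_ ?_
  · exact this
  · refine ContinuousLinearMap.ext fun v => ?_
    simp; ring

lemma add (h : HasWirtingerAt F p q z) (h' : HasWirtingerAt G r s z) :
    HasWirtingerAt (fun w => F w + G w) (p + r) (q + s) z := by
  refine (HasFDerivAt.add h h').congr_fderiv ?_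
  refine ContinuousLinearMap.ext fun v => ?_
  simp; ring

lemma mul (h : HasWirtingerAt F p q z) (h' : HasWirtingerAt G r s z) :
    HasWirtingerAt (fun w => F w * G w) (p * G z + F z * r) (q * G z + F z * s) z := by
  refine (HasFDerivAt.mul h h').congr_fderiv ?_
  refine ContinuousLinearMap.ext fun v => ?_
  simp; ring

/-- The chain rule for a holomorphic outer function. -/
lemma comp_hasDerivAt {φ : ℂ → ℂ} {c : ℂ} (hφ : HasDerivAt φ c (F z))
    (h : HasWirtingerAt F p q z) :
    HasWirtingerAt (fun w => φ (F w)) (c * p) (c * q) z := by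
  have := (hφ.hasFDerivAt.restrictScalars ℝ).comp z h
  refine HasFDerivAt.congr_fderiv this ?_
  refine ContinuousLinearMap.ext fun v => ?_
  simp; ring

lemma inv (h : HasWirtingerAt F p q z) (hz : F z ≠ 0) :
    HasWirtingerAt (fun w => (F w)⁻¹) (-p / F z ^ 2) (-q / F z ^ 2) z := by
  refine (h.comp_hasDerivAt (hasDerivAt_inv hz)).congr_deriv ?_ ?_ <;> ring

lemma div (h : HasWirtingerAt F p q z) (h' : HasWirtingerAt G r s z) (hz : G z ≠ 0) :
    HasWirtingerAt (fun w => F w / G w) ((p * G z - F z * r) / G z ^ 2)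
      ((q * G z - F z * s) / G z ^ 2) z := by
  simp only [div_eq_mul_inv]
  refine (h.mul (h'.inv hz)).congr_deriv ?_ ?_ <;> field_simp <;> ring

lemma hasFDerivAt_re (h : HasWirtingerAt F p q z) :
    HasFDerivAt (fun w => (F w).re) (Complex.reCLM.comp (wirtinger p q)) z :=
  (Complex.reCLM.hasFDerivAt (x := F z)).comp z h

end HasWirtingerAt

/-- The Laplacian is `4 ∂∂̄`. -/
lemma laplacian_eq_of_hasWirtingerAt {F p q : ℂ → ℂ} {z p₁ p₂ q₁ q₂ : ℂ}
    (hF : ∀ᶠ w in 𝓝 z, HasWirtingerAt F (p w) (q w) w)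
    (hp : HasWirtingerAt p p₁ p₂ z) (hq : HasWirtingerAt q q₁ q₂ z) :
    Laplacian.laplacian F z = 4 * q₁ := by
  have h2' : HasFDerivAt q (wirtinger q₁ q₂) z := hq
  have h2 : HasFDerivAt (fun w => wirtinger (p w) (q w))
      ((wirtinger p₁ p₂).smulRight (ContinuousLinearMap.id ℝ ℂ) +
        (wirtinger q₁ q₂).smulRight (Complex.conjCLE : ℂ →L[ℝ] ℂ)) z := by
    exact (HasFDerivAt.smul_const hp _).add (h2'.smul_const (Complex.conjCLE : ℂ →L[ℝ] ℂ))
  -- the mixed derivatives `∂̄∂F` and `∂∂̄F` agree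
  have hsymm : p₂ = q₁ := by
    have := second_derivative_symmetric_of_eventually hF h2 1 Complex.I
    simp at this
    linear_combination (-Complex.I / 2) * this + (p₂ - q₁) * Complex.I_sq
  have key : ∀ v : ℂ, iteratedFDeriv ℝ 2 F z ![v, v] =
      (wirtinger p₁ p₂ v) * v + (wirtinger q₁ q₂ v) * conj v := by
    intro v
    rw [iteratedFDeriv_two_apply]
    have h1 : fderiv ℝ F =ᶠ[𝓝 z] fun w => wirtinger (p w) (q w) := by
      filter_upwards [hF] with w hw using hw.fderiv
    rw [h1.fderiv_eq, h2.fderiv]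
    simp
  rw [InnerProductSpace.laplacian_eq_iteratedFDeriv_complexPlane]
  simp only [key, wirtinger_apply]
  simp only [map_one, Complex.conj_I]
  linear_combination (p₁ - p₂ - q₁ + q₂) * Complex.I_sq + 2 * hsymm

lemma HasWirtingerAt.log_ofReal {r : ℂ → ℝ} {p q z : ℂ}
    (h : HasWirtingerAt (fun w => (r w : ℂ)) p q z) (hz : 0 < r z) :
    HasWirtingerAt (fun w => (Real.log (r w) : ℂ)) (p / r z) (q / r z) z := by
  have h1 : HasDerivAt Complex.log (r z : ℂ)⁻¹ (r z : ℂ) :=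
    Complex.hasDerivAt_log (Complex.ofReal_mem_slitPlane.2 hz)
  have hre : HasFDerivAt r (Complex.reCLM.comp (wirtinger p q)) z := by
    simpa using h.hasFDerivAt_re
  refine ((h.comp_hasDerivAt h1).congr_of_eventuallyEq ?_).congr_deriv ?_ ?_
  · filter_upwards [hre.continuousAt.eventually (lt_mem_nhds hz)] with w hw
    exact Complex.ofReal_log hw.le
  · field_simp
  · field_simp

lemma ofReal_laplacian {f : ℂ → ℝ} {z : ℂ} (hf : ContDiffAt ℝ 2 f z) :
    (Laplacian.laplacian f z : ℂ) = Laplacian.laplacian (fun w => (f w : ℂ)) z :=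
  (hf.laplacian_CLM_comp_left (l := Complex.ofRealCLM)).symm

/-! ### Metrics and eigenfunctions given by pairs of holomorphic functions -/

/-- The Hermitian form `A D̄ + C Ḡ` of the pairs `(A, C)` and `(D, G)`. -/
def herm (A C D G : ℂ → ℂ) (w : ℂ) : ℂ := A w * conj (D w) + C w * conj (G w)

/-- The Wronskian `D G' - G D'`. The derivative of `G / D` is `wronskian D G / D²`. -/
def wronskian (D G : ℂ → ℂ) (w : ℂ) : ℂ := D w * deriv G w - G w * deriv D w

lemma herm_self (D G : ℂ → ℂ) (w : ℂ) : herm D G D G w = ((‖D w‖ ^ 2 + ‖G w‖ ^ 2 : ℝ) : ℂ) := by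
  simp [herm, Complex.mul_conj, Complex.normSq_eq_norm_sq]

section Pairs

variable {A C D G : ℂ → ℂ} {a : ℂ}

lemma hasWirtingerAt_herm (hA : AnalyticAt ℂ A a) (hC : AnalyticAt ℂ C a) (hD : AnalyticAt ℂ D a)
    (hG : AnalyticAt ℂ G a) :
    HasWirtingerAt (herm A C D G) (deriv A a * conj (D a) + deriv C a * conj (G a))
      (A a * conj (deriv D a) + C a * conj (deriv G a)) a := by
  have h := fun {F : ℂ → ℂ} (hF : AnalyticAt ℂ F a) =>
    HasWirtingerAt.of_hasDerivAt hF.differentiableAt.hasDerivAt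
  refine (((h hA).mul (h hD).star).add ((h hC).mul (h hG).star)).congr_deriv ?_ ?_ <;> simp

lemma hasWirtingerAt_herm_div (hA : AnalyticAt ℂ A a) (hC : AnalyticAt ℂ C a)
    (hD : AnalyticAt ℂ D a) (hG : AnalyticAt ℂ G a) (h0 : herm D G D G a ≠ 0) :
    HasWirtingerAt (fun w => herm A C D G w / herm D G D G w)
      (((deriv A a * conj (D a) + deriv C a * conj (G a)) * herm D G D G a -
        herm A C D G a * (deriv D a * conj (D a) + deriv G a * conj (G a))) / herm D G D G a ^ 2)
      (-((A a * G a - C a * D a) * conj (wronskian D G a)) / herm D G D G a ^ 2) a := by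
  refine ((hasWirtingerAt_herm hA hC hD hG).div (hasWirtingerAt_herm hD hG hD hG) h0).congr_deriv
    rfl ?_
  congr 1
  simp only [herm, wronskian, map_sub, map_mul]
  ring

/-- If the Wronskians of `(D, C)` and of `(G, A)` agree, the quotient `(A D̄ + C Ḡ) / (|D|² + |G|²)`
is an eigenfunction for the eigenvalue `2` of the metric with density
`4 |D G' - G D'|² / (|D|² + |G|²)²`. -/
lemma laplacian_herm_div (hA : AnalyticAt ℂ A a) (hC : AnalyticAt ℂ C a) (hD : AnalyticAt ℂ D a)
    (hG : AnalyticAt ℂ G a) (h0 : herm D G D G a ≠ 0)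
    (hrel : wronskian D C a = wronskian G A a) :
    Laplacian.laplacian (fun w => herm A C D G w / herm D G D G w) a =
      -2 * ((4 * ‖wronskian D G a‖ ^ 2 / (‖D a‖ ^ 2 + ‖G a‖ ^ 2) ^ 2 : ℝ) : ℂ) *
        (herm A C D G a / herm D G D G a) := by
  have hQ := hasWirtingerAt_herm hD hG hD hG
  have hcont : ContinuousAt (herm D G D G) a := HasFDerivAt.continuousAt hQ
  have hF := (((hA.eventually_analyticAt.and hC.eventually_analyticAt).and
    (hD.eventually_analyticAt.and hG.eventually_analyticAt)).and (hcont.eventually_ne h0)).mono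
      fun w h => hasWirtingerAt_herm_div h.1.1.1 h.1.1.2 h.1.2.1 h.1.2.2 h.2
  have h := fun {F : ℂ → ℂ} (hF : AnalyticAt ℂ F a) =>
    HasWirtingerAt.of_hasDerivAt hF.differentiableAt.hasDerivAt
  have hinv2 := hQ.comp_hasDerivAt (φ := fun t => (t ^ 2)⁻¹)
    ((hasDerivAt_pow 2 (herm D G D G a)).inv (pow_ne_zero 2 h0))
  have hp := ((((h hA.deriv).mul (h hD).star).add ((h hC.deriv).mul (h hG).star)).mul hQ).add
    ((((hasWirtingerAt_herm hA hC hD hG).mul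
      (((h hD.deriv).mul (h hD).star).add ((h hG.deriv).mul (h hG).star))).mul
        (HasWirtingerAt.const (-1) a)))
  have hW : HasDerivAt (wronskian D G) _ a :=
    (hD.differentiableAt.hasDerivAt.mul hG.deriv.differentiableAt.hasDerivAt).sub
      (hG.differentiableAt.hasDerivAt.mul hD.deriv.differentiableAt.hasDerivAt)
  -- `∂̄` of the quotient is `(C D - A G) conj (wronskian D G) / (|D|² + |G|²)²`
  have hL : HasDerivAt (fun w => C w * D w - A w * G w) _ a :=
    (hC.differentiableAt.hasDerivAt.mul hD.differentiableAt.hasDerivAt).sub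
      (hA.differentiableAt.hasDerivAt.mul hG.differentiableAt.hasDerivAt)
  have hq := ((HasWirtingerAt.of_hasDerivAt hL).mul (HasWirtingerAt.of_hasDerivAt hW).star).mul hinv2
  rw [laplacian_eq_of_hasWirtingerAt hF
    ((hp.mul hinv2).congr_of_eventuallyEq (Eventually.of_forall fun w => ?_))
    (hq.congr_of_eventuallyEq (Eventually.of_forall fun w => ?_))]
  · have e1 : ((4 * ‖wronskian D G a‖ ^ 2 / (‖D a‖ ^ 2 + ‖G a‖ ^ 2) ^ 2 : ℝ) : ℂ) =
        4 * (wronskian D G a * conj (wronskian D G a)) / herm D G D G a ^ 2 := by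
      rw [herm_self]; simp [Complex.mul_conj, Complex.normSq_eq_norm_sq]
    rw [e1]
    -- the only place where `hrel` enters
    have key : (deriv C a * D a + C a * deriv D a - (deriv A a * G a + A a * deriv G a)) *
        herm D G D G a - 2 * (C a * D a - A a * G a) *
          (deriv D a * conj (D a) + deriv G a * conj (G a)) =
        -2 * wronskian D G a * herm A C D G a := by
      simp only [wronskian, herm] at hrel ⊢
      linear_combination (D a * conj (D a) + G a * conj (G a)) * hrel
    field_simp
    simp only [Nat.cast_ofNat, map_zero, Nat.add_one_sub_one, pow_one]
    linear_combination (conj (wronskian D G a) * herm D G D G a) * key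
  · ring
  · ring

lemma hasWirtingerAt_log_metric (hD : AnalyticAt ℂ D a) (hG : AnalyticAt ℂ G a)
    (h0 : herm D G D G a ≠ 0) (hW : wronskian D G a ≠ 0) :
    HasWirtingerAt
      (fun w => (Real.log (4 * ‖wronskian D G w‖ ^ 2 / (‖D w‖ ^ 2 + ‖G w‖ ^ 2) ^ 2) : ℂ))
      (deriv (wronskian D G) a / wronskian D G a -
        2 * (deriv D a * conj (D a) + deriv G a * conj (G a)) / herm D G D G a)
      (conj (deriv (wronskian D G) a) / conj (wronskian D G a) -
        2 * (D a * conj (deriv D a) + G a * conj (deriv G a)) / herm D G D G a) a := by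
  have hWa : AnalyticAt ℂ (wronskian D G) a := (hD.mul hG.deriv).sub (hG.mul hD.deriv)
  have hQ := hasWirtingerAt_herm hD hG hD hG
  have hW1 := HasWirtingerAt.of_hasDerivAt hWa.differentiableAt.hasDerivAt
  have hcw : conj (wronskian D G a) ≠ 0 := by simpa using hW
  have e : ∀ w, ((4 * ‖wronskian D G w‖ ^ 2 / (‖D w‖ ^ 2 + ‖G w‖ ^ 2) ^ 2 : ℝ) : ℂ) =
      4 * (wronskian D G w * conj (wronskian D G w)) / (herm D G D G w * herm D G D G w) := by
    intro w
    rw [herm_self]; simp [Complex.mul_conj, Complex.normSq_eq_norm_sq]; ring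
  have h1 := ((HasWirtingerAt.const 4 a).mul (hW1.mul hW1.star)).div (hQ.mul hQ)
    (mul_ne_zero h0 h0)
  have h2 := (h1.congr_of_eventuallyEq (Eventually.of_forall e)).log_ofReal ?_
  · refine h2.congr_deriv ?_ ?_ <;>
    · rw [e]
      simp only [map_zero, zero_mul]
      field_simp
      ring
  · have : 0 < ‖D a‖ ^ 2 + ‖G a‖ ^ 2 := by
      refine lt_of_le_of_ne (by positivity) fun h => h0 ?_
      rw [herm_self, ← h]; simp
    have := norm_pos_iff.2 hW
    positivity

/-- The metric with density `4 |D G' - G D'|² / (|D|² + |G|²)²` has curvature one. -/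
lemma laplacian_log_metric (hD : AnalyticAt ℂ D a) (hG : AnalyticAt ℂ G a)
    (h0 : herm D G D G a ≠ 0) (hW : wronskian D G a ≠ 0) :
    Laplacian.laplacian
      (fun w => (Real.log (4 * ‖wronskian D G w‖ ^ 2 / (‖D w‖ ^ 2 + ‖G w‖ ^ 2) ^ 2) : ℂ)) a =
      -2 * ((4 * ‖wronskian D G a‖ ^ 2 / (‖D a‖ ^ 2 + ‖G a‖ ^ 2) ^ 2 : ℝ) : ℂ) := by
  have hWa : AnalyticAt ℂ (wronskian D G) a := (hD.mul hG.deriv).sub (hG.mul hD.deriv)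
  have hQ := hasWirtingerAt_herm hD hG hD hG
  have hcont : ContinuousAt (herm D G D G) a := HasFDerivAt.continuousAt hQ
  have hcw : conj (wronskian D G a) ≠ 0 := by simpa using hW
  have hF := ((hD.eventually_analyticAt.and hG.eventually_analyticAt).and
    ((hcont.eventually_ne h0).and (hWa.continuousAt.eventually_ne hW))).mono
      fun w h => hasWirtingerAt_log_metric h.1.1 h.1.2 h.2.1 h.2.2
  have h := fun {F : ℂ → ℂ} (hF : AnalyticAt ℂ F a) =>
    HasWirtingerAt.of_hasDerivAt hF.differentiableAt.hasDerivAt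
  have hp := ((h hWa.deriv).div (h hWa) hW).add
    ((((HasWirtingerAt.const (-2) a).mul
      (((h hD.deriv).mul (h hD).star).add ((h hG.deriv).mul (h hG).star)))).div hQ h0)
  have hq := (((h hWa.deriv).star).div (h hWa).star hcw).add
    ((((HasWirtingerAt.const (-2) a).mul
      (((h hD).mul (h hD.deriv).star).add ((h hG).mul (h hG.deriv).star)))).div hQ h0)
  rw [laplacian_eq_of_hasWirtingerAt hF
    (hp.congr_of_eventuallyEq (Eventually.of_forall fun w => ?_))
    (hq.congr_of_eventuallyEq (Eventually.of_forall fun w => ?_))]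
  · have e1 : ((4 * ‖wronskian D G a‖ ^ 2 / (‖D a‖ ^ 2 + ‖G a‖ ^ 2) ^ 2 : ℝ) : ℂ) =
        4 * (wronskian D G a * conj (wronskian D G a)) / herm D G D G a ^ 2 := by
      rw [herm_self]; simp [Complex.mul_conj, Complex.normSq_eq_norm_sq]
    rw [e1]
    simp only [map_zero]
    field_simp
    simp only [wronskian, herm, map_sub, map_mul]
    ring
  · ring
  · ring

end Pairs

/-! ### The pairs of holomorphic functions of the explicit family -/

/-- The denominator `z ^ k + 1` of the developing map. -/
def den (k : ℕ) (z : ℂ) : ℂ := z ^ k + 1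

/-- The numerator of the developing map, without the factor `z ^ β`. -/
def num (β : ℝ) (k : ℕ) (z : ℂ) : ℂ := (k - β) * z ^ k - (k + β)

/-- The polynomial `z ^ k - 1`, the coefficient of `conj (den k z)` in `h₁`. -/
def den' (k : ℕ) (z : ℂ) : ℂ := z ^ k - 1

/-- Up to sign, the coefficient of `|z| ^ (2 β) conj (num β k z)` in `h₁`. -/
def num' (β : ℝ) (k : ℕ) (z : ℂ) : ℂ := (k - β) * z ^ k + (k + β)

/-- The polynomial function of `z` whose zeros are the critical points of the developing map in `ℂ ∖ {0}`. -/
def crit (β : ℝ) (k : ℕ) (z : ℂ) : ℂ :=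
  β * (k - β) * (z ^ k) ^ 2 + 2 * (k ^ 2 - β ^ 2) * z ^ k - β * (k + β)

/-- The sum `|den|² + |z| ^ (2 β) |num|²`, that is, `h₂` as a real function. -/
def normSum (β : ℝ) (k : ℕ) (z : ℂ) : ℝ :=
  ‖den k z‖ ^ 2 + ‖z‖ ^ (2 * β) * ‖num β k z‖ ^ 2

/-- The density of the metric in the coordinate `z`. (Its value at `z = 0` carries no meaning.) -/
def planeMetric (β : ℝ) (k : ℕ) (z : ℂ) : ℝ :=
  4 * (‖z‖ ^ (2 * β - 2) * ‖crit β k z‖ ^ 2) / normSum β k z ^ 2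

lemma normSum_def' (β : ℝ) (k : ℕ) (z : ℂ) : (normSum β k z : ℂ) =
    den k z * conj (den k z) + ((‖z‖ ^ (2 * β) : ℝ) : ℂ) * (num β k z * conj (num β k z)) := by
  simp [normSum, Complex.mul_conj, Complex.normSq_eq_norm_sq]

lemma h₂_eq (β : ℝ) (k : ℕ) (z : ℂ) : h₂ β k z = normSum β k z := by
  have e : (‖z‖ : ℂ) ^ (2 * k) = z ^ k * conj z ^ k := by
    rw [pow_mul, ← mul_pow, Complex.mul_conj, Complex.normSq_eq_norm_sq]; simp
  rw [normSum_def', h₂, e]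
  simp only [den, num, map_add, map_sub, map_mul, map_pow, map_one, Complex.conj_ofReal, map_natCast]
  ring

lemma h₁_eq (β : ℝ) (k : ℕ) (z : ℂ) : h₁ β k z = den' k z * conj (den k z) -
    ((‖z‖ ^ (2 * β) : ℝ) : ℂ) * (num' β k z * conj (num β k z)) := by
  have e : (‖z‖ : ℂ) ^ (2 * k) = z ^ k * conj z ^ k := by
    rw [pow_mul, ← mul_pow, Complex.mul_conj, Complex.normSq_eq_norm_sq]; simp
  rw [h₁, e]
  simp only [den, num, den', num', map_add, map_sub, map_mul, map_pow, map_one,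
    Complex.conj_ofReal, map_natCast]
  ring

lemma num_ne_zero_of_den_eq_zero {β : ℝ} {k : ℕ} (hk : 0 < k) {z : ℂ} (h : den k z = 0) :
    num β k z ≠ 0 := by
  have h1 : z ^ k = -1 := eq_neg_of_add_eq_zero_left h
  rw [num, h1]
  have : (k : ℂ) ≠ 0 := by exact_mod_cast hk.ne'
  intro h2
  apply this
  linear_combination (-1 / 2 : ℂ) * h2

lemma crit_ne_zero_of_den_eq_zero {β : ℝ} {k : ℕ} (hk : 0 < k) {z : ℂ} (h : den k z = 0) :
    crit β k z ≠ 0 := by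
  have h1 : z ^ k = -1 := eq_neg_of_add_eq_zero_left h
  rw [crit, h1]
  have : (k : ℂ) ^ 2 ≠ 0 := pow_ne_zero 2 (by exact_mod_cast hk.ne')
  intro h2
  apply this
  linear_combination (-1 / 2 : ℂ) * h2

lemma den_zero {k : ℕ} (hk : 0 < k) : den k 0 = 1 := by simp [den, hk.ne']

lemma num_zero {β : ℝ} {k : ℕ} (hk : 0 < k) : num β k 0 = -(k + β) := by simp [num, hk.ne']

lemma crit_zero {β : ℝ} {k : ℕ} (hk : 0 < k) : crit β k 0 = -(β * (k + β)) := by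
  simp [crit, hk.ne']

lemma normSum_pos {β : ℝ} {k : ℕ} (hk : 0 < k) (z : ℂ) : 0 < normSum β k z := by
  by_cases h : den k z = 0
  · have hz : z ≠ 0 := by rintro rfl; simp [den_zero hk] at h
    have := norm_pos_iff.2 (num_ne_zero_of_den_eq_zero (β := β) hk h)
    have := norm_pos_iff.2 hz
    unfold normSum; positivity
  · have := norm_pos_iff.2 h
    unfold normSum; positivity

lemma h₂_ne_zero {β : ℝ} {k : ℕ} (hk : 0 < k) (z : ℂ) : h₂ β k z ≠ 0 := by
  rw [h₂_eq]; exact_mod_cast (normSum_pos hk z).ne'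

@[fun_prop] lemma analyticAt_den (k : ℕ) (a : ℂ) : AnalyticAt ℂ (den k) a := by
  unfold den; fun_prop

@[fun_prop] lemma analyticAt_den' (k : ℕ) (a : ℂ) : AnalyticAt ℂ (den' k) a := by
  unfold den'; fun_prop

@[fun_prop] lemma analyticAt_num (β : ℝ) (k : ℕ) (a : ℂ) : AnalyticAt ℂ (num β k) a := by
  unfold num; fun_prop

@[fun_prop] lemma analyticAt_num' (β : ℝ) (k : ℕ) (a : ℂ) : AnalyticAt ℂ (num' β k) a := by
  unfold num'; fun_prop

@[fun_prop] lemma analyticAt_crit (β : ℝ) (k : ℕ) (a : ℂ) : AnalyticAt ℂ (crit β k) a := by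
  unfold crit; fun_prop

lemma mul_pow_sub_one {k : ℕ} (hk : 0 < k) (z : ℂ) : z * z ^ (k - 1) = z ^ k := by
  rw [← pow_succ', Nat.sub_add_cancel hk]

lemma deriv_den (k : ℕ) (z : ℂ) : deriv (den k) z = k * z ^ (k - 1) :=
  (((hasDerivAt_pow k z)).add_const 1).deriv

lemma deriv_den' (k : ℕ) (z : ℂ) : deriv (den' k) z = k * z ^ (k - 1) :=
  (((hasDerivAt_pow k z)).sub_const 1).deriv

lemma deriv_num (β : ℝ) (k : ℕ) (z : ℂ) : deriv (num β k) z = (k - β) * (k * z ^ (k - 1)) :=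
  (((hasDerivAt_pow k z).const_mul (k - β : ℂ)).sub_const _).deriv

lemma deriv_num' (β : ℝ) (k : ℕ) (z : ℂ) : deriv (num' β k) z = (k - β) * (k * z ^ (k - 1)) :=
  (((hasDerivAt_pow k z).const_mul (k - β : ℂ)).add_const _).deriv

lemma hasDerivAt_crit (β : ℝ) (k : ℕ) (z : ℂ) : HasDerivAt (crit β k)
    (k * z ^ (k - 1) * (2 * (k - β) * (β * z ^ k + (k + β)))) z := by
  have h := hasDerivAt_pow k z
  have := (((h.pow 2).const_mul (β * (k - β) : ℂ)).add
    (h.const_mul (2 * (k ^ 2 - β ^ 2) : ℂ))).sub_const (β * (k + β) : ℂ)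
  refine this.congr_deriv ?_
  push_cast
  ring

/-- All critical points of the developing map in `ℂ ∖ {0}` are simple. -/
lemma deriv_crit_ne_zero {β : ℝ} {k : ℕ} (hβ : 0 < β) (hk : β < k) {z : ℂ} (h : crit β k z = 0) :
    deriv (crit β k) z ≠ 0 := by
  have hk0 : 0 < k := by exact_mod_cast hβ.trans hk
  have hz : z ≠ 0 := by
    rintro rfl
    rw [crit_zero hk0] at h
    have : (0 : ℝ) < β * (k + β) := by positivity
    exact this.ne' (by exact_mod_cast neg_eq_zero.1 h)
  have hkC : (k : ℂ) ≠ 0 := by exact_mod_cast hk0.ne'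
  have h1 : (k - β : ℂ) ≠ 0 := by exact_mod_cast (sub_pos.2 hk).ne'
  have h2 : (k + β : ℂ) ≠ 0 := by
    have : (0 : ℝ) < k + β := by positivity
    exact_mod_cast this.ne'
  rw [(hasDerivAt_crit β k z).deriv]
  refine mul_ne_zero (mul_ne_zero hkC (pow_ne_zero _ hz)) (mul_ne_zero (mul_ne_zero two_ne_zero h1) ?_)
  intro h3
  -- otherwise `β z ^ k = -(k + β)`, and `β * crit = -(k + β) k²`
  have : (k + β : ℂ) * k ^ 2 = 0 := by
    unfold crit at h
    linear_combination (-β) * h + ((k - β) * (β * z ^ k + (k + β))) * h3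
  simp_all

/-! ### Branches of powers -/

/-- Near `a`, the function `E` is a holomorphic branch of `z ^ β`, up to a constant of modulus
one. -/
def IsPowBranch (β : ℝ) (E : ℂ → ℂ) (a : ℂ) : Prop :=
  ∀ᶠ z in 𝓝 a, HasDerivAt E (β * E z / z) z ∧ ‖E z‖ = ‖z‖ ^ β

/-- Continuous branches of the logarithm near `a` differ from the principal branch, rotated, by a
constant. -/
lemma eventually_eq_add_log {ℓ : ℂ → ℂ} {a : ℂ} (hc : ContinuousAt ℓ a)
    (h : ∀ᶠ z in 𝓝 a, Complex.exp (ℓ z) = z) :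
    ∀ᶠ z in 𝓝 a, ℓ z = ℓ a + Complex.log (z / a) := by
  have h1 : ContinuousAt (fun z => (ℓ z - ℓ a).im) a := by fun_prop
  have h2 : ∀ᶠ z in 𝓝 a, (ℓ z - ℓ a).im ∈ Set.Ioo (-Real.pi) Real.pi :=
    h1.eventually (isOpen_Ioo.mem_nhds (by simp [Real.pi_pos]))
  have h3 := h.self_of_nhds
  filter_upwards [h, h2] with z hz hz2
  have h4 : z / a = Complex.exp (ℓ z - ℓ a) := by rw [Complex.exp_sub, hz, h3]
  rw [h4, Complex.log_exp hz2.1 hz2.2.le]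
  ring

lemma isPowBranch_exp (β : ℝ) {ℓ : ℂ → ℂ} {a : ℂ} (ha : a ≠ 0) (hc : ContinuousAt ℓ a)
    (h : ∀ᶠ z in 𝓝 a, Complex.exp (ℓ z) = z) :
    IsPowBranch β (fun z => Complex.exp (β * ℓ z)) a := by
  have h1 : ∀ᶠ z in 𝓝 a, z / a ∈ Complex.slitPlane := by
    have : ContinuousAt (fun z : ℂ => z / a) a := by fun_prop
    exact this.eventually (Complex.isOpen_slitPlane.mem_nhds (by simp [ha]))
  filter_upwards [h1, eventually_ne_nhds ha, h, (eventually_eq_add_log hc h).eventually_nhds]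
    with z hz hz0 hzℓ hlog
  constructor
  · have h2 : HasDerivAt (fun z : ℂ => z / a) (1 / a) z := (hasDerivAt_id z).div_const a
    have h3 := (((h2.clog hz).const_add (ℓ a)).congr_of_eventuallyEq hlog).const_mul (β : ℂ)
    refine h3.cexp.congr_deriv ?_
    field_simp
  · have h2 : ‖z‖ = Real.exp (ℓ z).re := by rw [← Complex.norm_exp, hzℓ]
    rw [h2, Complex.norm_exp, ← Real.exp_mul]
    congr 1
    simp [mul_comm]

lemma exists_isPowBranch (β : ℝ) {a : ℂ} (ha : a ≠ 0) : ∃ E, IsPowBranch β E a := by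
  have h1 : ∀ᶠ z in 𝓝 a, Complex.exp (Complex.log (z / a) + Complex.log a) = z := by
    filter_upwards [eventually_ne_nhds ha] with z hz
    rw [Complex.exp_add, Complex.exp_log (div_ne_zero hz ha), Complex.exp_log ha,
      div_mul_cancel₀ z ha]
  refine ⟨_, isPowBranch_exp β ha ?_ h1⟩
  have h2 : ContinuousAt (fun z : ℂ => z / a) a := by fun_prop
  exact (h2.clog (by simp [ha])).add continuousAt_const

namespace IsPowBranch

variable {β : ℝ} {E : ℂ → ℂ} {a : ℂ}

lemma eventually (h : IsPowBranch β E a) : ∀ᶠ z in 𝓝 a, IsPowBranch β E z :=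
  eventually_eventually_nhds.2 h

lemma analyticAt (h : IsPowBranch β E a) : AnalyticAt ℂ E a :=
  Complex.analyticAt_iff_eventually_differentiableAt.2 (h.mono fun _ hz => hz.1.differentiableAt)

lemma norm_eq (h : IsPowBranch β E a) : ‖E a‖ = ‖a‖ ^ β := h.self_of_nhds.2

lemma ne_zero (h : IsPowBranch β E a) (ha : a ≠ 0) : E a ≠ 0 := by
  rw [← norm_pos_iff, h.norm_eq]
  have := norm_pos_iff.2 ha
  positivity

lemma norm_sq_eq (h : IsPowBranch β E a) : ‖E a‖ ^ 2 = ‖a‖ ^ (2 * β) := by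
  rw [h.norm_eq, ← Real.rpow_natCast, ← Real.rpow_mul (norm_nonneg a), mul_comm]; norm_num

lemma deriv_mul (h : IsPowBranch β E a) {F : ℂ → ℂ} (hF : AnalyticAt ℂ F a) :
    deriv (fun z => E z * F z) a = E a * (β * F a / a + deriv F a) := by
  refine HasDerivAt.deriv ((h.self_of_nhds.1.mul hF.differentiableAt.hasDerivAt).congr_deriv ?_)
  ring

variable {k : ℕ}

/-- The Wronskian of the denominator and the numerator of the developing map is
`z ^ (β - 1) crit`. -/
lemma wronskian_den_num (h : IsPowBranch β E a) (hk : 0 < k) (ha : a ≠ 0) :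
    wronskian (den k) (fun z => E z * num β k z) a = E a / a * crit β k a := by
  rw [wronskian, h.deriv_mul (by fun_prop), deriv_den, deriv_num]
  have := mul_pow_sub_one hk a
  field_simp
  rw [den, num, crit]
  linear_combination (2 * k ^ 2 * E a) * this

/-- The hypothesis of `laplacian_herm_div` on the Wronskians holds for the explicit family. -/
lemma wronskian_compat (h : IsPowBranch β E a) (hk : 0 < k) (ha : a ≠ 0) :
    wronskian (den k) (fun z => E z * (-num' β k z)) a =
      wronskian (fun z => E z * num β k z) (den' k) a := by
  have h1 : AnalyticAt ℂ (fun z => -num' β k z) a := by fun_prop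
  have h2 : deriv (fun z => -num' β k z) a = -deriv (num' β k) a := deriv.fun_neg
  rw [wronskian, wronskian, h.deriv_mul h1, h.deriv_mul (by fun_prop), h2, deriv_den, deriv_den',
    deriv_num, deriv_num']
  have := mul_pow_sub_one hk a
  field_simp
  rw [den, den', num, num']
  linear_combination (4 * β * k * E a) * this

lemma herm_den_num (h : IsPowBranch β E a) :
    herm (den k) (fun z => E z * num β k z) (den k) (fun z => E z * num β k z) a =
      normSum β k a := by
  rw [herm_self, normSum, norm_mul, mul_pow, h.norm_sq_eq]

lemma norm_den_num (h : IsPowBranch β E a) :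
    ‖den k a‖ ^ 2 + ‖E a * num β k a‖ ^ 2 = normSum β k a := by
  rw [normSum, norm_mul, mul_pow, h.norm_sq_eq]

lemma herm_den'_num' (h : IsPowBranch β E a) :
    herm (den' k) (fun z => E z * (-num' β k z)) (den k) (fun z => E z * num β k z) a =
      h₁ β k a := by
  rw [h₁_eq, herm, ← h.norm_sq_eq]
  have : ((‖E a‖ ^ 2 : ℝ) : ℂ) = E a * conj (E a) := by
    simp [Complex.mul_conj, Complex.normSq_eq_norm_sq]
  rw [this, map_mul]
  ring

lemma metric_eq (h : IsPowBranch β E a) (hk : 0 < k) (ha : a ≠ 0) :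
    4 * ‖wronskian (den k) (fun z => E z * num β k z) a‖ ^ 2 /
      (‖den k a‖ ^ 2 + ‖E a * num β k a‖ ^ 2) ^ 2 = planeMetric β k a := by
  rw [h.norm_den_num, h.wronskian_den_num hk ha, planeMetric]
  have h1 : ‖a‖ ^ (2 * β - 2) = ‖a‖ ^ (2 * β) / ‖a‖ ^ 2 := by
    rw [Real.rpow_sub (norm_pos_iff.2 ha)]; norm_num
  rw [h1, ← h.norm_sq_eq, norm_mul, norm_div]
  ring

end IsPowBranch

/-! ### The eigenfunction and the metric on the punctured plane -/

/-- The function `h₁ / h₂` on `ℂ`. -/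
def planeQuot (β : ℝ) (k : ℕ) (z : ℂ) : ℂ := h₁ β k z / h₂ β k z

section Plane

variable {β : ℝ} {k : ℕ} {a : ℂ}

lemma planeQuot_eventuallyEq {E : ℂ → ℂ} (h : IsPowBranch β E a) :
    planeQuot β k =ᶠ[𝓝 a] fun z =>
      herm (den' k) (fun z => E z * (-num' β k z)) (den k) (fun z => E z * num β k z) z /
        herm (den k) (fun z => E z * num β k z) (den k) (fun z => E z * num β k z) z := by
  filter_upwards [h.eventually] with z hz
  rw [hz.herm_den_num, hz.herm_den'_num', planeQuot, h₂_eq]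

lemma laplacian_planeQuot (hk : 0 < k) (ha : a ≠ 0) :
    Laplacian.laplacian (planeQuot β k) a = -2 * planeMetric β k a * planeQuot β k a := by
  obtain ⟨E, hE⟩ := exists_isPowBranch β ha
  have hEa := hE.analyticAt
  have h0 : herm (den k) (fun z => E z * num β k z) (den k) (fun z => E z * num β k z) a ≠ 0 := by
    rw [hE.herm_den_num]; exact_mod_cast (normSum_pos hk a).ne'
  rw [InnerProductSpace.laplacian_congr_nhds (planeQuot_eventuallyEq hE) |>.self_of_nhds,
    laplacian_herm_div (by fun_prop) (by fun_prop) (by fun_prop) (by fun_prop) h0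
      (hE.wronskian_compat hk ha), hE.metric_eq hk ha, (planeQuot_eventuallyEq hE).self_of_nhds]

lemma laplacian_log_planeMetric (hk : 0 < k) (ha : a ≠ 0) (hc : crit β k a ≠ 0) :
    Laplacian.laplacian (fun z => (Real.log (planeMetric β k z) : ℂ)) a =
      -2 * planeMetric β k a := by
  obtain ⟨E, hE⟩ := exists_isPowBranch β ha
  have hEa := hE.analyticAt
  have h0 : herm (den k) (fun z => E z * num β k z) (den k) (fun z => E z * num β k z) a ≠ 0 := by
    rw [hE.herm_den_num]; exact_mod_cast (normSum_pos hk a).ne'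
  have hW : wronskian (den k) (fun z => E z * num β k z) a ≠ 0 := by
    rw [hE.wronskian_den_num hk ha]
    exact mul_ne_zero (div_ne_zero (hE.ne_zero ha) ha) hc
  have := laplacian_log_metric (by fun_prop) (by fun_prop) h0 hW
  rw [hE.metric_eq hk ha] at this
  rw [← this]
  refine (InnerProductSpace.laplacian_congr_nhds ?_).self_of_nhds
  filter_upwards [hE.eventually, eventually_ne_nhds ha] with z hz hz0
  rw [hz.metric_eq hk hz0]

/-- At a critical point of the developing map, `∂̄(h₁ / h₂) = 0` and `∂(h₁ / h₂) ≠ 0`. -/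
lemma hasWirtingerAt_planeQuot_of_crit (hk : 0 < k) (ha : a ≠ 0) (hc : crit β k a = 0) :
    ∃ p, p ≠ 0 ∧ HasWirtingerAt (planeQuot β k) p 0 a := by
  obtain ⟨E, hE⟩ := exists_isPowBranch β ha
  have hEa := hE.analyticAt
  have h0 : herm (den k) (fun z => E z * num β k z) (den k) (fun z => E z * num β k z) a ≠ 0 := by
    rw [hE.herm_den_num]; exact_mod_cast (normSum_pos hk a).ne'
  have hW : wronskian (den k) (fun z => E z * num β k z) a = 0 := by
    rw [hE.wronskian_den_num hk ha, hc, mul_zero]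
  have hD : den k a ≠ 0 := fun h => crit_ne_zero_of_den_eq_zero hk h hc
  have hrel := hE.wronskian_compat hk ha
  have hF := hasWirtingerAt_herm_div (A := den' k) (C := fun z => E z * (-num' β k z))
    (D := den k) (G := fun z => E z * num β k z) (a := a)
    (by fun_prop) (by fun_prop) (by fun_prop) (by fun_prop) h0
  refine ⟨2 * k * a ^ (k - 1) / den k a ^ 2, ?_, ?_⟩
  · have : (k : ℂ) ≠ 0 := by exact_mod_cast hk.ne'
    simp [this, ha, hD]
  · refine (HasWirtingerAt.congr_of_eventuallyEq hF (planeQuot_eventuallyEq hE)).congr_deriv ?_ ?_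
    -- since both Wronskians vanish, `∂` of the quotient is `(den' / den)' = 2 k a ^ (k - 1) / den ^ 2`
    · have hA : deriv (den' k) a * den k a - den' k a * deriv (den k) a = 2 * k * a ^ (k - 1) := by
        rw [deriv_den', deriv_den, den, den']; ring
      rw [← hA]
      simp only [wronskian] at hW hrel
      generalize deriv (fun z => E z * -num' β k z) a = C₁ at hrel ⊢
      field_simp
      simp only [herm]
      linear_combination (den k a * conj (E a * num β k a) * (den k a * conj (den k a) +
        E a * num β k a * conj (E a * num β k a))) * hrel -
        (conj (E a * num β k a) * (den k a * conj (den k a) +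
          E a * num β k a * conj (E a * num β k a)) * den' k a + den k a * conj (E a * num β k a) *
          (den' k a * conj (den k a) + E a * -num' β k a * conj (E a * num β k a))) * hW
    · rw [hW]; simp

end Plane

/-! ### The symmetry `z ↦ 1 / z` -/

section Inversion

variable {β : ℝ} {k : ℕ} {z : ℂ}

lemma den_inv (hz : z ≠ 0) : den k z⁻¹ = den k z / z ^ k := by
  rw [den, den, inv_pow]; field_simp; ring

lemma den'_inv (hz : z ≠ 0) : den' k z⁻¹ = -den' k z / z ^ k := by
  rw [den', den', inv_pow]; field_simp; ring

lemma num_inv (hz : z ≠ 0) : num β k z⁻¹ = -num (-β) k z / z ^ k := by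
  rw [num, num, inv_pow]; push_cast; field_simp; ring

lemma num'_inv (hz : z ≠ 0) : num' β k z⁻¹ = num' (-β) k z / z ^ k := by
  rw [num', num', inv_pow]; push_cast; field_simp; ring

lemma crit_inv (hz : z ≠ 0) : crit β k z⁻¹ = crit (-β) k z / (z ^ k) ^ 2 := by
  rw [crit, crit, inv_pow]; push_cast; field_simp; ring

lemma normSum_inv (hz : z ≠ 0) : normSum β k z⁻¹ = normSum (-β) k z / (‖z‖ ^ k) ^ 2 := by
  rw [normSum, normSum, den_inv hz, num_inv hz]
  have : ‖z‖ ≠ 0 := norm_ne_zero_iff.2 hz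
  rw [norm_div, norm_div, norm_neg, norm_pow, norm_inv, Real.inv_rpow (norm_nonneg z), mul_neg,
    Real.rpow_neg (norm_nonneg z)]
  field_simp

lemma planeQuot_inv (hz : z ≠ 0) : planeQuot β k z⁻¹ = -planeQuot (-β) k z := by
  have h0 : ‖z‖ ≠ 0 := norm_ne_zero_iff.2 hz
  have h1 : h₂ β k z⁻¹ = h₂ (-β) k z / (z ^ k * conj (z ^ k)) := by
    rw [h₂_eq, h₂_eq, normSum_inv hz, Complex.mul_conj, Complex.normSq_eq_norm_sq]
    simp
  have hc : z ^ k * conj (z ^ k) ≠ 0 := by simp [hz]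
  have h2 : h₁ β k z⁻¹ = -h₁ (-β) k z / (z ^ k * conj (z ^ k)) := by
    rw [h₁_eq, h₁_eq, den_inv hz, den'_inv hz, num_inv hz, num'_inv hz, norm_inv,
      Real.inv_rpow (norm_nonneg z), mul_neg, Real.rpow_neg (norm_nonneg z)]
    simp only [map_div₀, map_neg]
    have : conj (z ^ k) ≠ 0 := by simp [hz]
    field_simp
    ring
  rw [planeQuot, planeQuot, h1, h2, div_div_div_cancel_right₀ hc, neg_div]

lemma planeMetric_inv (hz : z ≠ 0) : planeMetric β k z⁻¹ / ‖z‖ ^ 4 = planeMetric (-β) k z := by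
  have h0 : 0 < ‖z‖ := norm_pos_iff.2 hz
  rw [planeMetric, planeMetric, normSum_inv hz, crit_inv hz, norm_inv,
    Real.inv_rpow (norm_nonneg z), norm_div, norm_pow, norm_pow, Real.rpow_sub h0,
    Real.rpow_sub h0, mul_neg, Real.rpow_neg h0.le, Real.rpow_two]
  field_simp

end Inversion

/-! ### Behaviour near the points `0` and `∞` -/

/-- The function `(X + |z| ^ (2 b) Y) / (V + |z| ^ (2 b) W)`. The function `h₁ / h₂` has this form
with smooth `X`, `Y`, `V`, `W`, near `0` and also near `∞` in the coordinate `1 / z`. -/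
def radialQuot (b : ℝ) (X Y V W : ℂ → ℂ) (z : ℂ) : ℂ :=
  (X z + ((‖z‖ ^ (2 * b) : ℝ) : ℂ) * Y z) / (V z + ((‖z‖ ^ (2 * b) : ℝ) : ℂ) * W z)

lemma planeQuot_eq_radialQuot (β : ℝ) (k : ℕ) : planeQuot β k = radialQuot β
    (fun z => den' k z * conj (den k z)) (fun z => -(num' β k z * conj (num β k z)))
    (fun z => den k z * conj (den k z)) (fun z => num β k z * conj (num β k z)) := by
  ext z
  rw [planeQuot, h₁_eq, h₂_eq, normSum_def', radialQuot]
  ring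

lemma planeQuot_neg_eq_radialQuot {β : ℝ} {k : ℕ} {z : ℂ} (hz : z ≠ 0) :
    planeQuot (-β) k z = radialQuot β
      (fun z => -(num' (-β) k z * conj (num (-β) k z))) (fun z => den' k z * conj (den k z))
      (fun z => num (-β) k z * conj (num (-β) k z)) (fun z => den k z * conj (den k z)) z := by
  rw [planeQuot, h₁_eq, h₂_eq, normSum_def', radialQuot, mul_neg, Real.rpow_neg (norm_nonneg z)]
  have h0 : ((‖z‖ ^ (2 * β) : ℝ) : ℂ) ≠ 0 := by
    have := norm_pos_iff.2 hz
    exact_mod_cast (by positivity : ‖z‖ ^ (2 * β) ≠ 0)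
  rw [Complex.ofReal_inv, ← mul_div_mul_left _ _ h0]
  congr 1 <;> field_simp <;> ring

section RadialQuot

variable {b : ℝ} {X Y V W : ℂ → ℂ}

lemma continuous_norm_rpow (hb : 0 < b) : Continuous fun z : ℂ => ((‖z‖ ^ (2 * b) : ℝ) : ℂ) := by
  have : Continuous fun z : ℂ => ‖z‖ ^ (2 * b) :=
    continuous_norm.rpow_const fun _ => Or.inr (by positivity)
  fun_prop

lemma continuousAt_radialQuot (hb : 0 < b) (hX : ContinuousAt X 0) (hY : ContinuousAt Y 0)
    (hV : ContinuousAt V 0) (hW : ContinuousAt W 0) (h0 : V 0 ≠ 0) :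
    ContinuousAt (radialQuot b X Y V W) 0 := by
  have := (continuous_norm_rpow hb).continuousAt (x := 0)
  unfold radialQuot
  refine ContinuousAt.div (by fun_prop) (by fun_prop) ?_
  simp [hb.ne', h0]

lemma radialQuot_zero (hb : 0 < b) : radialQuot b X Y V W 0 = X 0 / V 0 := by
  simp [radialQuot, hb.ne']

lemma hasFDerivAt_norm_rpow_real (c : ℝ) {z : ℂ} (hz : z ≠ 0) : ∃ L : ℂ →L[ℝ] ℝ,
    HasFDerivAt (fun z : ℂ => ‖z‖ ^ c) L z ∧ ‖L‖ ≤ |c| * ‖z‖ ^ (c - 1) := by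
  have h1 := (DifferentiableAt.norm ℂ (differentiableAt_id (x := z) (𝕜 := ℝ)) (by simpa using hz))
  have h2 := h1.hasFDerivAt.rpow_const (p := c) (Or.inl (by simpa using hz))
  refine ⟨_, h2, ?_⟩
  have h4 : ‖fderiv ℝ (fun t : ℂ => ‖id t‖) z‖ ≤ 1 := by
    simpa using norm_fderiv_le_of_lipschitz ℝ (x₀ := z) (lipschitzWith_one_norm (E := ℂ))
  rw [norm_smul, norm_mul, Real.norm_eq_abs, Real.norm_eq_abs, Real.abs_rpow_of_nonneg (by simp)]
  simp only [id, abs_norm]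
  have : 0 ≤ |c| * ‖z‖ ^ (c - 1) := by positivity
  simpa using mul_le_mul_of_nonneg_left h4 this

lemma hasFDerivAt_norm_rpow (b : ℝ) {z : ℂ} (hz : z ≠ 0) : ∃ L : ℂ →L[ℝ] ℂ,
    HasFDerivAt (fun z : ℂ => ((‖z‖ ^ (2 * b) : ℝ) : ℂ)) L z ∧ ‖L‖ ≤ |2 * b| * ‖z‖ ^ (2 * b - 1) := by
  obtain ⟨L, hL, hL'⟩ := hasFDerivAt_norm_rpow_real (2 * b) hz
  refine ⟨_, Complex.ofRealCLM.hasFDerivAt.comp z hL, ?_⟩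
  refine (ContinuousLinearMap.opNorm_comp_le _ _).trans ?_
  rwa [Complex.ofRealCLM_norm, one_mul]

open Asymptotics in
/-- Near `0` the gradient of `radialQuot` grows at most like `|z| ^ (2 b - 1)`. -/
lemma isBigO_fderiv_radialQuot (hb : 0 < b) (hX : ContDiffAt ℝ 1 X 0) (hY : ContDiffAt ℝ 1 Y 0)
    (hV : ContDiffAt ℝ 1 V 0) (hW : ContDiffAt ℝ 1 W 0) (h0 : V 0 ≠ 0) :
    (fderiv ℝ (radialQuot b X Y V W)) =O[𝓝[≠] 0] fun z => ‖z‖ ^ (min 0 (2 * b - 1)) := by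
  set s := min 0 (2 * b - 1)
  set m : ℂ → ℝ := fun z => ‖z‖ ^ s
  set t : ℂ → ℂ := fun z => ((‖z‖ ^ (2 * b) : ℝ) : ℂ) with ht
  have htc : ContinuousAt t 0 := (continuous_norm_rpow hb).continuousAt
  have ht0 : t 0 = 0 := by simp [ht, hb.ne']
  have hsmall : ∀ᶠ z : ℂ in 𝓝[≠] 0, 0 < ‖z‖ ∧ ‖z‖ ≤ 1 := by
    have h1 : ∀ᶠ z : ℂ in 𝓝 0, ‖z‖ < 1 :=
      continuous_norm.continuousAt.eventually (gt_mem_nhds (by simp))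
    filter_upwards [h1.filter_mono nhdsWithin_le_nhds, self_mem_nhdsWithin] with z hz hz'
    exact ⟨norm_pos_iff.2 hz', hz.le⟩
  have hone : (fun _ => (1 : ℝ)) =O[𝓝[≠] (0 : ℂ)] m := by
    refine IsBigO.of_bound 1 ?_
    filter_upwards [hsmall] with z hz
    have : 1 ≤ ‖z‖ ^ s := Real.one_le_rpow_of_pos_of_le_one_of_nonpos hz.1 hz.2 (min_le_left _ _)
    simpa [m, abs_of_nonneg (zero_le_one.trans this)] using this
  have hdt : (fderiv ℝ t) =O[𝓝[≠] (0 : ℂ)] m := by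
    refine IsBigO.of_bound |2 * b| ?_
    filter_upwards [hsmall] with z hz
    obtain ⟨L, hL, hL'⟩ := hasFDerivAt_norm_rpow b (norm_pos_iff.1 hz.1)
    rw [hL.fderiv]
    refine hL'.trans ?_
    have h1 : ‖z‖ ^ (2 * b - 1) ≤ ‖z‖ ^ s :=
      Real.rpow_le_rpow_of_exponent_ge hz.1 hz.2 (min_le_right _ _)
    have h2 : ‖m z‖ = ‖z‖ ^ s := by
      simp only [m, Real.norm_eq_abs]; exact abs_of_nonneg (by positivity)
    rw [h2]
    gcongr
  have hbd : ∀ {F : ℂ → ℂ}, ContinuousAt F 0 → F =O[𝓝[≠] (0 : ℂ)] fun _ => (1 : ℝ) :=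
    fun hF => (hF.isBigO_one ℝ).mono nhdsWithin_le_nhds
  have hbd' : ∀ {F : ℂ → ℂ}, ContDiffAt ℝ 1 F 0 → (fderiv ℝ F) =O[𝓝[≠] (0 : ℂ)] m := fun hF =>
    (((hF.fderiv_right (m := 0) le_rfl).continuousAt.isBigO_one ℝ).mono nhdsWithin_le_nhds).trans hone
  have hR0 : V 0 + t 0 * W 0 ≠ 0 := by simpa [ht0] using h0
  have hRc : ContinuousAt (fun z => V z + t z * W z) 0 :=
    hV.continuousAt.add (htc.mul hW.continuousAt)
  have hNc : ContinuousAt (fun z => X z + t z * Y z) 0 :=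
    hX.continuousAt.add (htc.mul hY.continuousAt)
  have hd : ∀ {P Q : ℂ → ℂ}, ContDiffAt ℝ 1 P 0 → ContDiffAt ℝ 1 Q 0 →
      (fun z => fderiv ℝ P z + (t z • fderiv ℝ Q z + Q z • fderiv ℝ t z)) =O[𝓝[≠] (0 : ℂ)] m := by
    intro P Q hP hQ
    refine (hbd' hP).add (IsBigO.add ?_ ?_)
    · simpa using (hbd htc).smul (hbd' hQ)
    · simpa using (hbd hQ.continuousAt).smul hdt
  have hdiff : ∀ {P : ℂ → ℂ}, ContDiffAt ℝ 1 P 0 → ∀ᶠ z in 𝓝[≠] (0 : ℂ), DifferentiableAt ℝ P z :=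
    fun hP => ((hP.eventually (by simp)).mono fun z hz => hz.differentiableAt one_ne_zero).filter_mono
      nhdsWithin_le_nhds
  have hfd : ∀ᶠ z in 𝓝[≠] (0 : ℂ), fderiv ℝ (radialQuot b X Y V W) z =
      (((V z + t z * W z) ^ 2)⁻¹ * (V z + t z * W z)) •
        (fderiv ℝ X z + (t z • fderiv ℝ Y z + Y z • fderiv ℝ t z)) -
      (((V z + t z * W z) ^ 2)⁻¹ * (X z + t z * Y z)) •
        (fderiv ℝ V z + (t z • fderiv ℝ W z + W z • fderiv ℝ t z)) := by
    filter_upwards [hdiff hX, hdiff hY, hdiff hV, hdiff hW, hsmall,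
      (hRc.eventually_ne hR0).filter_mono nhdsWithin_le_nhds] with z h1 h2 h3 h4 h5 h6
    obtain ⟨L, hL, -⟩ := hasFDerivAt_norm_rpow b (norm_pos_iff.1 h5.1)
    have hL' : HasFDerivAt t (fderiv ℝ t z) z := hL.differentiableAt.hasFDerivAt
    have hR : HasFDerivAt (fun z => V z + t z * W z) _ z :=
      h3.hasFDerivAt.add (hL'.mul h4.hasFDerivAt)
    have hN : HasFDerivAt (fun z => X z + t z * Y z) _ z :=
      h1.hasFDerivAt.add (hL'.mul h2.hasFDerivAt)
    have := hN.mul (((hasDerivAt_inv h6).hasFDerivAt.restrictScalars ℝ).comp z hR)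
    refine HasFDerivAt.fderiv (HasFDerivAt.congr_fderiv this ?_)
    refine ContinuousLinearMap.ext fun v => ?_
    simp
    field_simp
    ring
  refine IsBigO.congr' ?_ (hfd.mono fun _ h => h.symm) EventuallyEq.rfl
  have hi : ContinuousAt (fun z => ((V z + t z * W z) ^ 2)⁻¹) 0 :=
    (hRc.pow 2).inv₀ (pow_ne_zero 2 hR0)
  refine IsBigO.sub ?_ ?_
  · simpa using (hbd (hi.mul hRc)).smul (hd hX hY)
  · simpa using (hbd (hi.mul hNc)).smul (hd hV hW)

end RadialQuot

/-! ### Cone points, cone angles and the metric -/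

/-- A polynomial with root set `{0} ∪ {crit = 0}`. -/
def conePoly (β : ℝ) (k : ℕ) : Polynomial ℂ :=
  Polynomial.X * (Polynomial.C (β * (k - β) : ℂ) * (Polynomial.X ^ k) ^ 2 +
    Polynomial.C (2 * (k ^ 2 - β ^ 2) : ℂ) * Polynomial.X ^ k - Polynomial.C (β * (k + β) : ℂ))

lemma eval_conePoly (β : ℝ) (k : ℕ) (z : ℂ) : (conePoly β k).eval z = z * crit β k z := by
  simp [conePoly, crit]

/-- The cone points: `0`, `∞` and the critical points of the developing map. -/
def conePoints (β : ℝ) (k : ℕ) : Finset (OnePoint ℂ) :=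
  open Classical in insert ∞ ((conePoly β k).roots.toFinset.image fun z : ℂ => (z : OnePoint ℂ))

/-- The cone angles, divided by `2 π`: `β` at `0` and `∞`, and `2` at the other cone points. -/
def coneAngle (β : ℝ) (p : OnePoint ℂ) : ℝ :=
  open Classical in p.elim β fun z => if z = 0 then β else 2

/-- The metric on the sphere; `∞` is a cone point, so the value there carries no meaning. -/
def coneMetric (β : ℝ) (k : ℕ) (p : OnePoint ℂ) : ℝ := p.elim 0 (planeMetric β k)

@[simp] lemma coneMetric_coe (β : ℝ) (k : ℕ) (z : ℂ) :
    coneMetric β k (z : OnePoint ℂ) = planeMetric β k z := rfl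

@[simp] lemma coneAngle_infty (β : ℝ) : coneAngle β ∞ = β := rfl

@[simp] lemma coneAngle_zero (β : ℝ) : coneAngle β ((0 : ℂ) : OnePoint ℂ) = β := by
  simp [coneAngle]

lemma coneAngle_of_ne_zero (β : ℝ) {z : ℂ} (hz : z ≠ 0) : coneAngle β (z : OnePoint ℂ) = 2 := by
  simp [coneAngle, hz]

@[simp] lemma density_coe (g : OnePoint ℂ → ℝ) (a ζ : ℂ) :
    density g (a : OnePoint ℂ) ζ = g ((a + ζ : ℂ) : OnePoint ℂ) := rfl

@[simp] lemma param_coe (a ζ : ℂ) : param (a : OnePoint ℂ) ζ = ((a + ζ : ℂ) : OnePoint ℂ) := rfl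

lemma param_infty {ζ : ℂ} (hζ : ζ ≠ 0) : param ∞ ζ = ((ζ⁻¹ : ℂ) : OnePoint ℂ) := by
  change (if ζ = 0 then (∞ : OnePoint ℂ) else _) = _
  rw [if_neg hζ]

@[simp] lemma infty_mem_conePoints (β : ℝ) (k : ℕ) : ∞ ∈ conePoints β k := by simp [conePoints]

section Params

variable {β : ℝ} {k : ℕ}

lemma crit_zero_ne_zero (hβ : 0 < β) (hk : 0 < k) : crit β k 0 ≠ 0 := by
  rw [crit_zero hk, neg_ne_zero]
  have : (0 : ℝ) < β * (k + β) := by positivity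
  exact_mod_cast this.ne'

lemma crit_neg_zero_ne_zero (hβ : 0 < β) (hk : β < k) : crit (-β) k 0 ≠ 0 := by
  rw [crit_zero (by exact_mod_cast hβ.trans hk), neg_ne_zero]
  have : (0 : ℝ) < β * (k - β) := mul_pos hβ (sub_pos.2 hk)
  have h : (-β * (k + -β) : ℝ) ≠ 0 := by linarith
  exact_mod_cast h

lemma num_neg_zero_ne_zero (hβ : 0 < β) (hk : β < k) : num (-β) k 0 ≠ 0 := by
  rw [num_zero (by exact_mod_cast hβ.trans hk), neg_ne_zero]
  have h : (k + -β : ℝ) ≠ 0 := by linarith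
  exact_mod_cast h

lemma coe_mem_conePoints (hβ : 0 < β) (hk : 0 < k) (z : ℂ) :
    (z : OnePoint ℂ) ∈ conePoints β k ↔ z = 0 ∨ crit β k z = 0 := by
  have h0 : conePoly β k ≠ 0 := by
    refine mul_ne_zero Polynomial.X_ne_zero fun h => crit_zero_ne_zero hβ hk ?_
    simpa [crit] using congrArg (Polynomial.eval 0) h
  simp [conePoints, h0, eval_conePoly]

lemma notMem_conePoints (hβ : 0 < β) (hk : 0 < k) {p : OnePoint ℂ} :
    p ∉ conePoints β k ↔ ∃ z : ℂ, p = z ∧ z ≠ 0 ∧ crit β k z ≠ 0 := by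
  induction p using OnePoint.rec with
  | infty => simp
  | coe z => simp [coe_mem_conePoints hβ hk]

/-! ### Regularity -/

lemma contDiffAt_real_of_analyticAt {F : ℂ → ℂ} (hF : ∀ a, AnalyticAt ℂ F a) {n : WithTop ℕ∞} (a : ℂ) :
    ContDiffAt ℝ n F a := (hF a).contDiffAt.restrict_scalars ℝ

lemma contDiffAt_den {n : WithTop ℕ∞} (a : ℂ) : ContDiffAt ℝ n (den k) a :=
  contDiffAt_real_of_analyticAt (analyticAt_den k) a

lemma contDiffAt_den' {n : WithTop ℕ∞} (a : ℂ) : ContDiffAt ℝ n (den' k) a :=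
  contDiffAt_real_of_analyticAt (analyticAt_den' k) a

lemma contDiffAt_num {n : WithTop ℕ∞} (a : ℂ) : ContDiffAt ℝ n (num β k) a :=
  contDiffAt_real_of_analyticAt (analyticAt_num β k) a

lemma contDiffAt_num' {n : WithTop ℕ∞} (a : ℂ) : ContDiffAt ℝ n (num' β k) a :=
  contDiffAt_real_of_analyticAt (analyticAt_num' β k) a

lemma contDiffAt_crit {n : WithTop ℕ∞} (a : ℂ) : ContDiffAt ℝ n (crit β k) a :=
  contDiffAt_real_of_analyticAt (analyticAt_crit β k) a

lemma contDiffAt_conj {F : ℂ → ℂ} {n : WithTop ℕ∞} {a : ℂ} (hF : ContDiffAt ℝ n F a) :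
    ContDiffAt ℝ n (fun z => conj (F z)) a :=
  (Complex.conjCLE : ℂ →L[ℝ] ℂ).contDiff.contDiffAt.comp a hF

lemma contDiffAt_mul_conj {F G : ℂ → ℂ} {n : WithTop ℕ∞} {a : ℂ} (hF : ContDiffAt ℝ n F a)
    (hG : ContDiffAt ℝ n G a) : ContDiffAt ℝ n (fun z => F z * conj (G z)) a :=
  hF.mul (contDiffAt_conj hG)

lemma contDiffAt_norm_rpow (c : ℝ) {n : WithTop ℕ∞} {a : ℂ} (ha : a ≠ 0) :
    ContDiffAt ℝ n (fun z : ℂ => ‖z‖ ^ c) a :=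
  (contDiffAt_norm ℝ ha).rpow_const_of_ne (norm_ne_zero_iff.2 ha)

lemma contDiffAt_normSum {n : WithTop ℕ∞} {a : ℂ} (ha : a ≠ 0) :
    ContDiffAt ℝ n (normSum β k) a :=
  ((contDiffAt_den a).norm_sq ℝ).add
    ((contDiffAt_norm_rpow _ ha).mul ((contDiffAt_num a).norm_sq ℝ))

lemma contDiffAt_planeMetric (hk : 0 < k) {n : WithTop ℕ∞} {a : ℂ} (ha : a ≠ 0) :
    ContDiffAt ℝ n (planeMetric β k) a :=
  (contDiffAt_const.mul ((contDiffAt_norm_rpow _ ha).mul ((contDiffAt_crit a).norm_sq ℝ))).div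
    ((contDiffAt_normSum ha).pow 2) (pow_ne_zero 2 (normSum_pos hk a).ne')

lemma contDiffAt_planeQuot (hk : 0 < k) {n : WithTop ℕ∞} {a : ℂ} (ha : a ≠ 0) :
    ContDiffAt ℝ n (planeQuot β k) a := by
  have ht : ContDiffAt ℝ n (fun z : ℂ => ((‖z‖ ^ (2 * β) : ℝ) : ℂ)) a :=
    Complex.ofRealCLM.contDiff.contDiffAt.comp a (contDiffAt_norm_rpow _ ha)
  have h1 : h₁ β k = fun z => _ := funext (h₁_eq β k)
  have h2 : h₂ β k = fun z => _ := funext (h₂_eq β k)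
  unfold planeQuot
  simp only [div_eq_mul_inv]
  refine ContDiffAt.mul ?_ (ContDiffAt.inv ?_ (h₂_ne_zero hk a))
  · rw [h1]
    exact (contDiffAt_mul_conj (contDiffAt_den' a) (contDiffAt_den a)).sub
      (ht.mul (contDiffAt_mul_conj (contDiffAt_num' a) (contDiffAt_num a)))
  · rw [h2]
    exact Complex.ofRealCLM.contDiff.contDiffAt.comp a (contDiffAt_normSum ha)

lemma planeMetric_pos (hk : 0 < k) {z : ℂ} (hz : z ≠ 0) (hc : crit β k z ≠ 0) :
    0 < planeMetric β k z := by
  have := norm_pos_iff.2 hz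
  have := norm_pos_iff.2 hc
  have := normSum_pos (β := β) hk z
  unfold planeMetric; positivity

lemma continuous_normSum (hβ : 0 < β) : Continuous (normSum β k) := by
  have h1 : Continuous (den k) := by unfold den; fun_prop
  have h2 : Continuous (num β k) := by unfold num; fun_prop
  have h3 : Continuous fun z : ℂ => ‖z‖ ^ (2 * β) :=
    continuous_norm.rpow_const fun _ => Or.inr (by positivity)
  unfold normSum; fun_prop

lemma laplacian_comp_const_add {F : Type*} [NormedAddCommGroup F] [NormedSpace ℝ F] (f : ℂ → F)
    (a : ℂ) : Laplacian.laplacian (fun ζ => f (a + ζ)) 0 = Laplacian.laplacian f a := by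
  simp only [InnerProductSpace.laplacian_eq_iteratedFDeriv_complexPlane]
  rw [iteratedFDeriv_comp_add_left]
  simp

lemma contDiffAt_comp_const_add {F : Type*} [NormedAddCommGroup F] [NormedSpace ℝ F] {f : ℂ → F}
    {n : WithTop ℕ∞} {a : ℂ} (hf : ContDiffAt ℝ n f a) : ContDiffAt ℝ n (fun ζ => f (a + ζ)) 0 := by
  have h : ContDiffAt ℝ n (fun ζ : ℂ => a + ζ) 0 := by fun_prop
  exact ContDiffAt.comp (g := f) 0 (by simpa using hf) h

/-! ### The metric is a spherical conical metric -/

/-- The standard coordinate exhibits a conical singularity if the density is `|ζ| ^ (2 b - 2)` times a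
positive continuous function. -/
lemma isConicalAt_of_eventually {g : OnePoint ℂ → ℝ} {p : OnePoint ℂ} {b : ℝ} {m : ℂ → ℝ}
    (hm : ContinuousAt m 0) (h0 : 0 < m 0)
    (h : ∀ᶠ ζ in 𝓝[≠] (0 : ℂ), density g p ζ = m ζ * ‖ζ‖ ^ (2 * b - 2)) : IsConicalAt g p b := by
  refine ⟨id, analyticAt_id, rfl, by simp, fun ζ => Real.log (m ζ) / 2,
    (hm.log h0.ne').div_const 2, ?_⟩
  filter_upwards [h, (hm.eventually (lt_mem_nhds h0)).filter_mono nhdsWithin_le_nhds,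
    self_mem_nhdsWithin] with ζ h1 h2 h3
  have h4 : 0 < ‖ζ‖ := norm_pos_iff.2 h3
  simp only [id, h1, deriv_id', norm_one, one_pow, mul_one]
  rw [Real.rpow_def_of_pos h4, ← Real.exp_log h2, ← Real.exp_add, Real.log_exp]
  congr 1
  ring

/-- The density in the coordinate `1 / z`, with the factors `|z| ^ (2 β)` cleared from the
denominators. -/
lemma planeMetric_neg_eq {z : ℂ} (hz : z ≠ 0) : planeMetric (-β) k z =
    4 * ‖crit (-β) k z‖ ^ 2 / (‖num (-β) k z‖ ^ 2 + ‖z‖ ^ (2 * β) * ‖den k z‖ ^ 2) ^ 2 *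
      ‖z‖ ^ (2 * β - 2) := by
  have h0 : 0 < ‖z‖ := norm_pos_iff.2 hz
  have h1 : normSum (-β) k z =
      (‖num (-β) k z‖ ^ 2 + ‖z‖ ^ (2 * β) * ‖den k z‖ ^ 2) / ‖z‖ ^ (2 * β) := by
    rw [normSum, mul_neg, Real.rpow_neg h0.le]
    field_simp
    ring
  rw [planeMetric, h1, Real.rpow_sub h0, Real.rpow_sub h0, mul_neg, Real.rpow_neg h0.le]
  field_simp

lemma isConicalAt_zero (hβ : 0 < β) (hk : 0 < k) :
    IsConicalAt (coneMetric β k) ((0 : ℂ) : OnePoint ℂ) β := by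
  refine isConicalAt_of_eventually (m := fun z => 4 * ‖crit β k z‖ ^ 2 / normSum β k z ^ 2) ?_ ?_
    (Eventually.of_forall fun z => ?_)
  · have h1 := (analyticAt_crit β k 0).continuousAt
    have h2 := (continuous_normSum (k := k) hβ).continuousAt (x := 0)
    exact ContinuousAt.div (by fun_prop) (by fun_prop) (pow_ne_zero 2 (normSum_pos hk 0).ne')
  · have := norm_pos_iff.2 (crit_zero_ne_zero hβ hk)
    have := normSum_pos (β := β) hk 0
    positivity
  · rw [density_coe, zero_add, coneMetric_coe, planeMetric]
    ring

lemma density_coneMetric_infty {z : ℂ} (hz : z ≠ 0) :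
    density (coneMetric β k) ∞ z = planeMetric (-β) k z := by
  rw [← planeMetric_inv hz]
  change (if z = 0 then _ else _) = _
  rw [if_neg hz]
  rfl

lemma isConicalAt_infty (hβ : 0 < β) (hk : β < k) : IsConicalAt (coneMetric β k) ∞ β := by
  have hn := norm_pos_iff.2 (num_neg_zero_ne_zero hβ hk)
  refine isConicalAt_of_eventually (m := fun z => 4 * ‖crit (-β) k z‖ ^ 2 /
    (‖num (-β) k z‖ ^ 2 + ‖z‖ ^ (2 * β) * ‖den k z‖ ^ 2) ^ 2) ?_ ?_ ?_
  · have h1 := (analyticAt_crit (-β) k 0).continuousAt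
    have h2 := (analyticAt_num (-β) k 0).continuousAt
    have h3 := (analyticAt_den k 0).continuousAt
    have h4 : Continuous fun z : ℂ => ‖z‖ ^ (2 * β) :=
      continuous_norm.rpow_const fun _ => Or.inr (by positivity)
    have h5 := h4.continuousAt (x := 0)
    exact ContinuousAt.div (by fun_prop) (by fun_prop) (by positivity)
  · have := norm_pos_iff.2 (crit_neg_zero_ne_zero hβ hk)
    positivity
  · filter_upwards [self_mem_nhdsWithin] with z hz
    rw [density_coneMetric_infty hz, planeMetric_neg_eq hz]

/-- At a simple zero of `crit` the density vanishes to second order, so the cone angle is `4 π`. -/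
lemma isConicalAt_of_crit (hβ : 0 < β) (hk : β < k) {a : ℂ} (ha : a ≠ 0) (hc : crit β k a = 0) :
    IsConicalAt (coneMetric β k) (a : OnePoint ℂ) 2 := by
  have hk0 : 0 < k := by exact_mod_cast hβ.trans hk
  refine isConicalAt_of_eventually (m := fun z => 4 * (‖a + z‖ ^ (2 * β - 2) *
    ‖dslope (crit β k) a (a + z)‖ ^ 2) / normSum β k (a + z) ^ 2) ?_ ?_
    (Eventually.of_forall fun z => ?_)
  · have e : ContinuousAt (fun z : ℂ => a + z) 0 := by fun_prop
    have h1 : ContinuousAt (fun z => dslope (crit β k) a (a + z)) 0 :=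
      ContinuousAt.comp (g := dslope (crit β k) a) (by
        simpa using continuousAt_dslope_same.2 (analyticAt_crit β k a).differentiableAt) e
    have h2 : ContinuousAt (fun z => normSum β k (a + z)) 0 :=
      ((continuous_normSum (k := k) hβ).comp (continuous_const.add continuous_id)).continuousAt
    have h3 : ContinuousAt (fun z : ℂ => ‖a + z‖ ^ (2 * β - 2)) 0 :=
      (contDiffAt_comp_const_add (n := 0) (contDiffAt_norm_rpow _ ha)).continuousAt
    exact ContinuousAt.div (by fun_prop) (by fun_prop) (pow_ne_zero 2 (normSum_pos hk0 _).ne')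
  · have h1 := norm_pos_iff.2 (deriv_crit_ne_zero hβ hk hc)
    have h2 := normSum_pos (β := β) hk0 a
    have h3 := norm_pos_iff.2 ha
    simp only [add_zero, dslope_same]
    positivity
  · have h1 : crit β k (a + z) = z * dslope (crit β k) a (a + z) := by
      have := sub_smul_dslope (crit β k) a (a + z)
      simpa [hc] using this.symm
    rw [density_coe, coneMetric_coe, planeMetric, h1, norm_mul]
    norm_num
    ring

lemma isSphericalAt_coneMetric (hk : 0 < k) {a : ℂ} (ha : a ≠ 0) (hc : crit β k a ≠ 0) :
    IsSphericalAt (coneMetric β k) (a : OnePoint ℂ) := by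
  have hd : density (coneMetric β k) (a : OnePoint ℂ) = fun ζ => planeMetric β k (a + ζ) := rfl
  have hpos := planeMetric_pos hk ha hc
  rw [IsSphericalAt, hd]
  refine ⟨contDiffAt_comp_const_add (contDiffAt_planeMetric hk ha), by simpa using hpos, ?_⟩
  have h1 := ofReal_laplacian ((contDiffAt_planeMetric (β := β) hk ha).log hpos.ne')
  rw [laplacian_log_planeMetric hk ha hc] at h1
  have h2 : Laplacian.laplacian (fun z => Real.log (planeMetric β k z)) a =
    -2 * planeMetric β k a := by exact_mod_cast h1
  rw [laplacian_comp_const_add (fun z => Real.log (planeMetric β k z)), h2]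
  simp only [add_zero]
  field_simp

lemma isSphericalConicalMetric_coneMetric (hβ : 0 < β) (hk : β < k) :
    IsSphericalConicalMetric (coneMetric β k) (conePoints β k) (coneAngle β) := by
  have hk0 : 0 < k := by exact_mod_cast hβ.trans hk
  constructor
  · intro p hp
    induction p using OnePoint.rec with
    | infty => exact ⟨hβ, isConicalAt_infty hβ hk⟩
    | coe z =>
      by_cases hz : z = 0
      · subst hz
        rw [coneAngle_zero]
        exact ⟨hβ, isConicalAt_zero hβ hk0⟩
      · rw [coneAngle_of_ne_zero β hz]
        exact ⟨two_pos, isConicalAt_of_crit hβ hk hz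
          (((coe_mem_conePoints hβ hk0 z).1 hp).resolve_left hz)⟩
  · intro p hp
    obtain ⟨z, rfl, hz, hc⟩ := (notMem_conePoints hβ hk0).1 hp
    exact isSphericalAt_coneMetric hk0 hz hc

/-! ### Continuity and boundedness of `h₁ / h₂` -/

lemma hQuot_coe (z : ℂ) : hQuot β k (z : OnePoint ℂ) = planeQuot β k z := rfl

lemma continuousAt_planeQuot_zero (hβ : 0 < β) (hk : 0 < k) :
    ContinuousAt (planeQuot β k) 0 := by
  rw [planeQuot_eq_radialQuot]
  refine continuousAt_radialQuot hβ ?_ ?_ ?_ ?_ (by simp [den_zero hk])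
  · exact (contDiffAt_mul_conj (n := 0) (contDiffAt_den' 0) (contDiffAt_den 0)).continuousAt
  · exact (contDiffAt_mul_conj (n := 0) (contDiffAt_num' 0) (contDiffAt_num 0)).neg.continuousAt
  · exact (contDiffAt_mul_conj (n := 0) (contDiffAt_den 0) (contDiffAt_den 0)).continuousAt
  · exact (contDiffAt_mul_conj (n := 0) (contDiffAt_num 0) (contDiffAt_num 0)).continuousAt

lemma continuous_planeQuot (hβ : 0 < β) (hk : 0 < k) : Continuous (planeQuot β k) :=
  continuous_iff_continuousAt.2 fun a => by
    by_cases ha : a = 0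
    · exact ha ▸ continuousAt_planeQuot_zero hβ hk
    · exact (contDiffAt_planeQuot (n := 0) hk ha).continuousAt

lemma tendsto_planeQuot_neg (hβ : 0 < β) (hk : β < k) :
    Tendsto (planeQuot (-β) k) (𝓝[≠] 0) (𝓝 1) := by
  have hn := num_neg_zero_ne_zero hβ hk
  have hk0 : 0 < k := by exact_mod_cast hβ.trans hk
  have h := continuousAt_radialQuot hβ (X := fun z => -(num' (-β) k z * conj (num (-β) k z)))
    (Y := fun z => den' k z * conj (den k z)) (V := fun z => num (-β) k z * conj (num (-β) k z))
    (W := fun z => den k z * conj (den k z))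
    (contDiffAt_mul_conj (n := 0) (contDiffAt_num' 0) (contDiffAt_num 0)).neg.continuousAt
    (contDiffAt_mul_conj (n := 0) (contDiffAt_den' 0) (contDiffAt_den 0)).continuousAt
    (contDiffAt_mul_conj (n := 0) (contDiffAt_num 0) (contDiffAt_num 0)).continuousAt
    (contDiffAt_mul_conj (n := 0) (contDiffAt_den 0) (contDiffAt_den 0)).continuousAt
    (by simp [hn])
  rw [ContinuousAt, radialQuot_zero hβ] at h
  have e : -(num' (-β) k 0 * conj (num (-β) k 0)) / (num (-β) k 0 * conj (num (-β) k 0)) = 1 := by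
    have : num' (-β) k 0 = -num (-β) k 0 := by simp [num', num, hk0.ne']
    rw [this, neg_mul, neg_neg]
    exact div_self (by simp [hn])
  rw [e] at h
  refine (h.mono_left nhdsWithin_le_nhds).congr' ?_
  filter_upwards [self_mem_nhdsWithin] with z hz using (planeQuot_neg_eq_radialQuot hz).symm

lemma tendsto_planeQuot_cobounded (hβ : 0 < β) (hk : β < k) :
    Tendsto (planeQuot β k) (Bornology.cobounded ℂ) (𝓝 (-1)) := by
  have h := ((tendsto_planeQuot_neg hβ hk).neg).comp (tendsto_inv₀_cobounded' (α := ℂ))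
  refine h.congr' ?_
  filter_upwards [(Filter.hasBasis_cobounded_norm (E := ℂ)).mem_of_mem (i := 1) trivial] with z hz
  have hz0 : z ≠ 0 := by
    rintro rfl
    simp at hz
    linarith
  have := planeQuot_inv (β := β) (k := k) (inv_ne_zero hz0)
  simpa using this.symm

lemma exists_norm_hQuot_le (hβ : 0 < β) (hk : β < k) : ∃ C : ℝ, ∀ p, ‖hQuot β k p‖ ≤ C := by
  have hk0 : 0 < k := by exact_mod_cast hβ.trans hk
  have h1 : ∀ᶠ z in cocompact ℂ, ‖planeQuot β k z‖ < 2 := by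
    rw [← Metric.cobounded_eq_cocompact]
    exact (tendsto_planeQuot_cobounded hβ hk).norm.eventually (gt_mem_nhds (by norm_num))
  obtain ⟨K, hK, hK'⟩ := (hasBasis_cocompact.eventually_iff).1 h1
  obtain ⟨C, hC⟩ := hK.exists_bound_of_continuousOn (continuous_planeQuot hβ hk0).continuousOn
  refine ⟨max C 2, fun p => ?_⟩
  induction p using OnePoint.rec with
  | infty =>
    refine le_trans ?_ (le_max_right _ _)
    change ‖(-1 : ℂ)‖ ≤ 2
    simp
  | coe z =>
    rw [hQuot_coe]
    by_cases hz : z ∈ K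
    · exact (hC z hz).trans (le_max_left _ _)
    · exact (hK' hz).le.trans (le_max_right _ _)

end Params

/-! ### Integrals of radial functions and `L²` convergence -/

lemma lintegral_radial {f : ℝ → ℝ} (hf : ∀ y, 0 ≤ f y) (a : ℂ)
    (hi : IntegrableOn (fun y => y * f y) (Set.Ioi 0)) :
    ∫⁻ z : ℂ, ENNReal.ofReal (f ‖z - a‖) =
      ENNReal.ofReal (2 * Real.pi * ∫ y in Set.Ioi 0, y * f y) := by
  have hint : Integrable (fun z : ℂ => f ‖z‖) := by
    rw [integrable_fun_norm_addHaar volume]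
    simpa using hi
  rw [lintegral_sub_right_eq_self (fun z : ℂ => ENNReal.ofReal (f ‖z‖)) a,
    ← ofReal_integral_eq_lintegral_ofReal hint (Eventually.of_forall fun z => hf _),
    integral_fun_norm_addHaar volume f]
  congr 1
  simp [Measure.real, mul_assoc]

section LTwo

variable {α E : Type*} [MeasurableSpace α] {μ : Measure α} [NormedAddCommGroup E]

lemma tendsto_eLpNorm_two_of_lintegral {F : ℕ → α → E}
    (h : Tendsto (fun n => ∫⁻ x, ‖F n x‖ₑ ^ (2 : ℝ) ∂μ) atTop (𝓝 0)) :
    Tendsto (fun n => eLpNorm (F n) 2 μ) atTop (𝓝 0) := by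
  have h1 := (ENNReal.continuous_rpow_const (y := 1 / 2)).continuousAt.tendsto.comp h
  simpa [Function.comp_def, eLpNorm_eq_lintegral_rpow_enorm_toReal] using h1

lemma tendsto_eLpNorm_two_of_dominated {F : ℕ → α → E} {G : α → ℝ}
    (hF : ∀ n, AEStronglyMeasurable (F n) μ) (hG : MemLp G 2 μ)
    (hb : ∀ n, ∀ᵐ x ∂μ, ‖F n x‖ ≤ ‖G x‖)
    (hlim : ∀ᵐ x ∂μ, Tendsto (fun n => F n x) atTop (𝓝 0)) :
    Tendsto (fun n => eLpNorm (F n) 2 μ) atTop (𝓝 0) := by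
  refine tendsto_eLpNorm_two_of_lintegral ?_
  have h0 : ∫⁻ x, ‖G x‖ₑ ^ (2 : ℝ) ∂μ ≠ ⊤ := by
    have := lintegral_rpow_enorm_lt_top_of_eLpNorm_lt_top two_ne_zero ENNReal.ofNat_ne_top hG.2
    simpa using this.ne
  have := tendsto_lintegral_of_dominated_convergence' (F := fun n x => ‖F n x‖ₑ ^ (2 : ℝ))
    (f := fun _ => 0) (fun x => ‖G x‖ₑ ^ (2 : ℝ)) (fun n => (hF n).enorm.pow_const _) ?_ h0 ?_
  · simpa using this
  · intro n
    filter_upwards [hb n] with x hx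
    gcongr
    exact enorm_le_iff_norm_le.2 hx
  · filter_upwards [hlim] with x hx
    have h1 := (ENNReal.continuous_rpow_const (y := 2)).continuousAt.tendsto.comp hx.enorm
    simpa [Function.comp_def] using h1

end LTwo

/-! ### Cut-off functions: finite sets have zero capacity -/

/-- A sequence of smooth cut-off functions with values in `[0, 1]`, converging to `1` almost
everywhere, with Dirichlet energy tending to zero. -/
structure IsCutoffSeq (χ : ℕ → ℂ → ℝ) : Prop where
  smooth : ∀ n, ContDiff ℝ (⊤ : ℕ∞) (χ n)
  nonneg : ∀ n z, 0 ≤ χ n z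
  le_one : ∀ n z, χ n z ≤ 1
  energy : Tendsto (fun n => eLpNorm (fderiv ℝ (χ n)) 2 volume) atTop (𝓝 0)
  tendsto : ∀ᵐ z, Tendsto (fun n => χ n z) atTop (𝓝 1)

namespace IsCutoffSeq

lemma abs_le_one {χ : ℕ → ℂ → ℝ} (h : IsCutoffSeq χ) (n : ℕ) (z : ℂ) : ‖χ n z‖ ≤ 1 := by
  rw [Real.norm_eq_abs, abs_of_nonneg (h.nonneg n z)]; exact h.le_one n z

lemma mul {χ χ' : ℕ → ℂ → ℝ} (h : IsCutoffSeq χ) (h' : IsCutoffSeq χ') :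
    IsCutoffSeq fun n z => χ n z * χ' n z where
  smooth n := (h.smooth n).mul (h'.smooth n)
  nonneg n z := mul_nonneg (h.nonneg n z) (h'.nonneg n z)
  le_one n z := mul_le_one₀ (h.le_one n z) (h'.nonneg n z) (h'.le_one n z)
  energy := by
    refine tendsto_of_tendsto_of_tendsto_of_le_of_le tendsto_const_nhds
      (by simpa using h.energy.add h'.energy) (fun _ => zero_le) fun n => ?_
    have hm : ∀ f : ℂ → ℝ, AEStronglyMeasurable (fun z => ‖fderiv ℝ f z‖) volume := fun f =>
      (measurable_fderiv ℝ f).norm.aestronglyMeasurable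
    calc eLpNorm (fderiv ℝ fun z => χ n z * χ' n z) 2 volume
        ≤ eLpNorm (fun z => ‖fderiv ℝ (χ n) z‖ + ‖fderiv ℝ (χ' n) z‖) 2 volume := by
          refine eLpNorm_mono_real fun z => ?_
          rw [fderiv_fun_mul ((h.smooth n).differentiable (by simp) z)
            ((h'.smooth n).differentiable (by simp) z)]
          refine (norm_add_le _ _).trans ?_
          rw [norm_smul, norm_smul, add_comm]
          gcongr
          · exact mul_le_of_le_one_left (norm_nonneg _) (h'.abs_le_one n z)
          · exact mul_le_of_le_one_left (norm_nonneg _) (h.abs_le_one n z)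
      _ ≤ _ := (eLpNorm_add_le (hm _) (hm _) one_le_two).trans (by simp only [eLpNorm_norm]; rfl)
  tendsto := by
    filter_upwards [h.tendsto, h'.tendsto] with z h1 h2
    simpa using h1.mul h2

end IsCutoffSeq

lemma exists_deriv_smoothTransition_le : ∃ K : ℝ, ∀ x, |deriv Real.smoothTransition x| ≤ K := by
  have hc : Continuous (deriv Real.smoothTransition) :=
    (Real.smoothTransition.contDiff (n := 1)).continuous_deriv le_rfl
  obtain ⟨K, hK⟩ := isCompact_Icc.exists_bound_of_continuousOn (s := Set.Icc (0 : ℝ) 1) hc.continuousOn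
  refine ⟨max K 0, fun x => ?_⟩
  by_cases hx : x ∈ Set.Icc (0 : ℝ) 1
  · exact (hK x hx).trans (le_max_left _ _)
  · have : deriv Real.smoothTransition x = 0 := by
      rcases lt_or_ge x 0 with h | h
      · have : Real.smoothTransition =ᶠ[𝓝 x] fun _ => 0 := by
          filter_upwards [gt_mem_nhds h] with y hy using Real.smoothTransition.zero_of_nonpos hy.le
        rw [this.deriv_eq]; simp
      · have h1 : 1 < x := by
          by_contra h1
          exact hx ⟨h, not_lt.1 h1⟩
        have : Real.smoothTransition =ᶠ[𝓝 x] fun _ => 1 := by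
          filter_upwards [lt_mem_nhds h1] with y hy using Real.smoothTransition.one_of_one_le hy.le
        rw [this.deriv_eq]; simp
    rw [this]; simp

/-- A smooth function of `|z - a| ^ ε`. -/
def radialCutoff (c d ε : ℝ) (a z : ℂ) : ℝ := Real.smoothTransition (c + d * ‖z - a‖ ^ ε)

section RadialCutoff

variable {c d ε : ℝ} {a : ℂ}

lemma continuous_norm_sub_rpow (hε : 0 < ε) : Continuous fun z : ℂ => ‖z - a‖ ^ ε :=
  (continuous_id.sub continuous_const).norm.rpow_const fun _ => Or.inr hε.le

lemma contDiff_radialCutoff (hε : 0 < ε) (hc : c < 0 ∨ 1 < c) :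
    ContDiff ℝ (⊤ : ℕ∞) (radialCutoff c d ε a) := by
  refine contDiff_iff_contDiffAt.2 fun z => ?_
  by_cases hz : z = a
  · have hcont : ContinuousAt (fun z : ℂ => c + d * ‖z - a‖ ^ ε) z := by
      have := (continuous_norm_sub_rpow (a := a) hε).continuousAt (x := z)
      fun_prop
    have h0 : c + d * ‖z - a‖ ^ ε = c := by simp [hz, hε.ne']
    rcases hc with hc | hc
    · refine (contDiffAt_const (c := (0 : ℝ))).congr_of_eventuallyEq ?_
      filter_upwards [hcont.eventually (gt_mem_nhds (h0.trans_lt hc))] with w hw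
      exact Real.smoothTransition.zero_of_nonpos hw.le
    · refine (contDiffAt_const (c := (1 : ℝ))).congr_of_eventuallyEq ?_
      filter_upwards [hcont.eventually (lt_mem_nhds (hc.trans_eq h0.symm))] with w hw
      exact Real.smoothTransition.one_of_one_le hw.le
  · have h1 : ContDiffAt ℝ (⊤ : ℕ∞) (fun z : ℂ => ‖z - a‖ ^ ε) z :=
      (contDiffAt_norm_rpow ε (sub_ne_zero.2 hz)).comp z (contDiffAt_id.sub contDiffAt_const)
    exact Real.smoothTransition.contDiffAt.comp z (contDiffAt_const.add (contDiffAt_const.mul h1))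

lemma norm_fderiv_radialCutoff_le {K : ℝ} (hK : ∀ x, |deriv Real.smoothTransition x| ≤ K)
    (hε : 0 < ε) {z : ℂ} (hz : z ≠ a) :
    ‖fderiv ℝ (radialCutoff c d ε a) z‖ ≤ K * |d| * (ε * ‖z - a‖ ^ (ε - 1)) := by
  obtain ⟨L, hL, hL'⟩ := hasFDerivAt_norm_rpow_real ε (sub_ne_zero.2 hz)
  have h1 : HasFDerivAt (fun z : ℂ => ‖z - a‖ ^ ε) L z := by
    have := HasFDerivAt.comp z hL ((hasFDerivAt_id z).sub_const a)
    rwa [ContinuousLinearMap.comp_id] at this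
  have h2 : HasDerivAt Real.smoothTransition _ (c + d * ‖z - a‖ ^ ε) :=
    ((Real.smoothTransition.contDiff (n := 1)).differentiable one_ne_zero _).hasDerivAt
  have h3 : HasFDerivAt (radialCutoff c d ε a) _ z :=
    h2.comp_hasFDerivAt z ((h1.const_mul d).const_add c)
  rw [h3.fderiv, norm_smul, norm_smul, mul_assoc]
  rw [abs_of_pos hε] at hL'
  have := (abs_nonneg _).trans (hK 0)
  rw [Real.norm_eq_abs, Real.norm_eq_abs]
  gcongr
  exact hK _

lemma fderiv_radialCutoff_of_lt (hε : 0 < ε) {z : ℂ} (h : 1 < c + d * ‖z - a‖ ^ ε) :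
    fderiv ℝ (radialCutoff c d ε a) z = 0 := by
  have : radialCutoff c d ε a =ᶠ[𝓝 z] fun _ => 1 := by
    have hcont : ContinuousAt (fun z : ℂ => c + d * ‖z - a‖ ^ ε) z := by
      have := (continuous_norm_sub_rpow (a := a) hε).continuousAt (x := z)
      fun_prop
    filter_upwards [hcont.eventually (lt_mem_nhds h)] with w hw
    exact Real.smoothTransition.one_of_one_le hw.le
  rw [this.fderiv_eq]; simp

lemma fderiv_radialCutoff_of_gt (hε : 0 < ε) {z : ℂ} (h : c + d * ‖z - a‖ ^ ε < 0) :
    fderiv ℝ (radialCutoff c d ε a) z = 0 := by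
  have : radialCutoff c d ε a =ᶠ[𝓝 z] fun _ => 0 := by
    have hcont : ContinuousAt (fun z : ℂ => c + d * ‖z - a‖ ^ ε) z := by
      have := (continuous_norm_sub_rpow (a := a) hε).continuousAt (x := z)
      fun_prop
    filter_upwards [hcont.eventually (gt_mem_nhds h)] with w hw
    exact Real.smoothTransition.zero_of_nonpos hw.le
  rw [this.fderiv_eq]; simp

end RadialCutoff

/-- Sequences of radial cut-offs have energy tending to zero, if their gradients are dominated by
`ε f ^ (1 / 2)` with `∫ y f(y) dy` of order `1 / ε`. -/
lemma tendsto_energy {χ : ℕ → ℂ → ℝ} {a : ℂ} {C : ℝ} {f : ℕ → ℝ → ℝ}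
    (hf : ∀ n y, 0 ≤ f n y) (hi : ∀ n, IntegrableOn (fun y => y * f n y) (Set.Ioi 0))
    (hI : ∀ n, ∫ y in Set.Ioi 0, y * f n y ≤ n + 1)
    (hb : ∀ n z, z ≠ a → ‖fderiv ℝ (χ n) z‖ ^ 2 ≤ C * (1 / (n + 1 : ℝ)) ^ 2 * f n ‖z - a‖) :
    Tendsto (fun n => eLpNorm (fderiv ℝ (χ n)) 2 volume) atTop (𝓝 0) := by
  have hC : ∀ n, 0 ≤ max C 0 * (1 / (n + 1 : ℝ)) ^ 2 := fun n => by positivity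
  refine tendsto_eLpNorm_two_of_lintegral ?_
  have h1 : ∀ n, ∫⁻ z, ‖fderiv ℝ (χ n) z‖ₑ ^ (2 : ℝ) ≤
      ENNReal.ofReal (max C 0 * (2 * Real.pi) * (1 / (n + 1 : ℝ))) := by
    intro n
    calc ∫⁻ z, ‖fderiv ℝ (χ n) z‖ₑ ^ (2 : ℝ)
        ≤ ∫⁻ z, ENNReal.ofReal (max C 0 * (1 / (n + 1 : ℝ)) ^ 2 * f n ‖z - a‖) := by
          refine lintegral_mono_ae ?_
          have : ∀ᵐ z : ℂ, z ≠ a := by simp [ae_iff, measure_singleton]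
          filter_upwards [this] with z hz
          rw [← ofReal_norm, ENNReal.ofReal_rpow_of_nonneg (norm_nonneg _) zero_le_two]
          refine ENNReal.ofReal_le_ofReal ?_
          rw [Real.rpow_two]
          refine (hb n z hz).trans ?_
          gcongr
          · exact hf n _
          · exact le_max_left _ _
      _ = ENNReal.ofReal (2 * Real.pi *
            ∫ y in Set.Ioi 0, y * (max C 0 * (1 / (n + 1 : ℝ)) ^ 2 * f n y)) := by
          refine lintegral_radial (f := fun y => max C 0 * (1 / (n + 1 : ℝ)) ^ 2 * f n y)
            (fun y => mul_nonneg (hC n) (hf n y)) a ?_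
          refine IntegrableOn.congr_fun ((hi n).const_mul (max C 0 * (1 / (n + 1 : ℝ)) ^ 2))
            (fun y _ => ?_) measurableSet_Ioi
          ring
      _ ≤ _ := by
          refine ENNReal.ofReal_le_ofReal ?_
          have : ∀ y, y * (max C 0 * (1 / (n + 1 : ℝ)) ^ 2 * f n y) =
              max C 0 * (1 / (n + 1 : ℝ)) ^ 2 * (y * f n y) := fun y => by ring
          simp only [this]
          rw [integral_const_mul]
          calc 2 * Real.pi * (max C 0 * (1 / (n + 1 : ℝ)) ^ 2 * ∫ y in Set.Ioi 0, y * f n y)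
              ≤ 2 * Real.pi * (max C 0 * (1 / (n + 1 : ℝ)) ^ 2 * (n + 1)) := by
                gcongr
                exact hI n
            _ = _ := by field_simp
  refine tendsto_of_tendsto_of_tendsto_of_le_of_le tendsto_const_nhds ?_ (fun _ => zero_le) h1
  have h2 := (tendsto_one_div_add_atTop_nhds_zero_nat (𝕜 := ℝ)).const_mul (max C 0 * (2 * Real.pi))
  rw [mul_zero] at h2
  simpa using ENNReal.tendsto_ofReal h2

lemma tendsto_rpow_one_div {r : ℝ} (hr : 0 < r) :
    Tendsto (fun n : ℕ => r ^ (1 / (n + 1 : ℝ))) atTop (𝓝 1) := by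
  have := (Real.continuousAt_const_rpow (b := 0) hr.ne').tendsto.comp
    (tendsto_one_div_add_atTop_nhds_zero_nat (𝕜 := ℝ))
  simpa [Function.comp_def] using this

lemma integral_radial_indicator {s : Set ℝ} (hs : MeasurableSet s) (hs0 : s ⊆ Set.Ioi 0) (e : ℝ)
    (hi : IntegrableOn (fun y : ℝ => y ^ (e - 1)) s) :
    IntegrableOn (fun y => y * s.indicator (fun y => y ^ (e - 2)) y) (Set.Ioi 0) ∧
      ∫ y in Set.Ioi 0, y * s.indicator (fun y => y ^ (e - 2)) y = ∫ y in s, y ^ (e - 1) := by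
  have h1 : (fun y : ℝ => y * s.indicator (fun y => y ^ (e - 2)) y) =
      s.indicator fun y => y ^ (e - 1) := by
    ext y
    by_cases hy : y ∈ s
    · have h2 : y ^ (e - 1) = y ^ (1 : ℝ) * y ^ (e - 2) := by
        rw [← Real.rpow_add (hs0 hy)]; congr 1; ring
      rw [Set.indicator_of_mem hy, Set.indicator_of_mem hy, h2, Real.rpow_one]
    · simp [hy]
  rw [h1]
  refine ⟨?_, ?_⟩
  · exact ((integrable_indicator_iff hs).2 hi).integrableOn
  · rw [setIntegral_indicator hs, Set.inter_eq_right.2 hs0]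

/-- Cut-offs vanishing near a point `a`: smooth steps of `2 |z - a| ^ ε - 1` with `ε = 1 / (n + 1)`. Their
energy is of order `ε² ∫ r ^ (2 ε - 1) dr` over `r ≤ 1`, that is, of order `ε`. -/
lemma exists_isCutoffSeq_point (a : ℂ) : ∃ χ, IsCutoffSeq χ ∧ ∀ n, χ n =ᶠ[𝓝 a] 0 := by
  obtain ⟨K, hK⟩ := exists_deriv_smoothTransition_le
  have hε : ∀ n : ℕ, 0 < 1 / (n + 1 : ℝ) := fun n => Nat.one_div_pos_of_nat
  have hI := fun n : ℕ => integral_radial_indicator (s := Set.Ioc 0 1) measurableSet_Ioc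
    (fun y hy => hy.1) (2 * (1 / (n + 1 : ℝ))) (by
      rw [← intervalIntegrable_iff_integrableOn_Ioc_of_le zero_le_one]
      exact intervalIntegral.intervalIntegrable_rpow' (by linarith [hε n]))
  refine ⟨fun n => radialCutoff (-1) 2 (1 / (n + 1 : ℝ)) a, ⟨fun n =>
    contDiff_radialCutoff (hε n) (Or.inl (by norm_num)), fun n z => Real.smoothTransition.nonneg _,
    fun n z => Real.smoothTransition.le_one _, ?_, ?_⟩, fun n => ?_⟩
  · refine tendsto_energy (a := a) (C := (K * |2|) ^ 2)
      (f := fun n => (Set.Ioc 0 1).indicator fun y => y ^ (2 * (1 / (n + 1 : ℝ)) - 2))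
      (fun n y => Set.indicator_nonneg (fun y hy => Real.rpow_nonneg hy.1.le _) y)
      (fun n => (hI n).1) (fun n => ?_) (fun n z hz => ?_)
    · rw [(hI n).2, ← intervalIntegral.integral_of_le zero_le_one,
        integral_rpow (Or.inl (by linarith [hε n]))]
      have : (2 * (1 / (n + 1 : ℝ)) - 1 + 1) ≠ 0 := by linarith [hε n]
      rw [Real.one_rpow, Real.zero_rpow this]
      have h1 : (n : ℝ) + 1 ≠ 0 := by positivity
      field_simp
      norm_num
    · by_cases h1 : ‖z - a‖ ≤ 1
      · have h0 : 0 < ‖z - a‖ := norm_pos_iff.2 (sub_ne_zero.2 hz)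
        have h2 := norm_fderiv_radialCutoff_le (c := -1) (d := 2) hK (hε n) hz
        rw [Set.indicator_of_mem (Set.mem_Ioc.2 ⟨h0, h1⟩)]
        refine (pow_le_pow_left₀ (norm_nonneg _) h2 2).trans_eq ?_
        have : ‖z - a‖ ^ (2 * (1 / (n + 1 : ℝ)) - 2) = (‖z - a‖ ^ (1 / (n + 1 : ℝ) - 1)) ^ 2 := by
          rw [← Real.rpow_natCast, ← Real.rpow_mul h0.le]; congr 1; push_cast; ring
        rw [this]; ring
      · have h2 : 1 < -1 + 2 * ‖z - a‖ ^ (1 / (n + 1 : ℝ)) := by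
          linarith [Real.one_lt_rpow (not_le.1 h1) (hε n)]
        rw [fderiv_radialCutoff_of_lt (hε n) h2, norm_zero, zero_pow two_ne_zero]
        exact mul_nonneg (by positivity)
          (Set.indicator_nonneg (fun y hy => Real.rpow_nonneg hy.1.le _) _)
  · have : ∀ᵐ z : ℂ, z ≠ a := by simp [ae_iff, measure_singleton]
    filter_upwards [this] with z hz
    have h1 := (tendsto_rpow_one_div (norm_pos_iff.2 (sub_ne_zero.2 hz))).const_mul 2
    have h2 := (Real.smoothTransition.continuous.tendsto _).comp (h1.const_add (-1))
    norm_num [Real.smoothTransition.one] at h2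
    simpa [Function.comp_def, radialCutoff] using h2
  · have h1 : ContinuousAt (fun z : ℂ => -1 + 2 * ‖z - a‖ ^ (1 / (n + 1 : ℝ))) a := by
      have := (continuous_norm_sub_rpow (a := a) (hε n)).continuousAt (x := a)
      fun_prop
    have h2 : -1 + 2 * ‖a - a‖ ^ (1 / (n + 1 : ℝ)) < 0 := by
      rw [sub_self, norm_zero, Real.zero_rpow (hε n).ne']; norm_num
    filter_upwards [h1.eventually (gt_mem_nhds h2)] with z hz
    exact Real.smoothTransition.zero_of_nonpos hz.le

/-- Cut-offs vanishing near `∞`: smooth steps of `3 - |z| ^ ε` with `ε = 1 / (n + 1)`. The gradient is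
supported where `1 ≤ |z| ^ ε ≤ 3`, which makes the energy of order `ε`. -/
lemma exists_isCutoffSeq_infty : ∃ χ, IsCutoffSeq χ ∧ ∀ n, χ n =ᶠ[cocompact ℂ] 0 := by
  obtain ⟨K, hK⟩ := exists_deriv_smoothTransition_le
  have hε : ∀ n : ℕ, 0 < 1 / (n + 1 : ℝ) := fun n => Nat.one_div_pos_of_nat
  have hI := fun n : ℕ => integral_radial_indicator (s := Set.Ioi 1) measurableSet_Ioi
    (Set.Ioi_subset_Ioi zero_le_one) (-2 * (1 / (n + 1 : ℝ)))
      (integrableOn_Ioi_rpow_of_lt (by linarith [hε n]) one_pos)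
  refine ⟨fun n => radialCutoff 3 (-1) (1 / (n + 1 : ℝ)) 0, ⟨fun n =>
    contDiff_radialCutoff (hε n) (Or.inr (by norm_num)), fun n z => Real.smoothTransition.nonneg _,
    fun n z => Real.smoothTransition.le_one _, ?_, ?_⟩, fun n => ?_⟩
  · refine tendsto_energy (a := 0) (C := (K * |-1|) ^ 2 * 3 ^ 4)
      (f := fun n => (Set.Ioi 1).indicator fun y => y ^ (-2 * (1 / (n + 1 : ℝ)) - 2))
      (fun n y => Set.indicator_nonneg
        (fun y hy => Real.rpow_nonneg (zero_le_one.trans (Set.mem_Ioi.1 hy).le) _) y)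
      (fun n => (hI n).1) (fun n => ?_) (fun n z hz => ?_)
    · rw [(hI n).2, integral_Ioi_rpow_of_lt (by linarith [hε n]) one_pos, Real.one_rpow]
      have h1 : (n : ℝ) + 1 ≠ 0 := by positivity
      have h2 : -1 / (-2 * (1 / (n + 1 : ℝ)) - 1 + 1) = (n + 1 : ℝ) / 2 := by
        rw [sub_add_cancel]; field_simp
      rw [h2]
      linarith [Nat.cast_nonneg (α := ℝ) n]
    · have h0 : 0 < ‖z - 0‖ := norm_pos_iff.2 (sub_ne_zero.2 hz)
      have hnn : 0 ≤ (K * |-1|) ^ 2 * 3 ^ 4 * (1 / (n + 1 : ℝ)) ^ 2 * (Set.Ioi 1).indicator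
          (fun y : ℝ => y ^ (-2 * (1 / (n + 1 : ℝ)) - 2)) ‖z - 0‖ :=
        mul_nonneg (by positivity) (Set.indicator_nonneg
          (fun y hy => Real.rpow_nonneg (zero_le_one.trans (Set.mem_Ioi.1 hy).le) _) _)
      by_cases h1 : ‖z - 0‖ ≤ 1
      · have h2 : 1 < 3 + (-1) * ‖z - 0‖ ^ (1 / (n + 1 : ℝ)) := by
          linarith [Real.rpow_le_one h0.le h1 (hε n).le]
        rwa [fderiv_radialCutoff_of_lt (hε n) h2, norm_zero, zero_pow two_ne_zero]
      by_cases h3 : 3 < ‖z - 0‖ ^ (1 / (n + 1 : ℝ))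
      · have h2 : 3 + (-1) * ‖z - 0‖ ^ (1 / (n + 1 : ℝ)) < 0 := by linarith
        rwa [fderiv_radialCutoff_of_gt (hε n) h2, norm_zero, zero_pow two_ne_zero]
      have h2 := norm_fderiv_radialCutoff_le (c := 3) (d := -1) hK (hε n) hz
      rw [Set.indicator_of_mem (Set.mem_Ioi.2 (not_le.1 h1))]
      refine (pow_le_pow_left₀ (norm_nonneg _) h2 2).trans ?_
      generalize ‖z - 0‖ = r at *
      generalize 1 / (n + 1 : ℝ) = ε at *
      -- on the support of the gradient, `r ^ (2 ε) ≤ 3 ^ 4 r ^ (-2 ε)`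
      have e1 : r ^ (-2 * ε - 2) = (r ^ ε)⁻¹ ^ 2 * (r ^ 2)⁻¹ := by
        rw [← Real.rpow_neg h0.le, ← Real.rpow_natCast (r ^ (-ε)), ← Real.rpow_mul h0.le,
          ← Real.rpow_two, ← Real.rpow_neg h0.le, ← Real.rpow_add h0]
        congr 1; push_cast; ring
      have e2 : r ^ (ε - 1) = r ^ ε * r⁻¹ := by
        rw [Real.rpow_sub h0, Real.rpow_one]; rfl
      have h5 : 0 < r ^ ε := by positivity
      have h6 : (r ^ ε) ^ 2 ≤ 3 ^ 4 * ((r ^ ε)⁻¹) ^ 2 := by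
        rw [inv_pow, ← div_eq_mul_inv, le_div_iff₀ (by positivity), ← pow_add]
        exact pow_le_pow_left₀ h5.le (not_lt.1 h3) 4
      rw [e1, e2]
      calc (K * |-1| * (ε * (r ^ ε * r⁻¹))) ^ 2
          = (K * |-1| * ε) ^ 2 * (r ^ 2)⁻¹ * (r ^ ε) ^ 2 := by rw [← inv_pow]; ring
        _ ≤ (K * |-1| * ε) ^ 2 * (r ^ 2)⁻¹ * (3 ^ 4 * ((r ^ ε)⁻¹) ^ 2) := by gcongr
        _ = _ := by ring
  · have : ∀ᵐ z : ℂ, z ≠ 0 := by simp [ae_iff, measure_singleton]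
    filter_upwards [this] with z hz
    have h1 := (tendsto_rpow_one_div (norm_pos_iff.2 (sub_ne_zero.2 hz))).const_mul (-1)
    have h2 := (Real.smoothTransition.continuous.tendsto _).comp (h1.const_add 3)
    norm_num [Real.smoothTransition.one_of_one_le] at h2
    simpa [Function.comp_def, radialCutoff] using h2
  · have h1 : Tendsto (fun z : ℂ => ‖z‖ ^ (1 / (n + 1 : ℝ))) (cocompact ℂ) atTop :=
      (tendsto_rpow_atTop (hε n)).comp (tendsto_norm_cocompact_atTop)
    filter_upwards [h1.eventually (eventually_ge_atTop 3)] with z hz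
    refine Real.smoothTransition.zero_of_nonpos ?_
    simp only [sub_zero]
    linarith

/-- Cut-offs vanishing near `∞` and near the points of a finite set. -/
lemma exists_isCutoffSeq (S : Finset ℂ) : ∃ χ, IsCutoffSeq χ ∧ (∀ n, χ n =ᶠ[cocompact ℂ] 0) ∧
    ∀ n, ∀ a ∈ S, χ n =ᶠ[𝓝 a] 0 := by
  classical
  induction S using Finset.induction_on with
  | empty =>
    obtain ⟨χ, h1, h2⟩ := exists_isCutoffSeq_infty
    exact ⟨χ, h1, h2, by simp⟩
  | insert a S _ ih =>
    obtain ⟨χ, h1, h2, h3⟩ := ih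
    obtain ⟨χ', h1', h2'⟩ := exists_isCutoffSeq_point a
    refine ⟨_, h1.mul h1', fun n => ?_, fun n b hb => ?_⟩
    · filter_upwards [h2 n] with z hz
      simp [hz]
    · rcases Finset.mem_insert.1 hb with rfl | hb
      · filter_upwards [h2' n] with z hz
        simp [hz]
      · filter_upwards [h3 n b hb] with z hz
        simp [hz]

/-! ### The form domain and the weak equation -/

section Friedrichs

variable {g : OnePoint ℂ → ℝ} {P : Finset (OnePoint ℂ)} {u : OnePoint ℂ → ℝ}

lemma contDiffAt_of_comp_const_add {F : Type*} [NormedAddCommGroup F] [NormedSpace ℝ F] {f : ℂ → F}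
    {n : WithTop ℕ∞} {a : ℂ} (hf : ContDiffAt ℝ n (fun ζ => f (a + ζ)) 0) : ContDiffAt ℝ n f a := by
  have h : ContDiffAt ℝ n (fun z : ℂ => z - a) a := by fun_prop
  have := ContDiffAt.comp (g := fun ζ => f (a + ζ)) a (by simpa using hf) h
  simpa [Function.comp_def] using this

/-- Extension by zero of a product of a cut-off function and `u` is a test function. -/
lemma isTestFunction_cutoff_mul {χ : ℂ → ℝ} (hχ : ContDiff ℝ (⊤ : ℕ∞) χ)
    (hχi : χ =ᶠ[cocompact ℂ] 0) (hχP : ∀ a : ℂ, (a : OnePoint ℂ) ∈ P → χ =ᶠ[𝓝 a] 0)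
    (hu : ∀ z : ℂ, (z : OnePoint ℂ) ∉ P →
      ContDiffAt ℝ (⊤ : ℕ∞) (fun z : ℂ => u (z : OnePoint ℂ)) z) :
    IsTestFunction P (fun p => p.elim 0 (fun z : ℂ => χ z * u (z : OnePoint ℂ))) := by
  have hzero : ∀ a : ℂ, (a : OnePoint ℂ) ∈ P →
      (fun z : ℂ => χ z * u (z : OnePoint ℂ)) =ᶠ[𝓝 a] 0 := fun a ha => by
    filter_upwards [hχP a ha] with z hz
    simp [hz]
  constructor
  · intro p
    induction p using OnePoint.rec with
    | infty =>
      refine (contDiffAt_const (c := (0 : ℝ))).congr_of_eventuallyEq ?_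
      have h1 : ∀ᶠ ζ in 𝓝[≠] (0 : ℂ), χ ζ⁻¹ = 0 := by
        have := Filter.tendsto_inv₀_nhdsNE_zero (α := ℂ)
        rw [Metric.cobounded_eq_cocompact] at this
        exact this.eventually hχi
      rw [eventually_nhdsWithin_iff] at h1
      filter_upwards [h1] with ζ hζ
      by_cases h0 : ζ = 0
      · subst h0
        have : param ∞ 0 = ∞ := if_pos rfl
        rw [this]; rfl
      · rw [param_infty h0]
        change χ ζ⁻¹ * _ = 0
        rw [hζ h0, zero_mul]
    | coe a =>
      change ContDiffAt ℝ _ (fun ζ : ℂ => χ (a + ζ) * u ((a + ζ : ℂ) : OnePoint ℂ)) 0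
      refine contDiffAt_comp_const_add (f := fun z : ℂ => χ z * u (z : OnePoint ℂ)) ?_
      by_cases ha : (a : OnePoint ℂ) ∈ P
      · exact (contDiffAt_const (c := (0 : ℝ))).congr_of_eventuallyEq (hzero a ha)
      · exact hχ.contDiffAt.mul (hu a ha)
  · intro p hp hpP
    revert hp
    rw [imp_false, notMem_tsupport_iff_eventuallyEq]
    induction p using OnePoint.rec with
    | infty =>
      rw [OnePoint.nhds_infty_eq, EventuallyEq, eventually_sup, eventually_map,
        coclosedCompact_eq_cocompact]
      refine ⟨?_, by simp⟩
      filter_upwards [hχi] with z hz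
      change χ z * _ = 0
      simp [hz]
    | coe a =>
      rw [OnePoint.nhds_coe_eq, EventuallyEq, eventually_map]
      exact hzero a hpP

/-- A bounded function with finite Dirichlet energy, smooth away from the cone points, is in the
form domain: it is approximated by its products with cut-off functions. -/
lemma inFormDomain_of_energy [IsFiniteMeasure (area g)] {C : ℝ}
    (hm : Measurable fun z : ℂ => u (z : OnePoint ℂ)) (hC : ∀ z : ℂ, ‖u (z : OnePoint ℂ)‖ ≤ C)
    (hu : ∀ z : ℂ, (z : OnePoint ℂ) ∉ P →
      ContDiffAt ℝ (⊤ : ℕ∞) (fun z : ℂ => u (z : OnePoint ℂ)) z)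
    (hE : MemLp (fderiv ℝ fun z : ℂ => u (z : OnePoint ℂ)) 2 volume) : InFormDomain g P u := by
  obtain ⟨χ, hχ, hχi, hχP⟩ := exists_isCutoffSeq (P.preimage _ OnePoint.coe_injective.injOn)
  have hχP' : ∀ n, ∀ a : ℂ, (a : OnePoint ℂ) ∈ P → χ n =ᶠ[𝓝 a] 0 := fun n a ha =>
    hχP n a (by simpa using ha)
  have hac : area g ≪ volume := withDensity_absolutelyContinuous _ _
  have hC0 : 0 ≤ C := (norm_nonneg _).trans (hC 0)
  set U : ℂ → ℝ := fun z => u (z : OnePoint ℂ) with hU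
  refine ⟨MemLp.of_bound hm.aestronglyMeasurable C (Eventually.of_forall hC),
    fun n p => p.elim 0 (fun z : ℂ => χ n z * u (z : OnePoint ℂ)),
    fun n => isTestFunction_cutoff_mul (hχ.smooth n) (hχi n) (hχP' n) hu, ?_, ?_⟩
  · change Tendsto (fun n => eLpNorm (fun z => χ n z * U z - U z) 2 (area g)) atTop (𝓝 0)
    refine tendsto_eLpNorm_two_of_dominated (G := fun _ => C)
      (fun n => (((hχ.smooth n).continuous.measurable.mul hm).sub hm).aestronglyMeasurable)
      (memLp_const C) (fun n => Eventually.of_forall fun z => ?_) ?_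
    · have h1 : χ n z * U z - U z = -((1 - χ n z) * U z) := by ring
      have h2 : ‖1 - χ n z‖ ≤ 1 := by
        rw [Real.norm_eq_abs, abs_le]
        constructor <;> linarith [hχ.nonneg n z, hχ.le_one n z]
      rw [h1, norm_neg, norm_mul, Real.norm_of_nonneg hC0]
      exact (mul_le_of_le_one_left (norm_nonneg _) h2).trans (hC z)
    · filter_upwards [hac.ae_le hχ.tendsto] with z hz
      simpa using (hz.mul_const (U z)).sub_const (U z)
  · have hfin : ∀ᵐ z : ℂ, (z : OnePoint ℂ) ∉ P := by
      have : (↑(P.preimage _ (OnePoint.coe_injective (X := ℂ)).injOn) : Set ℂ).Countable :=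
        (Finset.finite_toSet _).countable
      filter_upwards [this.ae_notMem volume] with z hz
      simpa using hz
    -- the gradients of the products converge to the gradient of `u`
    have hconv : Tendsto (fun n => eLpNorm
        (fun z => fderiv ℝ (fun z => χ n z * U z) z - fderiv ℝ U z) 2 volume) atTop (𝓝 0) := by
      have h1 : Tendsto (fun n => eLpNorm (fun z => (χ n z - 1) • fderiv ℝ U z) 2 volume) atTop
          (𝓝 0) := by
        refine tendsto_eLpNorm_two_of_dominated (G := fun z => ‖fderiv ℝ U z‖)
          (fun n => (((hχ.smooth n).continuous.measurable.sub_const 1).smul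
            (measurable_fderiv ℝ U)).aestronglyMeasurable)
          hE.norm (fun n => Eventually.of_forall fun z => ?_) ?_
        · rw [norm_norm, norm_smul]
          refine mul_le_of_le_one_left (norm_nonneg _) ?_
          rw [Real.norm_eq_abs, abs_le]
          constructor <;> linarith [hχ.nonneg n z, hχ.le_one n z]
        · filter_upwards [hχ.tendsto] with z hz
          simpa using (hz.sub_const 1).smul_const (fderiv ℝ U z)
      have h2 : Tendsto (fun n => ENNReal.ofReal C * eLpNorm (fderiv ℝ (χ n)) 2 volume) atTop
          (𝓝 0) := by
        simpa using ENNReal.Tendsto.const_mul hχ.energy (Or.inr ENNReal.ofReal_ne_top)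
      refine tendsto_of_tendsto_of_tendsto_of_le_of_le tendsto_const_nhds
        (by simpa using h1.add h2) (fun _ => zero_le) fun n => ?_
      have h3 : (fun z => fderiv ℝ (fun z => χ n z * U z) z - fderiv ℝ U z) =ᵐ[volume]
          fun z => (χ n z - 1) • fderiv ℝ U z + U z • fderiv ℝ (χ n) z := by
        filter_upwards [hfin] with z hz
        rw [fderiv_fun_mul ((hχ.smooth n).differentiable (by simp) z)
          ((hu z hz).differentiableAt (by simp)), sub_smul, one_smul]
        abel
      rw [eLpNorm_congr_ae h3]
      have m1 : AEStronglyMeasurable (fun z => (χ n z - 1) • fderiv ℝ U z) volume :=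
        (((hχ.smooth n).continuous.measurable.sub_const 1).smul
          (measurable_fderiv ℝ U)).aestronglyMeasurable
      have m2 : AEStronglyMeasurable (fun z => U z • fderiv ℝ (χ n) z) volume :=
        (hm.smul (measurable_fderiv ℝ (χ n))).aestronglyMeasurable
      refine (eLpNorm_add_le m1 m2 one_le_two).trans ?_
      gcongr
      refine eLpNorm_le_mul_eLpNorm_of_ae_le_mul (Eventually.of_forall fun z => ?_) 2
      rw [norm_smul]
      gcongr
      exact hC z
    have hmeas : ∀ n, AEStronglyMeasurable
        (fun z => fderiv ℝ (fun z => χ n z * U z) z - fderiv ℝ U z) volume := fun n =>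
      ((measurable_fderiv ℝ _).sub (measurable_fderiv ℝ U)).aestronglyMeasurable
    have hsum : Tendsto (fun mn : ℕ × ℕ =>
        eLpNorm (fun z => fderiv ℝ (fun z => χ mn.1 z * U z) z - fderiv ℝ U z) 2 volume +
        eLpNorm (fun z => fderiv ℝ (fun z => χ mn.2 z * U z) z - fderiv ℝ U z) 2 volume)
        atTop (𝓝 0) := by
      rw [← prod_atTop_atTop_eq]
      simpa using (hconv.comp tendsto_fst).add (hconv.comp tendsto_snd)
    refine tendsto_of_tendsto_of_tendsto_of_le_of_le tendsto_const_nhds hsum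
      (fun _ => zero_le) fun mn => ?_
    have h4 : (fun z => fderiv ℝ (fun z : ℂ => χ mn.1 z * U z - χ mn.2 z * U z) z) =ᵐ[volume]
        fun z => (fderiv ℝ (fun z => χ mn.1 z * U z) z - fderiv ℝ U z) -
          (fderiv ℝ (fun z => χ mn.2 z * U z) z - fderiv ℝ U z) := by
      filter_upwards [hfin] with z hz
      have hd : ∀ n, DifferentiableAt ℝ (fun z => χ n z * U z) z := fun n =>
        ((hχ.smooth n).differentiable (by simp) z).mul ((hu z hz).differentiableAt (n := (⊤ : ℕ∞)) (by simp))
      rw [fderiv_fun_sub (hd _) (hd _)]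
      abel
    exact (eLpNorm_congr_ae h4).trans_le (eLpNorm_sub_le (hmeas _) (hmeas _) one_le_two)

namespace IsTestFunction

variable {φ : OnePoint ℂ → ℝ}

lemma contDiff (h : IsTestFunction P φ) : ContDiff ℝ (⊤ : ℕ∞) fun z : ℂ => φ (z : OnePoint ℂ) :=
  contDiff_iff_contDiffAt.2 fun a =>
    contDiffAt_of_comp_const_add (f := fun z : ℂ => φ (z : OnePoint ℂ)) (h.1 a)

lemma notMem_of_mem_tsupport (h : IsTestFunction P φ) {z : ℂ}
    (hz : z ∈ tsupport fun z : ℂ => φ (z : OnePoint ℂ)) : (z : OnePoint ℂ) ∉ P :=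
  h.2 (tsupport_comp_subset_preimage φ OnePoint.continuous_coe hz)

lemma hasCompactSupport (h : IsTestFunction P φ) (hinf : ∞ ∈ P) :
    HasCompactSupport fun z : ℂ => φ (z : OnePoint ℂ) := by
  have h1 : ∞ ∉ tsupport φ := fun h' => h.2 h' hinf
  rw [notMem_tsupport_iff_eventuallyEq] at h1
  rw [hasCompactSupport_iff_eventuallyEq]
  exact OnePoint.tendsto_coe_infty.eventually h1

end IsTestFunction

lemma integrable_of_continuousAt_tsupport {f h : ℂ → ℝ} (hf : HasCompactSupport f)
    (h0 : ∀ z, z ∉ tsupport f → h z = 0) (hc : ∀ z ∈ tsupport f, ContinuousAt h z) :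
    Integrable h := by
  have h1 : Function.support h ⊆ tsupport f := fun z hz => by
    by_contra hz'
    exact hz (h0 z hz')
  rw [← integrableOn_iff_integrable_of_support_subset h1]
  exact ContinuousOn.integrableOn_compact hf fun z hz => (hc z hz).continuousWithinAt

/-- Green's formula for a function `U` that is smooth near the support of `f`. -/
lemma integral_mul_laplacian_eq {U f : ℂ → ℝ} (hf : ContDiff ℝ (⊤ : ℕ∞) f)
    (hc : HasCompactSupport f) (hU : ∀ z ∈ tsupport f, ContDiffAt ℝ (⊤ : ℕ∞) U z) :
    ∫ z, U z * Laplacian.laplacian f z = ∫ z, Laplacian.laplacian U z * f z := by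
  have hf1 : ∀ v z, ContDiffAt ℝ (⊤ : ℕ∞) (fun w => fderiv ℝ f w v) z := fun v z =>
    ((hf.contDiffAt (x := z)).fderiv_right (m := (⊤ : ℕ∞)) le_rfl).clm_apply contDiffAt_const
  have hU1 : ∀ v, ∀ z ∈ tsupport f, ContDiffAt ℝ (⊤ : ℕ∞) (fun w => fderiv ℝ U w v) z :=
    fun v z hz => ((hU z hz).fderiv_right (m := (⊤ : ℕ∞)) le_rfl).clm_apply contDiffAt_const
  have hcont : ∀ {h : ℂ → ℝ} {z : ℂ} (v : ℂ), ContDiffAt ℝ (⊤ : ℕ∞) h z →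
      ContinuousAt (fun w => fderiv ℝ h w v) z := fun v h =>
    ((h.fderiv_right (m := (⊤ : ℕ∞)) le_rfl).clm_apply contDiffAt_const).continuousAt
  have hts : ∀ v, tsupport (fun w => fderiv ℝ f w v) ⊆ tsupport f := fun v =>
    tsupport_fderiv_apply_subset ℝ v
  have z0 : ∀ z, z ∉ tsupport f → f z = 0 := fun z hz => image_eq_zero_of_notMem_tsupport hz
  have z1 : ∀ v z, z ∉ tsupport f → fderiv ℝ f z v = 0 := fun v z hz =>
    image_eq_zero_of_notMem_tsupport (f := fun w => fderiv ℝ f w v) fun h => hz (hts v h)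
  have z2 : ∀ v z, z ∉ tsupport f → fderiv ℝ (fun w => fderiv ℝ f w v) z v = 0 := fun v z hz =>
    image_eq_zero_of_notMem_tsupport (f := fun w => fderiv ℝ (fun w => fderiv ℝ f w v) w v)
      fun h => hz (hts v (tsupport_fderiv_apply_subset ℝ v h))
  have hfd : Differentiable ℝ f := hf.differentiable (by simp)
  have i0 : ∀ v, Integrable fun z => U z * fderiv ℝ (fun w => fderiv ℝ f w v) z v := fun v =>
    integrable_of_continuousAt_tsupport hc (fun z hz => by simp [z2 v z hz])
      fun z hz => (hU z hz).continuousAt.mul (hcont v (hf1 v z))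
  have i1 : ∀ v, Integrable fun z => fderiv ℝ U z v * fderiv ℝ f z v := fun v =>
    integrable_of_continuousAt_tsupport hc (fun z hz => by simp [z1 v z hz])
      fun z hz => (hcont v (hU z hz)).mul (hcont v hf.contDiffAt)
  have i2 : ∀ v, Integrable fun z => fderiv ℝ (fun w => fderiv ℝ U w v) z v * f z := fun v =>
    integrable_of_continuousAt_tsupport hc (fun z hz => by simp [z0 z hz])
      fun z hz => (hcont v (hU1 v z hz)).mul hf.continuous.continuousAt
  have key : ∀ v, ∫ z, U z * fderiv ℝ (fun w => fderiv ℝ f w v) z v =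
      ∫ z, fderiv ℝ (fun w => fderiv ℝ U w v) z v * f z := by
    intro v
    rw [integral_mul_fderiv_eq_neg_fderiv_mul_of_integrable (i1 v) (i0 v)
      (integrable_of_continuousAt_tsupport hc (fun z hz => by simp [z1 v z hz])
        fun z hz => (hU z hz).continuousAt.mul (hcont v hf.contDiffAt))
      (fun z hz => (hU z (hts v hz)).differentiableAt (by simp))
      (fun z _ => (hf1 v z).differentiableAt (by simp)),
      integral_mul_fderiv_eq_neg_fderiv_mul_of_integrable (i2 v) (i1 v)
      (integrable_of_continuousAt_tsupport hc (fun z hz => by simp [z0 z hz])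
        fun z hz => (hcont v (hU z hz)).mul hf.continuous.continuousAt)
      (fun z hz => (hU1 v z hz).differentiableAt (by simp))
      (fun z _ => hfd z), neg_neg]
  have hlap : ∀ {h : ℂ → ℝ} {z : ℂ}, ContDiffAt ℝ (⊤ : ℕ∞) h z → Laplacian.laplacian h z =
      fderiv ℝ (fun w => fderiv ℝ h w 1) z 1 +
        fderiv ℝ (fun w => fderiv ℝ h w Complex.I) z Complex.I := by
    intro h z hh
    have hd : DifferentiableAt ℝ (fderiv ℝ h) z :=
      (hh.fderiv_right (m := (⊤ : ℕ∞)) le_rfl).differentiableAt (by simp)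
    rw [InnerProductSpace.laplacian_eq_iteratedFDeriv_complexPlane]
    simp only [iteratedFDeriv_two_apply]
    rw [fderiv_clm_apply hd (differentiableAt_const _), fderiv_clm_apply hd (differentiableAt_const _)]
    simp
  have e1 : (fun z => U z * Laplacian.laplacian f z) = fun z =>
      U z * fderiv ℝ (fun w => fderiv ℝ f w 1) z 1 +
        U z * fderiv ℝ (fun w => fderiv ℝ f w Complex.I) z Complex.I := by
    ext z
    rw [hlap hf.contDiffAt, mul_add]
  have e2 : (fun z => Laplacian.laplacian U z * f z) = fun z =>
      fderiv ℝ (fun w => fderiv ℝ U w 1) z 1 * f z +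
        fderiv ℝ (fun w => fderiv ℝ U w Complex.I) z Complex.I * f z := by
    ext z
    by_cases hz : z ∈ tsupport f
    · rw [hlap (hU z hz), add_mul]
    · simp [z0 z hz]
  rw [e1, e2, integral_add (i0 1) (i0 Complex.I), integral_add (i2 1) (i2 Complex.I), key, key]

/-- A bounded function of finite Dirichlet energy that satisfies `Δ_g u = 2 u` away from the cone
points is an eigenfunction of the Friedrichs Laplacian. -/
lemma isTwoEigenfunction_of_energy [IsFiniteMeasure (area g)] {C : ℝ} (hinf : ∞ ∈ P)
    (hm : Measurable fun z : ℂ => u (z : OnePoint ℂ)) (hC : ∀ z : ℂ, ‖u (z : OnePoint ℂ)‖ ≤ C)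
    (hu : ∀ z : ℂ, (z : OnePoint ℂ) ∉ P →
      ContDiffAt ℝ (⊤ : ℕ∞) (fun z : ℂ => u (z : OnePoint ℂ)) z)
    (hE : MemLp (fderiv ℝ fun z : ℂ => u (z : OnePoint ℂ)) 2 volume)
    (hg : ∀ z : ℂ, (z : OnePoint ℂ) ∉ P → g (z : OnePoint ℂ) ≠ 0)
    (hlap : ∀ z : ℂ, (z : OnePoint ℂ) ∉ P →
      Laplacian.laplacian (fun z : ℂ => u (z : OnePoint ℂ)) z =
        -2 * g (z : OnePoint ℂ) * u (z : OnePoint ℂ)) :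
    IsTwoEigenfunction g P u := by
  have hdom := inFormDomain_of_energy (g := g) hm hC hu hE
  refine ⟨⟨hdom, hdom.1.const_mul 2, fun φ hφ => ?_⟩, fun p hp => ?_⟩
  · have := integral_mul_laplacian_eq hφ.contDiff (hφ.hasCompactSupport hinf)
      (fun z hz => hu z (hφ.notMem_of_mem_tsupport hz))
    simp only [mul_neg]
    rw [integral_neg, this, ← integral_neg]
    refine integral_congr_ae (Eventually.of_forall fun z => ?_)
    simp only
    by_cases hz : z ∈ tsupport fun z : ℂ => φ (z : OnePoint ℂ)
    · rw [hlap z (hφ.notMem_of_mem_tsupport hz)]; ring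
    · have : φ (z : OnePoint ℂ) = 0 :=
        image_eq_zero_of_notMem_tsupport (f := fun z : ℂ => φ (z : OnePoint ℂ)) hz
      simp [this]
  · induction p using OnePoint.rec with
    | infty => exact absurd hinf hp
    | coe a =>
      refine ⟨contDiffAt_comp_const_add (f := fun z : ℂ => u (z : OnePoint ℂ)) (hu a hp), ?_⟩
      simp only [param_coe]
      rw [laplacian_comp_const_add (fun z : ℂ => u (z : OnePoint ℂ)), hlap a hp, density_coe, add_zero]
      have := hg a hp
      field_simp

end Friedrichs

/-! ### Finite area and finite energy -/

open Asymptotics in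
/-- Integrability on the plane from power bounds at `0` and at `∞`. -/
lemma integrable_of_isBigO {F : ℂ → ℝ} {s : ℝ} (hm : Measurable F)
    (hc : ∀ z ≠ 0, ContinuousAt F z) (hs : -2 < s) (h0 : F =O[𝓝[≠] 0] fun z => ‖z‖ ^ s)
    (h1 : (fun z => F z⁻¹) =O[𝓝[≠] 0] fun z => ‖z‖ ^ (s + 4)) : Integrable F := by
  obtain ⟨C₀, hC₀⟩ := h0.bound
  obtain ⟨C₁, hC₁⟩ := h1.bound
  rw [eventually_nhdsWithin_iff, Metric.eventually_nhds_iff_ball] at hC₀ hC₁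
  obtain ⟨r, hr, hC₀⟩ := hC₀
  obtain ⟨ρ, hρ, hC₁⟩ := hC₁
  have hfin : Module.finrank ℝ ℂ - 1 = 1 := by simp
  have near : IntegrableOn F (Metric.ball 0 r) := by
    have hi : IntegrableOn (fun z : ℂ => ‖z‖ ^ s) (Metric.ball 0 r) := by
      refine (integrableOn_fun_norm_addHaar volume (f := fun y => y ^ s)).2 ?_
      rw [hfin]
      refine IntegrableOn.congr_fun (((intervalIntegral.integrableOn_Ioo_rpow_iff
        (s := s + 1) hr).2 (by linarith))) (fun y hy => ?_) measurableSet_Ioo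
      simp only [pow_one, smul_eq_mul]
      rw [Real.rpow_add_one hy.1.ne', mul_comm]
    refine (hi.const_mul C₀).mono' hm.aestronglyMeasurable ?_
    rw [ae_restrict_iff' measurableSet_ball]
    have : ∀ᵐ z : ℂ, z ≠ 0 := by simp [ae_iff, measure_singleton]
    filter_upwards [this] with z hz hzr
    refine (hC₀ z hzr hz).trans_eq ?_
    rw [Real.norm_of_nonneg (by positivity)]
  have far : IntegrableOn F {z | ρ⁻¹ < ‖z‖} := by
    have hms : MeasurableSet {z : ℂ | ρ⁻¹ < ‖z‖} := measurableSet_lt measurable_const measurable_norm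
    have hi : IntegrableOn (fun z : ℂ => ‖z‖ ^ (-s - 4)) {z | ρ⁻¹ < ‖z‖} := by
      rw [← integrable_indicator_iff hms]
      have e : ({z : ℂ | ρ⁻¹ < ‖z‖}.indicator fun z : ℂ => ‖z‖ ^ (-s - 4)) =
          fun z : ℂ => (Set.Ioi ρ⁻¹).indicator (fun y => y ^ (-s - 4)) ‖z‖ := by
        ext z
        simp [Set.indicator]
      rw [e, integrable_fun_norm_addHaar volume, hfin]
      have h2 := (integrable_indicator_iff measurableSet_Ioi).2
        (integrableOn_Ioi_rpow_of_lt (a := -s - 3) (by linarith) (inv_pos.2 hρ))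
      refine IntegrableOn.congr_fun h2.integrableOn (fun y hy => ?_) measurableSet_Ioi
      have hy0 : 0 < y := hy
      by_cases hy' : y ∈ Set.Ioi ρ⁻¹
      · rw [Set.indicator_of_mem hy', Set.indicator_of_mem hy', pow_one, smul_eq_mul, mul_comm,
          ← Real.rpow_add_one hy0.ne']
        congr 1; ring
      · simp [Set.indicator_of_notMem hy']
    refine (hi.const_mul C₁).mono' hm.aestronglyMeasurable ?_
    rw [ae_restrict_iff' hms]
    refine Eventually.of_forall fun z hz => ?_
    have hz' : ρ⁻¹ < ‖z‖ := hz
    have hz0 : 0 < ‖z‖ := (inv_pos.2 hρ).trans hz'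
    have := hC₁ z⁻¹ (by simpa using inv_lt_of_inv_lt₀ hρ hz') (by simpa using hz0)
    have e : ‖‖z⁻¹‖ ^ (s + 4)‖ = ‖z‖ ^ (-s - 4) := by
      rw [Real.norm_of_nonneg (by positivity), norm_inv, Real.inv_rpow hz0.le,
        ← Real.rpow_neg hz0.le]
      congr 1; ring
    rwa [inv_inv, e] at this
  have mid : IntegrableOn F (Metric.closedBall 0 ρ⁻¹ \ Metric.ball 0 r) := by
    refine ContinuousOn.integrableOn_compact
      ((isCompact_closedBall _ _).diff Metric.isOpen_ball) fun z hz => ?_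
    refine (hc z ?_).continuousWithinAt
    rintro rfl
    exact hz.2 (Metric.mem_ball_self hr)
  rw [← integrableOn_univ]
  refine ((near.union mid).union far).mono_set fun z _ => ?_
  by_cases h2 : ρ⁻¹ < ‖z‖
  · exact Or.inr h2
  · by_cases h3 : z ∈ Metric.ball 0 r
    · exact Or.inl (Or.inl h3)
    · exact Or.inl (Or.inr ⟨by simpa using not_lt.1 h2, h3⟩)

section Params

variable {β : ℝ} {k : ℕ}

lemma measurable_planeMetric : Measurable (planeMetric β k) := by
  unfold planeMetric normSum crit den num
  fun_prop

open Asymptotics in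
lemma isBigO_planeMetric (hβ : 0 < β) (hk : 0 < k) :
    planeMetric β k =O[𝓝[≠] 0] fun z => ‖z‖ ^ (2 * β - 2) := by
  have h1 : ContinuousAt (fun z => 4 * ‖crit β k z‖ ^ 2 / normSum β k z ^ 2) 0 := by
    have h1 := (analyticAt_crit β k 0).continuousAt
    have h2 := (continuous_normSum (k := k) hβ).continuousAt (x := 0)
    exact ContinuousAt.div (by fun_prop) (by fun_prop) (pow_ne_zero 2 (normSum_pos hk 0).ne')
  have h2 := ((h1.isBigO_one ℝ).mono nhdsWithin_le_nhds).mul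
    (isBigO_refl (fun z : ℂ => ‖z‖ ^ (2 * β - 2)) (𝓝[≠] 0))
  simp only [one_mul] at h2
  refine h2.congr_left fun z => ?_
  rw [planeMetric]; ring

open Asymptotics in
lemma isBigO_planeMetric_neg (hβ : 0 < β) (hk : β < k) :
    planeMetric (-β) k =O[𝓝[≠] 0] fun z => ‖z‖ ^ (2 * β - 2) := by
  have hn := norm_pos_iff.2 (num_neg_zero_ne_zero hβ hk)
  have h0 : ContinuousAt (fun z => 4 * ‖crit (-β) k z‖ ^ 2 /
      (‖num (-β) k z‖ ^ 2 + ‖z‖ ^ (2 * β) * ‖den k z‖ ^ 2) ^ 2) 0 := by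
    have h1 := (analyticAt_crit (-β) k 0).continuousAt
    have h2 := (analyticAt_num (-β) k 0).continuousAt
    have h3 := (analyticAt_den k 0).continuousAt
    have h4 : Continuous fun z : ℂ => ‖z‖ ^ (2 * β) :=
      continuous_norm.rpow_const fun _ => Or.inr (by positivity)
    have h5 := h4.continuousAt (x := 0)
    exact ContinuousAt.div (by fun_prop) (by fun_prop) (by positivity)
  have h2 := ((h0.isBigO_one ℝ).mono nhdsWithin_le_nhds).mul
    (isBigO_refl (fun z : ℂ => ‖z‖ ^ (2 * β - 2)) (𝓝[≠] 0))
  simp only [one_mul] at h2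
  refine h2.congr' ?_ EventuallyEq.rfl
  filter_upwards [self_mem_nhdsWithin] with z hz
  rw [planeMetric_neg_eq hz]

open Asymptotics in
/-- The total area is finite. -/
lemma integrable_planeMetric (hβ : 0 < β) (hk : β < k) : Integrable (planeMetric β k) := by
  have hk0 : 0 < k := by exact_mod_cast hβ.trans hk
  refine integrable_of_isBigO (s := 2 * β - 2) measurable_planeMetric
    (fun z hz => (contDiffAt_planeMetric (n := 0) hk0 hz).continuousAt) (by linarith)
    (isBigO_planeMetric hβ hk0) ?_
  have h := (isBigO_planeMetric_neg hβ hk).mul (isBigO_refl (fun z : ℂ => ‖z‖ ^ 4) (𝓝[≠] 0))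
  refine h.congr' ?_ ?_
  · filter_upwards [self_mem_nhdsWithin] with z hz
    have : ‖z‖ ≠ 0 := norm_ne_zero_iff.2 hz
    rw [← planeMetric_inv hz]
    field_simp
  · filter_upwards [self_mem_nhdsWithin] with z hz
    have : 0 < ‖z‖ := norm_pos_iff.2 hz
    rw [Real.rpow_add this]
    norm_num

lemma isFiniteMeasure_area (hβ : 0 < β) (hk : β < k) : IsFiniteMeasure (area (coneMetric β k)) :=
  isFiniteMeasure_withDensity_ofReal (integrable_planeMetric hβ hk).2

open Asymptotics in
lemma isBigO_fderiv_planeQuot (hβ : 0 < β) (hk : 0 < k) :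
    fderiv ℝ (planeQuot β k) =O[𝓝[≠] 0] fun z => ‖z‖ ^ (min 0 (2 * β - 1)) := by
  rw [planeQuot_eq_radialQuot]
  exact isBigO_fderiv_radialQuot hβ (contDiffAt_mul_conj (contDiffAt_den' 0) (contDiffAt_den 0))
    (contDiffAt_mul_conj (contDiffAt_num' 0) (contDiffAt_num 0)).neg
    (contDiffAt_mul_conj (contDiffAt_den 0) (contDiffAt_den 0))
    (contDiffAt_mul_conj (contDiffAt_num 0) (contDiffAt_num 0)) (by simp [den_zero hk])

open Asymptotics in
lemma isBigO_fderiv_planeQuot_neg (hβ : 0 < β) (hk : β < k) :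
    fderiv ℝ (planeQuot (-β) k) =O[𝓝[≠] 0] fun z => ‖z‖ ^ (min 0 (2 * β - 1)) := by
  have hn := num_neg_zero_ne_zero hβ hk
  have h := isBigO_fderiv_radialQuot hβ
    (contDiffAt_mul_conj (contDiffAt_num' (β := -β) (k := k) 0)
      (contDiffAt_num (β := -β) (k := k) 0)).neg
    (contDiffAt_mul_conj (contDiffAt_den' (k := k) 0) (contDiffAt_den (k := k) 0))
    (contDiffAt_mul_conj (contDiffAt_num (β := -β) (k := k) 0)
      (contDiffAt_num (β := -β) (k := k) 0))
    (contDiffAt_mul_conj (contDiffAt_den (k := k) 0) (contDiffAt_den (k := k) 0)) (by simp [hn])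
  refine h.congr' ?_ EventuallyEq.rfl
  filter_upwards [self_mem_nhdsWithin] with z hz
  refine EventuallyEq.fderiv_eq ?_
  filter_upwards [eventually_ne_nhds (Set.mem_compl_singleton_iff.1 hz)] with w hw
  exact (planeQuot_neg_eq_radialQuot hw).symm

/-- The gradient of `h₁ / h₂` in the coordinate `1 / z`. -/
lemma norm_fderiv_planeQuot_inv_le (hk : 0 < k) {z : ℂ} (hz : z ≠ 0) :
    ‖fderiv ℝ (planeQuot β k) z⁻¹‖ ≤ ‖fderiv ℝ (planeQuot (-β) k) z‖ * ‖z‖ ^ 2 := by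
  have h1 : planeQuot β k =ᶠ[𝓝 z⁻¹] fun w => -planeQuot (-β) k w⁻¹ := by
    filter_upwards [eventually_ne_nhds (inv_ne_zero hz)] with w hw
    have := planeQuot_inv (β := β) (k := k) (inv_ne_zero hw)
    rwa [inv_inv] at this
  have h2 : HasFDerivAt (planeQuot (-β) k) (fderiv ℝ (planeQuot (-β) k) z) (z⁻¹)⁻¹ := by
    rw [inv_inv]
    exact ((contDiffAt_planeQuot (n := 1) hk hz).differentiableAt one_ne_zero).hasFDerivAt
  have h3 := (hasDerivAt_inv (inv_ne_zero hz)).hasFDerivAt.restrictScalars ℝ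
  have h4 := (h2.comp z⁻¹ h3).neg
  have h5 : HasFDerivAt (planeQuot β k) _ z⁻¹ := HasFDerivAt.congr_of_eventuallyEq h4 h1
  rw [h5.fderiv, norm_neg]
  refine (ContinuousLinearMap.opNorm_comp_le _ _).trans ?_
  gcongr
  refine ContinuousLinearMap.opNorm_le_bound _ (by positivity) fun v => ?_
  simp [mul_comm]

open Asymptotics in
/-- The Dirichlet energy of `h₁ / h₂` is finite. -/
lemma memLp_fderiv_planeQuot (hβ : 0 < β) (hk : β < k) :
    MemLp (fderiv ℝ (planeQuot β k)) 2 volume := by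
  have hk0 : 0 < k := by exact_mod_cast hβ.trans hk
  have hms := measurable_fderiv ℝ (planeQuot β k)
  rw [memLp_two_iff_integrable_sq_norm hms.aestronglyMeasurable]
  set s := min 0 (2 * β - 1) with hs
  have hs1 : -1 < s := lt_min (by norm_num) (by linarith)
  refine integrable_of_isBigO (s := 2 * s) (hms.norm.pow_const 2) (fun z hz => ?_) (by linarith)
    ?_ ?_
  · exact (((contDiffAt_planeQuot (n := 1) hk0 hz).fderiv_right (m := 0)
      le_rfl).continuousAt.norm).pow 2
  · refine ((isBigO_fderiv_planeQuot hβ hk0).norm_left.pow 2).congr' EventuallyEq.rfl ?_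
    filter_upwards [self_mem_nhdsWithin] with z hz
    rw [← Real.rpow_natCast, ← Real.rpow_mul (norm_nonneg z), mul_comm]
    norm_num [hs]
  · have h1 : (fun z => ‖fderiv ℝ (planeQuot β k) z⁻¹‖) =O[𝓝[≠] 0] fun z => ‖z‖ ^ s * ‖z‖ ^ 2 := by
      refine IsBigO.trans (IsBigO.of_bound 1 ?_) ((isBigO_fderiv_planeQuot_neg hβ hk).norm_left.mul
        (isBigO_refl (fun z : ℂ => ‖z‖ ^ 2) (𝓝[≠] 0)))
      filter_upwards [self_mem_nhdsWithin] with z hz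
      have := norm_fderiv_planeQuot_inv_le (β := β) hk0 hz
      rw [one_mul, norm_norm, Real.norm_of_nonneg (by positivity)]
      exact this
    refine (h1.pow 2).congr' EventuallyEq.rfl ?_
    filter_upwards [self_mem_nhdsWithin] with z hz
    have h0 : 0 < ‖z‖ := norm_pos_iff.2 hz
    rw [mul_pow, ← pow_mul, Real.rpow_add h0, ← Real.rpow_natCast (‖z‖ ^ s), ← Real.rpow_mul h0.le,
      mul_comm s]
    norm_num

/-! ### The eigenfunctions -/

lemma hasFDerivAt_re_mul_planeQuot (l : ℂ) (hk : 0 < k) {z : ℂ} (hz : z ≠ 0) :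
    HasFDerivAt (fun z => (l * planeQuot β k z).re)
      ((Complex.reCLM.comp (l • ContinuousLinearMap.id ℝ ℂ)).comp
        (fderiv ℝ (planeQuot β k) z)) z := by
  have h1 := ((contDiffAt_planeQuot (β := β) (n := 1) hk hz).differentiableAt
    one_ne_zero).hasFDerivAt
  exact (Complex.reCLM.comp (l • ContinuousLinearMap.id ℝ ℂ)).hasFDerivAt.comp z h1

lemma isTwoEigenfunction_re_mul_hQuot (l : ℂ) (hβ : 0 < β) (hk : β < k) :
    IsTwoEigenfunction (coneMetric β k) (conePoints β k) fun p => (l * hQuot β k p).re := by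
  have hk0 : 0 < k := by exact_mod_cast hβ.trans hk
  have := isFiniteMeasure_area hβ hk
  obtain ⟨C, hC⟩ := exists_norm_hQuot_le hβ hk
  have hne : ∀ z : ℂ, (z : OnePoint ℂ) ∉ conePoints β k → z ≠ 0 ∧ crit β k z ≠ 0 := fun z hz => by
    rwa [coe_mem_conePoints hβ hk0, not_or] at hz
  set L : ℂ →L[ℝ] ℝ := Complex.reCLM.comp (l • ContinuousLinearMap.id ℝ ℂ) with hL
  have hU : (fun z : ℂ => (l * hQuot β k (z : OnePoint ℂ)).re) = L ∘ planeQuot β k := rfl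
  refine isTwoEigenfunction_of_energy (C := ‖l‖ * C) (infty_mem_conePoints β k) ?_ (fun z => ?_)
    (fun z hz => ?_) ?_ (fun z hz => ?_) (fun z hz => ?_)
  · rw [hU]
    exact (L.continuous.comp (continuous_planeQuot hβ hk0)).measurable
  · calc ‖(l * hQuot β k (z : OnePoint ℂ)).re‖ ≤ ‖l * hQuot β k (z : OnePoint ℂ)‖ :=
        Complex.abs_re_le_norm _
      _ ≤ ‖l‖ * C := by
        rw [norm_mul]
        gcongr
        exact hC _
  · rw [hU]
    exact L.contDiff.contDiffAt.comp z (contDiffAt_planeQuot hk0 (hne z hz).1)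
  · refine MemLp.of_le_mul (c := ‖L‖) (memLp_fderiv_planeQuot hβ hk)
      (measurable_fderiv ℝ _).aestronglyMeasurable ?_
    have : ∀ᵐ z : ℂ, z ≠ 0 := by simp [ae_iff, measure_singleton]
    filter_upwards [this] with z hz
    have h1 : HasFDerivAt (fun z : ℂ => (l * hQuot β k (z : OnePoint ℂ)).re) _ z :=
      hasFDerivAt_re_mul_planeQuot l hk0 hz
    rw [h1.fderiv]
    exact ContinuousLinearMap.opNorm_comp_le _ _
  · exact (planeMetric_pos hk0 (hne z hz).1 (hne z hz).2).ne'
  · rw [hU, (contDiffAt_planeQuot hk0 (hne z hz).1).laplacian_CLM_comp_left]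
    simp only [Function.comp_apply]
    rw [laplacian_planeQuot hk0 (hne z hz).1]
    have : (-2 * (planeMetric β k z : ℂ) * planeQuot β k z) =
        (-2 * planeMetric β k z : ℝ) • planeQuot β k z := by
      rw [Complex.real_smul]; push_cast; ring
    rw [this, _root_.map_smul]
    rfl

end Params

/-! ### Functions obtained by stereographic projection have gradient bounded by the metric -/

/-- A linear function on the unit sphere, in the stereographic coordinate `b`. -/
def sphereFun (σ : Fin 3 → ℝ) (b : ℂ) : ℝ := stereo (b : OnePoint ℂ) ⬝ᵥ σ

lemma stereo_coe (b : ℂ) : stereo (b : OnePoint ℂ) =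
    ![2 * b.re / (‖b‖ ^ 2 + 1), 2 * b.im / (‖b‖ ^ 2 + 1), (‖b‖ ^ 2 - 1) / (‖b‖ ^ 2 + 1)] := rfl

lemma stereo_infty : stereo ∞ = ![0, 0, 1] := rfl

/-- The map `w ↦ 1 / w` of the sphere is a half-turn of `ℝ³`. -/
lemma stereo_inv {c : ℂ} (hc : c ≠ 0) (σ : Fin 3 → ℝ) :
    stereo (c : OnePoint ℂ) ⬝ᵥ σ = sphereFun ![σ 0, -σ 1, -σ 2] c⁻¹ := by
  have h0 : ‖c‖ ≠ 0 := norm_ne_zero_iff.2 hc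
  simp only [sphereFun, stereo_coe, dotProduct, Fin.sum_univ_three, Complex.inv_re, Complex.inv_im,
    norm_inv, Complex.normSq_eq_norm_sq]
  simp
  field_simp
  ring

lemma hasWirtingerAt_sphereFun (σ : Fin 3 → ℝ) (b : ℂ) : ∃ p q : ℂ,
    HasWirtingerAt (fun b => (sphereFun σ b : ℂ)) p q b ∧
      ‖p‖ ≤ (‖(⟨σ 0, σ 1⟩ : ℂ)‖ + |σ 2|) / (1 + ‖b‖ ^ 2) ∧
      ‖q‖ ≤ (‖(⟨σ 0, σ 1⟩ : ℂ)‖ + |σ 2|) / (1 + ‖b‖ ^ 2) := by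
  set m : ℂ := ⟨σ 0, σ 1⟩ with hm
  have hid := HasWirtingerAt.of_hasDerivAt (hasDerivAt_id b)
  have hc := fun c : ℂ => HasWirtingerAt.const c b
  have hN := (((hc (conj m)).mul hid).add ((hc m).mul hid.star)).add
    ((hc (σ 2)).mul ((hid.mul hid.star).add (hc (-1))))
  have hQ := (hid.mul hid.star).add (hc 1)
  have hQe : id b * conj (id b) + 1 = ((1 + ‖b‖ ^ 2 : ℝ) : ℂ) := by
    simp [Complex.mul_conj, Complex.normSq_eq_norm_sq, add_comm]
  have hpos : (0 : ℝ) < 1 + ‖b‖ ^ 2 := by positivity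
  have hQ0 : id b * conj (id b) + 1 ≠ 0 := by
    rw [hQe]; exact_mod_cast hpos.ne'
  have h := hN.div hQ hQ0
  rw [hQe] at h
  have bound : ∀ c : ℂ, ‖c‖ = ‖b‖ → ∀ w : ℂ, ‖w‖ = ‖m‖ → ∀ w' : ℂ, ‖w'‖ = ‖m‖ →
      ‖(w - w' * c ^ 2 + 2 * σ 2 * c) / ((1 + ‖b‖ ^ 2 : ℝ) : ℂ) ^ 2‖ ≤
        (‖m‖ + |σ 2|) / (1 + ‖b‖ ^ 2) := by
    intro c hcb w hw w' hw'
    rw [norm_div, norm_pow, Complex.norm_real, Real.norm_of_nonneg hpos.le,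
      div_le_div_iff₀ (by positivity) hpos, pow_two (1 + ‖b‖ ^ 2), ← mul_assoc]
    gcongr
    calc ‖w - w' * c ^ 2 + 2 * σ 2 * c‖ ≤ ‖w‖ + ‖w' * c ^ 2‖ + ‖2 * (σ 2 : ℂ) * c‖ :=
          (norm_add_le _ _).trans (add_le_add_left (norm_sub_le _ _) _)
      _ = ‖m‖ * (1 + ‖b‖ ^ 2) + |σ 2| * (2 * ‖b‖) := by
          simp [hw, hw', hcb]; ring
      _ ≤ ‖m‖ * (1 + ‖b‖ ^ 2) + |σ 2| * (1 + ‖b‖ ^ 2) := by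
          gcongr
          nlinarith [sq_nonneg (‖b‖ - 1)]
      _ = _ := by ring
  refine ⟨_, _, (h.congr_of_eventuallyEq (Eventually.of_forall fun w => ?_)).congr_deriv ?_ ?_,
    bound (conj b) (by simp) (conj m) (by simp) m rfl, bound b rfl m rfl (conj m) (by simp)⟩
  · have e : w * conj w + 1 = ((‖w‖ ^ 2 + 1 : ℝ) : ℂ) := by
      simp [Complex.mul_conj, Complex.normSq_eq_norm_sq]
    have e3 : conj m * w + m * conj w = ((2 * w.re * σ 0 + 2 * w.im * σ 1 : ℝ) : ℂ) := by
      apply Complex.ext <;> simp [hm] <;> ring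
    have e2 : w * conj w = ((‖w‖ ^ 2 : ℝ) : ℂ) := by
      simp [Complex.mul_conj, Complex.normSq_eq_norm_sq]
    simp only [id]
    rw [e, e3, e2, ← Complex.ofReal_one, ← Complex.ofReal_neg, ← Complex.ofReal_add,
      ← Complex.ofReal_mul, ← Complex.ofReal_add, ← Complex.ofReal_div]
    congr 1
    simp [sphereFun, stereo_coe, dotProduct, Fin.sum_univ_three]
    field_simp
    ring
  · rw [← hQe]; simp only [id, map_zero]; congr 1; ring
  · rw [← hQe]; simp only [id, map_one]; congr 1; ring

lemma norm_fderiv_sphereFun_le (σ : Fin 3 → ℝ) : ∃ K : ℝ, ∀ b : ℂ,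
    DifferentiableAt ℝ (sphereFun σ) b ∧ ‖fderiv ℝ (sphereFun σ) b‖ ≤ K / (1 + ‖b‖ ^ 2) := by
  refine ⟨2 * (‖(⟨σ 0, σ 1⟩ : ℂ)‖ + |σ 2|), fun b => ?_⟩
  obtain ⟨p, q, h, hp, hq⟩ := hasWirtingerAt_sphereFun σ b
  have h1 : HasFDerivAt (sphereFun σ) (Complex.reCLM.comp (wirtinger p q)) b := by
    simpa using h.hasFDerivAt_re
  refine ⟨h1.differentiableAt, ?_⟩
  rw [h1.fderiv]
  refine ContinuousLinearMap.opNorm_le_bound _ (by positivity) fun v => ?_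
  calc ‖(Complex.reCLM.comp (wirtinger p q)) v‖ ≤ ‖p * v + q * conj v‖ := by
        simpa using Complex.abs_re_le_norm (p * v + q * conj v)
    _ ≤ ‖p‖ * ‖v‖ + ‖q‖ * ‖v‖ := by simpa using norm_add_le (p * v) (q * conj v)
    _ ≤ (‖(⟨σ 0, σ 1⟩ : ℂ)‖ + |σ 2|) / (1 + ‖b‖ ^ 2) * ‖v‖ +
          (‖(⟨σ 0, σ 1⟩ : ℂ)‖ + |σ 2|) / (1 + ‖b‖ ^ 2) * ‖v‖ := by gcongr
    _ = _ := by ring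

section DevelopingMap

variable {g : OnePoint ℂ → ℝ} {P : Finset (OnePoint ℂ)} {b : OnePoint ℂ → ℝ}
  {E : Type} [TopologicalSpace E] {π F : E → OnePoint ℂ}

lemma IsDevelopingMap.exists_isLocalLift (h : IsDevelopingMap g P b π F) {a : ℂ}
    (ha : (a : OnePoint ℂ) ∉ P) : ∃ s : ℂ → E, IsLocalLift π (a : OnePoint ℂ) s 0 := by
  have hr : (a : OnePoint ℂ) ∈ Set.range π := by rw [h.range_eq]; exact ha
  obtain ⟨e, he⟩ := hr
  obtain ⟨φ, hφ, rfl⟩ := h.covering.isLocalHomeomorphOn e (by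
    change π e ∉ P
    rwa [he])
  have ht : param (a : OnePoint ℂ) 0 ∈ φ.target := by
    rw [param_coe, add_zero, ← he]; exact φ.map_source hφ
  have hcont : Continuous (param (a : OnePoint ℂ)) :=
    OnePoint.continuous_coe.comp (continuous_const.add continuous_id)
  refine ⟨fun ζ => φ.symm (param (a : OnePoint ℂ) ζ),
    ContinuousAt.comp (g := φ.symm) (φ.continuousAt_symm ht) hcont.continuousAt, ?_⟩
  filter_upwards [hcont.continuousAt.eventually (φ.open_target.mem_nhds ht)] with ζ hζ
  exact φ.right_inv hζ

/-- A function obtained from a developing map is locally a function `sphereFun σ ∘ B`, with `B` a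
branch of the developing map or its inverse. -/
lemma eventually_stereo_eq_sphereFun {B : ℂ → OnePoint ℂ} (hB : ContinuousAt B 0)
    (σ : Fin 3 → ℝ) : ∃ τ ∈ ({σ, ![σ 0, -σ 1, -σ 2]} : Set (Fin 3 → ℝ)),
      ∀ᶠ ζ in 𝓝 0, stereo (B ζ) ⬝ᵥ σ = sphereFun τ (coord (B 0) (B ζ)) := by
  rcases hB0 : B 0 with _ | c
  · change B 0 = ∞ at hB0
    refine ⟨_, Or.inr rfl, ?_⟩
    have h1 : ∀ᶠ ζ in 𝓝 0, B ζ ≠ ((0 : ℂ) : OnePoint ℂ) := hB.eventually_ne (by simp [hB0])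
    filter_upwards [h1] with ζ hζ
    rcases hBζ : B ζ with _ | d
    · change stereo ∞ ⬝ᵥ σ = sphereFun _ 0
      simp [stereo_infty, sphereFun, stereo_coe, dotProduct, Fin.sum_univ_three]
    · change stereo (d : OnePoint ℂ) ⬝ᵥ σ = sphereFun _ d⁻¹
      refine stereo_inv ?_ σ
      rintro rfl
      exact hζ hBζ
  · change B 0 = (c : OnePoint ℂ) at hB0
    refine ⟨_, Or.inl rfl, ?_⟩
    have h1 : ∀ᶠ ζ in 𝓝 0, B ζ ≠ ∞ := hB.eventually_ne (by simp [hB0])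
    filter_upwards [h1] with ζ hζ
    rcases hBζ : B ζ with _ | d
    · exact absurd hBζ hζ
    · rfl

/-- The gradient of a linear function on the sphere is bounded, and a developing map is a local
isometry: so the gradient of the pull-back is bounded in the metric `g`. -/
lemma IsDevelopingMap.exists_norm_fderiv_sq_le (h : IsDevelopingMap g P b π F)
    {u : OnePoint ℂ → ℝ} {σ : Fin 3 → ℝ} (hu : ∀ e, u (π e) = stereo (F e) ⬝ᵥ σ) :
    ∃ K : ℝ, ∀ a : ℂ, (a : OnePoint ℂ) ∉ P →
      ‖fderiv ℝ (fun z : ℂ => u (z : OnePoint ℂ)) a‖ ^ 2 ≤ K * g (a : OnePoint ℂ) := by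
  obtain ⟨K₁, hK₁⟩ := norm_fderiv_sphereFun_le σ
  obtain ⟨K₂, hK₂⟩ := norm_fderiv_sphereFun_le ![σ 0, -σ 1, -σ 2]
  refine ⟨max (K₁ ^ 2) (K₂ ^ 2), fun a ha => ?_⟩
  obtain ⟨s, hs⟩ := h.exists_isLocalLift ha
  obtain ⟨hc, han⟩ := h.holomorphic _ ha s hs
  obtain ⟨τ, hτ, hloc⟩ := eventually_stereo_eq_sphereFun hc σ
  obtain ⟨K, hK, hKm⟩ : ∃ K : ℝ, (∀ b : ℂ, DifferentiableAt ℝ (sphereFun τ) b ∧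
      ‖fderiv ℝ (sphereFun τ) b‖ ≤ K / (1 + ‖b‖ ^ 2)) ∧ K ^ 2 ≤ max (K₁ ^ 2) (K₂ ^ 2) := by
    rcases hτ with rfl | rfl
    · exact ⟨K₁, hK₁, le_max_left _ _⟩
    · exact ⟨K₂, hK₂, le_max_right _ _⟩
  have hg := h.pullback _ ha s hs
  rw [pullbackRound, density_coe, add_zero] at hg
  set B := F ∘ s
  set w : ℂ → ℂ := fun ζ => coord (B 0) (B ζ) with hw
  have hu' : (fun ζ : ℂ => u ((a + ζ : ℂ) : OnePoint ℂ)) =ᶠ[𝓝 0] sphereFun τ ∘ w := by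
    filter_upwards [hloc, hs.2] with ζ h1 h2
    rw [Function.comp_apply, ← h1, ← param_coe, ← h2]
    exact hu _
  have hd := ((hK (w 0)).1.hasFDerivAt.comp (0 : ℂ)
    (han.differentiableAt.hasDerivAt.hasFDerivAt.restrictScalars ℝ)).congr_of_eventuallyEq hu'
  have e := hd.fderiv
  rw [fderiv_comp_add_left (f := fun z : ℂ => u (z : OnePoint ℂ)), add_zero] at e
  have hK0 : 0 ≤ K / (1 + ‖w 0‖ ^ 2) := (norm_nonneg _).trans (hK (w 0)).2
  have hn : ‖fderiv ℝ (fun z : ℂ => u (z : OnePoint ℂ)) a‖ ≤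
      K / (1 + ‖w 0‖ ^ 2) * ‖deriv w 0‖ := by
    rw [e]
    refine (ContinuousLinearMap.opNorm_comp_le _ _).trans ?_
    refine mul_le_mul (hK (w 0)).2 ?_ (norm_nonneg _) hK0
    refine ContinuousLinearMap.opNorm_le_bound _ (norm_nonneg _) fun v => ?_
    simp [hw, mul_comm]
  calc ‖fderiv ℝ (fun z : ℂ => u (z : OnePoint ℂ)) a‖ ^ 2
      ≤ (K / (1 + ‖w 0‖ ^ 2) * ‖deriv w 0‖) ^ 2 := by gcongr
    _ = K ^ 2 * (‖deriv w 0‖ ^ 2 / (1 + ‖w 0‖ ^ 2) ^ 2) := by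
        rw [mul_pow, div_pow]; ring
    _ ≤ max (K₁ ^ 2) (K₂ ^ 2) * (4 * ‖deriv w 0‖ ^ 2 / (1 + ‖w 0‖ ^ 2) ^ 2) := by
        rw [mul_div_assoc 4]
        have : 0 ≤ ‖deriv w 0‖ ^ 2 / (1 + ‖w 0‖ ^ 2) ^ 2 := by positivity
        have h0 : 0 ≤ K ^ 2 := sq_nonneg K
        nlinarith [mul_le_mul_of_nonneg_right hKm this, mul_nonneg (h0.trans hKm) this]
    _ = _ := by rw [hg]

end DevelopingMap

/-! ### The eigenfunctions are not obtained from a developing map -/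

lemma exists_crit_eq_zero {β : ℝ} {k : ℕ} (hβ : 0 < β) (hk : β < k) :
    ∃ a : ℂ, a ≠ 0 ∧ crit β k a = 0 := by
  have hk0 : 0 < k := by exact_mod_cast hβ.trans hk
  have h1 : (β * (k - β) : ℂ) ≠ 0 := by
    have : (0 : ℝ) < β * (k - β) := mul_pos hβ (sub_pos.2 hk)
    exact_mod_cast this.ne'
  obtain ⟨w, hw⟩ := exists_quadratic_eq_zero (b := (2 * (k ^ 2 - β ^ 2) : ℂ))
    (c := -(β * (k + β) : ℂ)) h1 (IsAlgClosed.exists_eq_mul_self _)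
  obtain ⟨a, ha⟩ := IsAlgClosed.exists_pow_nat_eq w hk0
  have hc : crit β k a = 0 := by rw [crit, ha, ← hw]; ring
  refine ⟨a, ?_, hc⟩
  rintro rfl
  exact crit_zero_ne_zero hβ hk0 hc

/-- At a critical point of the developing map the metric vanishes in the coordinate `z`, but the
gradient of `h₁ / h₂` does not. -/
lemma not_isFromDevelopingMap_re_mul_hQuot {β : ℝ} {k : ℕ} {l : ℂ} (hl : l ≠ 0) (hβ : 0 < β)
    (hk : β < k) : ¬ IsFromDevelopingMap (coneMetric β k) (conePoints β k) (coneAngle β)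
      fun p => (l * hQuot β k p).re := by
  rintro ⟨E, _, π, F, hF, σ, hσ⟩
  have hk0 : 0 < k := by exact_mod_cast hβ.trans hk
  obtain ⟨K, hK⟩ := hF.exists_norm_fderiv_sq_le (u := fun p => (l * hQuot β k p).re) hσ
  obtain ⟨a, ha, hc⟩ := exists_crit_eq_zero hβ hk
  set L : ℂ →L[ℝ] ℝ := Complex.reCLM.comp (l • ContinuousLinearMap.id ℝ ℂ) with hL
  have hU : ∀ z ≠ 0, HasFDerivAt (fun z : ℂ => (l * hQuot β k (z : OnePoint ℂ)).re)
      (L.comp (fderiv ℝ (planeQuot β k) z)) z := fun z hz => hasFDerivAt_re_mul_planeQuot l hk0 hz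
  have h1 : ∀ᶠ z in 𝓝[≠] a, ‖L.comp (fderiv ℝ (planeQuot β k) z)‖ ^ 2 ≤ K * planeMetric β k z := by
    have hfin : ∀ᶠ z in 𝓝[≠] a, crit β k z ≠ 0 := by
      have := (hasDerivAt_crit β k a).eventually_ne (c := 0) (by
        rw [← (hasDerivAt_crit β k a).deriv]; exact deriv_crit_ne_zero hβ hk hc)
      exact this
    filter_upwards [hfin, (eventually_ne_nhds ha).filter_mono nhdsWithin_le_nhds] with z hz hz0
    rw [← (hU z hz0).fderiv]
    exact hK z (by rw [coe_mem_conePoints hβ hk0]; tauto)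
  have h2 : Tendsto (fun z => ‖L.comp (fderiv ℝ (planeQuot β k) z)‖ ^ 2) (𝓝[≠] a)
      (𝓝 (‖L.comp (fderiv ℝ (planeQuot β k) a)‖ ^ 2)) := by
    have h3 : ContinuousAt (fderiv ℝ (planeQuot β k)) a :=
      ((contDiffAt_planeQuot (n := 1) hk0 ha).fderiv_right (m := 0) le_rfl).continuousAt
    exact ((continuousAt_const.clm_comp h3).norm.pow 2).tendsto.mono_left nhdsWithin_le_nhds
  have h3 : Tendsto (fun z => K * planeMetric β k z) (𝓝[≠] a) (𝓝 0) := by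
    have h4 := (contDiffAt_planeMetric (β := β) (n := 0) hk0 ha).continuousAt.tendsto
    have h5 : planeMetric β k a = 0 := by simp [planeMetric, hc]
    rw [h5] at h4
    simpa using (h4.const_mul K).mono_left nhdsWithin_le_nhds
  have h4 : L.comp (fderiv ℝ (planeQuot β k) a) = 0 := by
    have := le_of_tendsto_of_tendsto h2 h3 h1
    have h5 : ‖L.comp (fderiv ℝ (planeQuot β k) a)‖ ^ 2 = 0 := le_antisymm this (sq_nonneg _)
    simpa using h5
  obtain ⟨p, hp, hW⟩ := hasWirtingerAt_planeQuot_of_crit (β := β) hk0 ha hc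
  rw [HasFDerivAt.fderiv hW] at h4
  -- the derivative of `Re (l h₁ / h₂)` is `v ↦ Re (l p v)`; take `v = conj (l p)`
  have h5 := congrArg (fun T : ℂ →L[ℝ] ℝ => T (conj (l * p))) h4
  have h6 : (l * p) * conj (l * p) = 0 := by
    rw [Complex.mul_conj] at *
    have : (l * (p * conj (l * p))).re = 0 := by simpa [hL] using h5
    rw [← mul_assoc, Complex.mul_conj, Complex.ofReal_re] at this
    rw [this, Complex.ofReal_zero]
  simp [hl, hp] at h6

/-! ### The covering `exp` of the sphere minus the cone points -/

section Covering

variable {P : Finset (OnePoint ℂ)}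

/-- The complement of the countable set of points lying over `P` is connected. -/
lemma connectedSpace_expCover (P : Finset (OnePoint ℂ)) : ConnectedSpace (ExpCover P) := by
  have hfib : ∀ p : OnePoint ℂ, {ζ : ℂ | ((Complex.exp ζ : ℂ) : OnePoint ℂ) = p}.Countable := by
    intro p
    rcases Set.eq_empty_or_nonempty {ζ : ℂ | ((Complex.exp ζ : ℂ) : OnePoint ℂ) = p} with h | ⟨ζ₀, h⟩
    · rw [h]; exact Set.countable_empty
    · refine (Set.countable_range fun n : ℤ => ζ₀ + n * (2 * Real.pi * Complex.I)).mono fun ζ hζ => ?_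
      have : Complex.exp ζ = Complex.exp ζ₀ := OnePoint.coe_injective (hζ.trans h.symm)
      obtain ⟨n, hn⟩ := Complex.exp_eq_exp_iff_exists_int.1 this
      exact ⟨n, hn.symm⟩
  have hc : {ζ : ℂ | ((Complex.exp ζ : ℂ) : OnePoint ℂ) ∈ P}.Countable := by
    have : {ζ : ℂ | ((Complex.exp ζ : ℂ) : OnePoint ℂ) ∈ P} =
        ⋃ p ∈ (P : Set (OnePoint ℂ)), {ζ : ℂ | ((Complex.exp ζ : ℂ) : OnePoint ℂ) = p} := by
      ext; simp
    rw [this]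
    exact P.countable_toSet.biUnion fun p _ => hfib p
  have := (hc.isPathConnected_compl_of_one_lt_rank
    (by rw [Complex.rank_real_complex]; norm_num)).isConnected
  exact isConnected_iff_connectedSpace.1 this

lemma range_expProj (h0 : ((0 : ℂ) : OnePoint ℂ) ∈ P) (hinf : ∞ ∈ P) :
    Set.range (expProj P) = {p | p ∉ P} := by
  ext p
  constructor
  · rintro ⟨e, rfl⟩
    exact e.2
  · intro hp
    rcases p with _ | z
    · exact absurd hinf hp
    · have hz : z ≠ 0 := by rintro rfl; exact hp h0
      have he : Complex.exp (Complex.log z) = z := Complex.exp_log hz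
      exact ⟨⟨Complex.log z, by rw [he]; exact hp⟩, congrArg _ he⟩

lemma isCoveringMapOn_expProj (h0 : ((0 : ℂ) : OnePoint ℂ) ∈ P) (hinf : ∞ ∈ P) :
    IsCoveringMapOn (expProj P) {p | p ∉ P} := by
  set U : Set (OnePoint ℂ) := {p | p ∉ P} with hU
  have hUo : IsOpen U := P.finite_toSet.isClosed.isOpen_compl
  set T : Set ℂ := OnePoint.some ⁻¹' U with hT
  have hTsub : T ⊆ {0}ᶜ := by
    rintro z hz rfl
    exact hz h0
  have h1 : IsCoveringMap (T.restrictPreimage Complex.exp) :=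
    (Complex.isCoveringMapOn_exp.mono hTsub).isCoveringMap_restrictPreimage T
  have hsurj : Function.Surjective (U.restrictPreimage (OnePoint.some : ℂ → OnePoint ℂ)) := by
    rintro ⟨p, hp⟩
    rcases p with _ | z
    · exact absurd hinf hp
    · exact ⟨⟨z, hp⟩, rfl⟩
  have h2 : IsOpenEmbedding (U.restrictPreimage (OnePoint.some : ℂ → OnePoint ℂ)) :=
    OnePoint.isOpenEmbedding_coe.restrictPreimage U
  exact IsCoveringMapOn.of_isCoveringMap_subtype hUo (f := expProj P) (fun e => e.2)
    (h1.homeomorph_comp (h2.isEmbedding.toHomeomorphOfSurjective hsurj))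

end Covering

/-! ### Quotients of holomorphic functions as maps to the Riemann sphere -/

/-- The meromorphic function `G / D` as a map to the Riemann sphere, for `D` and `G` without common
zeros: its value is `∞` at the zeros of `D`. -/
def ratio (D G : ℂ → ℂ) (z : ℂ) : OnePoint ℂ :=
  if D z = 0 then ∞ else ((G z / D z : ℂ) : OnePoint ℂ)

section Ratio

variable {D G : ℂ → ℂ} {a : ℂ}

lemma coord_coe_coe (b c : ℂ) : coord (b : OnePoint ℂ) (c : OnePoint ℂ) = c := rfl

lemma coord_infty_coe (c : ℂ) : coord ∞ (c : OnePoint ℂ) = c⁻¹ := rfl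

lemma coord_infty_infty : coord ∞ ∞ = 0 := rfl

lemma eventually_coord_ratio_of_ne_zero (hD : ContinuousAt D a) (h : D a ≠ 0) :
    (fun z => coord (ratio D G a) (ratio D G z)) =ᶠ[𝓝 a] fun z => G z / D z := by
  filter_upwards [hD.eventually_ne h] with z hz
  rw [ratio, ratio, if_neg h, if_neg hz, coord_coe_coe]

lemma coord_ratio_of_eq_zero (h : D a = 0) (z : ℂ) :
    coord (ratio D G a) (ratio D G z) = D z / G z := by
  rw [ratio, if_pos h, ratio]
  split_ifs with hz
  · rw [hz, coord_infty_infty, zero_div]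
  · rw [coord_infty_coe, inv_div]

lemma continuousAt_param_infty : ContinuousAt (param ∞) 0 := by
  have h0 : param ∞ 0 = ∞ := by simp [param]
  rw [continuousAt_iff_punctured_nhds, h0]
  have h1 : Tendsto (fun ζ : ℂ => ((ζ⁻¹ : ℂ) : OnePoint ℂ)) (𝓝[≠] 0) (𝓝 ∞) := by
    refine OnePoint.tendsto_coe_infty.comp ?_
    rw [Filter.coclosedCompact_eq_cocompact, ← Metric.cobounded_eq_cocompact]
    exact tendsto_inv₀_nhdsNE_zero
  refine h1.congr' ?_
  filter_upwards [self_mem_nhdsWithin] with ζ hζ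
  rw [param_infty hζ]

lemma isHolomorphicAt_ratio (hD : AnalyticAt ℂ D a) (hG : AnalyticAt ℂ G a)
    (h : D a ≠ 0 ∨ G a ≠ 0) : IsHolomorphicAt (ratio D G) a := by
  by_cases hDa : D a = 0
  · have hGa : G a ≠ 0 := h.resolve_left (not_not.2 hDa)
    have han : AnalyticAt ℂ (fun z => D z / G z) a := hD.div hG hGa
    constructor
    · have h1 : ratio D G =ᶠ[𝓝 a] fun z => param ∞ (D z / G z) := by
        filter_upwards [hG.continuousAt.eventually_ne hGa] with z hz
        by_cases hz0 : D z = 0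
        · simp [ratio, hz0, param]
        · rw [param_infty (div_ne_zero hz0 hz), ratio, if_neg hz0, inv_div]
      refine ContinuousAt.congr ?_ h1.symm
      refine ContinuousAt.comp (g := param ∞) ?_ han.continuousAt
      rw [hDa, zero_div]
      exact continuousAt_param_infty
    · simpa only [coord_ratio_of_eq_zero hDa] using han
  · have han : AnalyticAt ℂ (fun z => G z / D z) a := hG.div hD hDa
    constructor
    · have h1 : ratio D G =ᶠ[𝓝 a] fun z => ((G z / D z : ℂ) : OnePoint ℂ) := by
        filter_upwards [hD.continuousAt.eventually_ne hDa] with z hz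
        rw [ratio, if_neg hz]
      refine ContinuousAt.congr ?_ h1.symm
      exact OnePoint.continuous_coe.continuousAt.comp han.continuousAt
    · exact han.congr (eventually_coord_ratio_of_ne_zero hD.continuousAt hDa).symm

lemma deriv_div_eq_wronskian (hD : AnalyticAt ℂ D a) (hG : AnalyticAt ℂ G a) (h : D a ≠ 0) :
    deriv (fun z => G z / D z) a = wronskian D G a / D a ^ 2 := by
  rw [deriv_fun_div hG.differentiableAt hD.differentiableAt h, wronskian]
  ring

lemma pullbackRound_ratio (hD : AnalyticAt ℂ D a) (hG : AnalyticAt ℂ G a)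
    (h : D a ≠ 0 ∨ G a ≠ 0) : pullbackRound (ratio D G) a =
      4 * ‖wronskian D G a‖ ^ 2 / (‖D a‖ ^ 2 + ‖G a‖ ^ 2) ^ 2 := by
  by_cases hDa : D a = 0
  · have hGa : G a ≠ 0 := h.resolve_left (not_not.2 hDa)
    have hn := norm_pos_iff.2 hGa
    have hw : wronskian G D a = -wronskian D G a := by rw [wronskian, wronskian]; ring
    rw [pullbackRound]
    simp only [coord_ratio_of_eq_zero hDa]
    rw [deriv_div_eq_wronskian hG hD hGa, hw, hDa]
    simp only [norm_div, norm_neg, norm_pow, zero_div, norm_zero]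
    field_simp
    ring
  · have hn := norm_pos_iff.2 hDa
    have h1 := eventually_coord_ratio_of_ne_zero (G := G) hD.continuousAt hDa
    have h2 : coord (ratio D G a) (ratio D G a) = G a / D a := h1.self_of_nhds
    rw [pullbackRound, h1.deriv_eq, h2, deriv_div_eq_wronskian hD hG hDa]
    simp only [norm_div, norm_pow]
    field_simp

end Ratio

section Congr

variable {B B' : ℂ → OnePoint ℂ} {ζ a : ℂ}

lemma eventually_coord_congr (h : B =ᶠ[𝓝 ζ] B') :
    (fun η => coord (B ζ) (B η)) =ᶠ[𝓝 ζ] fun η => coord (B' ζ) (B' η) := by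
  filter_upwards [h] with η hη
  rw [hη, h.self_of_nhds]

lemma IsHolomorphicAt.congr (hB : IsHolomorphicAt B ζ) (h : B =ᶠ[𝓝 ζ] B') :
    IsHolomorphicAt B' ζ :=
  ⟨hB.1.congr h, hB.2.congr (eventually_coord_congr h)⟩

lemma pullbackRound_congr (h : B =ᶠ[𝓝 ζ] B') : pullbackRound B ζ = pullbackRound B' ζ := by
  rw [pullbackRound, pullbackRound, (eventually_coord_congr h).deriv_eq, h.self_of_nhds]

lemma schwarzian_congr (h : B =ᶠ[𝓝 ζ] B') : schwarzian B ζ = schwarzian B' ζ := by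
  have := eventually_coord_congr h
  simp only [schwarzian, this.deriv_eq, this.iteratedDeriv_eq]

lemma IsHolomorphicAt.comp_const_add (hB : IsHolomorphicAt B (a + ζ)) :
    IsHolomorphicAt (fun η => B (a + η)) ζ := by
  have h1 : AnalyticAt ℂ (fun η => a + η) ζ := by fun_prop
  exact ⟨ContinuousAt.comp (g := B) hB.1 h1.continuousAt, AnalyticAt.comp hB.2 h1⟩

lemma pullbackRound_comp_const_add :
    pullbackRound (fun η => B (a + η)) ζ = pullbackRound B (a + ζ) := by
  rw [pullbackRound, pullbackRound, deriv_comp_const_add (fun η => coord (B (a + ζ)) (B η))]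

lemma schwarzian_comp_const_add :
    schwarzian (fun η => B (a + η)) ζ = schwarzian B (a + ζ) := by
  simp only [schwarzian]
  rw [deriv_comp_const_add (fun η => coord (B (a + ζ)) (B η)),
    iteratedDeriv_comp_const_add 2 (fun η => coord (B (a + ζ)) (B η)),
    iteratedDeriv_comp_const_add 3 (fun η => coord (B (a + ζ)) (B η))]

end Congr

/-! ### The Schwarzian derivative -/

/-- If `h'' = h' T` near `a`, the Schwarzian derivative of `h` is `T' - T² / 2`. -/
lemma schwarzian_expr_eq {h T : ℂ → ℂ} {a : ℂ}
    (hH : ∀ᶠ z in 𝓝 a, HasDerivAt (deriv h) (deriv h z * T z) z)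
    (hT : DifferentiableAt ℂ T a) (h0 : deriv h a ≠ 0) :
    iteratedDeriv 3 h a / deriv h a - 3 / 2 * (iteratedDeriv 2 h a / deriv h a) ^ 2 =
      deriv T a - T a ^ 2 / 2 := by
  have h2 : deriv (deriv h) =ᶠ[𝓝 a] fun z => deriv h z * T z := hH.mono fun z hz => hz.deriv
  have h3 : deriv (deriv (deriv h)) a = deriv h a * T a * T a + deriv h a * deriv T a := by
    rw [h2.deriv_eq]
    exact (hH.self_of_nhds.mul hT.hasDerivAt).deriv
  simp only [iteratedDeriv_succ, iteratedDeriv_zero]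
  rw [h3, h2.self_of_nhds]
  field_simp
  ring

/-- If `T = h'' / h'` has a simple pole with residue `γ`, the principal singular term of the
Schwarzian derivative `T' - T² / 2` is `(-γ - γ² / 2) / ζ²`. -/
lemma tendsto_sq_mul_schwarzian {T m : ℂ → ℂ} {γ : ℂ} (hm : AnalyticAt ℂ m 0)
    (hT : ∀ᶠ ζ in 𝓝[≠] 0, T ζ = γ / ζ + m ζ) :
    Tendsto (fun ζ => ζ ^ 2 * (deriv T ζ - T ζ ^ 2 / 2)) (𝓝[≠] 0) (𝓝 (-γ - γ ^ 2 / 2)) := by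
  have h1 : Tendsto (fun ζ : ℂ => -γ + ζ ^ 2 * deriv m ζ - (γ + ζ * m ζ) ^ 2 / 2) (𝓝[≠] 0)
      (𝓝 (-γ - γ ^ 2 / 2)) := by
    have hmd := hm.deriv.continuousAt
    have hmc := hm.continuousAt
    have : ContinuousAt (fun ζ : ℂ => -γ + ζ ^ 2 * deriv m ζ - (γ + ζ * m ζ) ^ 2 / 2) 0 := by
      fun_prop
    have h := this.tendsto
    simp only [ne_eq, OfNat.ofNat_ne_zero, not_false_eq_true, zero_pow, zero_mul, add_zero] at h
    exact h.mono_left nhdsWithin_le_nhds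
  refine h1.congr' ?_
  have hTn : ∀ᶠ ζ in 𝓝[≠] (0 : ℂ), T =ᶠ[𝓝 ζ] fun ζ => γ / ζ + m ζ := by
    have := eventually_eventually_nhdsWithin.2 hT
    filter_upwards [this, self_mem_nhdsWithin] with ζ h hζ
    rwa [IsOpen.nhdsWithin_eq isOpen_compl_singleton hζ] at h
  filter_upwards [hTn, self_mem_nhdsWithin,
    hm.eventually_analyticAt.filter_mono nhdsWithin_le_nhds] with ζ h hζ hmζ
  have hζ0 : ζ ≠ 0 := hζ
  have hd : HasDerivAt (fun ζ => γ / ζ + m ζ) (-γ / ζ ^ 2 + deriv m ζ) ζ := by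
    have := ((hasDerivAt_inv hζ0).const_mul γ).add hmζ.differentiableAt.hasDerivAt
    refine (this.congr_deriv ?_).congr_of_eventuallyEq ?_
    · ring
    · exact Eventually.of_forall fun z => by simp [div_eq_mul_inv]
  rw [h.deriv_eq, h.self_of_nhds, hd.deriv]
  field_simp

/-! ### The branches of the developing map -/

section Branches

variable {β : ℝ} {k : ℕ} {P : Finset (OnePoint ℂ)} {E : ℂ → ℂ} {a ζ : ℂ} {s : ℂ → ExpCover P}

lemma IsPowBranch.neg (h : IsPowBranch β E a) : IsPowBranch β (fun z => -E z) a := by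
  filter_upwards [h] with z hz
  exact ⟨hz.1.fun_neg.congr_deriv (by ring), by rw [norm_neg, hz.2]⟩

/-- The value of the developing map at a point over `z`, in terms of any function `E` that takes the
value `z ^ β` of the branch at `z`. -/
lemma devMap_eq_ratio {e : ExpCover P} {z : ℂ} (h : Complex.exp e.1 = z)
    (hE : E z = Complex.exp (β * e.1)) :
    devMap β k P e = ratio (den k) (fun z => E z * num β k z) z := by
  subst h
  simp only [devMap, ratio, den, num, hE]

/-- A local lift by `exp` is a continuous branch of the logarithm. -/
lemma IsLocalLift.continuousAt_log (hs : IsLocalLift (expProj P) (a : OnePoint ℂ) s ζ) :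
    ContinuousAt (fun z => (s (z - a)).1) (a + ζ) := by
  have h1 : ContinuousAt s (a + ζ - a) := by rw [add_sub_cancel_left]; exact hs.1
  have h2 : ContinuousAt (fun z : ℂ => z - a) (a + ζ) := by fun_prop
  exact continuous_subtype_val.continuousAt.comp (ContinuousAt.comp (g := s) h1 h2)

lemma IsLocalLift.eventually_exp (hs : IsLocalLift (expProj P) (a : OnePoint ℂ) s ζ) :
    ∀ᶠ z in 𝓝 (a + ζ), Complex.exp (s (z - a)).1 = z := by
  have h2 : Tendsto (fun z : ℂ => z - a) (𝓝 (a + ζ)) (𝓝 ζ) := by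
    have : ContinuousAt (fun z : ℂ => z - a) (a + ζ) := by fun_prop
    simpa [ContinuousAt] using this
  filter_upwards [h2.eventually hs.2] with z hz
  rw [param_coe, add_sub_cancel] at hz
  exact OnePoint.coe_injective hz

/-- Near every point the branches of the developing map are quotients of holomorphic functions. -/
lemma IsLocalLift.exists_ratio (hs : IsLocalLift (expProj P) (a : OnePoint ℂ) s ζ)
    (h0 : a + ζ ≠ 0) (β : ℝ) (k : ℕ) : ∃ E, IsPowBranch β E (a + ζ) ∧
      devMap β k P ∘ s =ᶠ[𝓝 ζ] fun η => ratio (den k) (fun z => E z * num β k z) (a + η) := by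
  refine ⟨_, isPowBranch_exp β h0 hs.continuousAt_log hs.eventually_exp, ?_⟩
  filter_upwards [hs.2] with η hη
  refine devMap_eq_ratio (OnePoint.coe_injective hη) ?_
  rw [add_sub_cancel_left]

/-- In the coordinate `1 / z` the branches have the same form, with `β` replaced by `-β`. -/
lemma IsLocalLift.exists_ratio_infty (hs : IsLocalLift (expProj P) ∞ s ζ)
    (h0 : ζ ≠ 0) (β : ℝ) (k : ℕ) : ∃ E, IsPowBranch (-β) E ζ ∧
      devMap β k P ∘ s =ᶠ[𝓝 ζ] ratio (den k) (fun z => E z * num (-β) k z) := by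
  have hexp : ∀ᶠ η in 𝓝 ζ, η ≠ 0 ∧ Complex.exp (s η).1 = η⁻¹ := by
    filter_upwards [hs.2, eventually_ne_nhds h0] with η hη hη0
    rw [param_infty hη0] at hη
    exact ⟨hη0, OnePoint.coe_injective hη⟩
  have hc : ContinuousAt (fun η => -(s η).1) ζ :=
    (continuous_subtype_val.continuousAt.comp hs.1).neg
  have he : ∀ᶠ η in 𝓝 ζ, Complex.exp (-(s η).1) = η := by
    filter_upwards [hexp] with η hη
    rw [Complex.exp_neg, hη.2, inv_inv]
  -- `num β k (1 / z)` has the opposite sign to `num (-β) k z`, hence the branch `-exp`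
  refine ⟨_, (isPowBranch_exp (-β) h0 hc he).neg, ?_⟩
  filter_upwards [hexp] with η ⟨hη0, hη⟩
  have h1 := devMap_eq_ratio (β := β) (k := k) (E := fun _ => Complex.exp (β * (s η).1)) hη rfl
  rw [Function.comp_apply, h1]
  have h2 := pow_ne_zero k hη0
  have h3 : ((-β : ℝ) : ℂ) * -(s η).1 = β * (s η).1 := by push_cast; ring
  have h4 : den k η / η ^ k = 0 ↔ den k η = 0 := by simp [h2]
  simp only [ratio, den_inv hη0, num_inv hη0, h3, h4]
  congr 2
  field_simp

lemma den_ne_zero_or (hE : IsPowBranch β E a) (hk : 0 < k) (ha : a ≠ 0) :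
    den k a ≠ 0 ∨ E a * num β k a ≠ 0 := by
  by_cases h : den k a = 0
  · exact Or.inr (mul_ne_zero (hE.ne_zero ha) (num_ne_zero_of_den_eq_zero hk h))
  · exact Or.inl h

end Branches

/-! ### The Schwarzian derivative of the developing map -/

section Schwarzian

variable {β : ℝ} {k : ℕ} {E : ℂ → ℂ} {a : ℂ}

/-- The logarithmic derivative `f'' / f'` of the derivative of the developing map `f`. -/
def logDerivDeriv (β : ℝ) (k : ℕ) (z : ℂ) : ℂ :=
  (β - 1) / z + (deriv (crit β k) z / crit β k z - 2 * (deriv (den k) z / den k z))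

lemma analyticAt_logDeriv_den (h : den k a ≠ 0) :
    AnalyticAt ℂ (fun z => deriv (den k) z / den k z) a :=
  (analyticAt_den k a).deriv.div (analyticAt_den k a) h

lemma analyticAt_logDeriv_crit (h : crit β k a ≠ 0) :
    AnalyticAt ℂ (fun z => deriv (crit β k) z / crit β k z) a :=
  (analyticAt_crit β k a).deriv.div (analyticAt_crit β k a) h

lemma schwarzian_ratio (hE : IsPowBranch β E a) (hk : 0 < k) (ha : a ≠ 0)
    (hc : crit β k a ≠ 0) (hd : den k a ≠ 0) :
    schwarzian (ratio (den k) (fun z => E z * num β k z)) a =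
      deriv (logDerivDeriv β k) a - logDerivDeriv β k a ^ 2 / 2 := by
  set h : ℂ → ℂ := fun z => E z * num β k z / den k z with hh
  have h1 : (fun z => coord (ratio (den k) (fun z => E z * num β k z) a)
      (ratio (den k) (fun z => E z * num β k z) z)) =ᶠ[𝓝 a] h :=
    eventually_coord_ratio_of_ne_zero (analyticAt_den k a).continuousAt hd
  have hderiv : ∀ᶠ z in 𝓝 a, deriv h z = E z / z * crit β k z / den k z ^ 2 := by
    filter_upwards [hE.eventually, eventually_ne_nhds ha,
      (analyticAt_den k a).continuousAt.eventually_ne hd] with z hz hz0 hzd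
    have hEz := hz.analyticAt
    rw [hh, deriv_div_eq_wronskian (D := den k) (G := fun z => E z * num β k z) (by fun_prop)
      (by fun_prop) hzd, hz.wronskian_den_num hk hz0]
  simp only [schwarzian, h1.deriv_eq, h1.iteratedDeriv_eq]
  refine schwarzian_expr_eq ?_ ?_ ?_
  · filter_upwards [hderiv.eventually_nhds, hE.eventually, eventually_ne_nhds ha,
      (analyticAt_den k a).continuousAt.eventually_ne hd,
      (analyticAt_crit β k a).continuousAt.eventually_ne hc] with z hz hEz hz0 hzd hzc
    have e1 := ((hEz.self_of_nhds.1.div (hasDerivAt_id z) hz0).mul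
      (analyticAt_crit β k z).differentiableAt.hasDerivAt).div
      ((analyticAt_den k z).differentiableAt.hasDerivAt.pow 2) (pow_ne_zero 2 hzd)
    have e2 := e1.congr_of_eventuallyEq (f₁ := deriv h) hz
    refine e2.congr_deriv ?_
    rw [hz.self_of_nhds, logDerivDeriv]
    simp only [id, Pi.mul_apply, Pi.div_apply, Pi.pow_apply]
    field_simp
    ring
  · have e1 := (analyticAt_logDeriv_den hd).differentiableAt
    have e2 := (analyticAt_logDeriv_crit hc).differentiableAt
    unfold logDerivDeriv
    fun_prop (disch := assumption)
  · rw [hderiv.self_of_nhds]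
    exact div_ne_zero (mul_ne_zero (div_ne_zero (hE.ne_zero ha) ha) hc) (pow_ne_zero 2 hd)

/-- The residue of `f'' / f'` at `0` is `β - 1`. This is used with `β` and, at `∞`, with `-β`. -/
lemma tendsto_schwarzian_zero (hc : crit β k 0 ≠ 0) (hk : 0 < k) :
    Tendsto (fun ζ => ζ ^ 2 * (deriv (logDerivDeriv β k) ζ - logDerivDeriv β k ζ ^ 2 / 2)) (𝓝[≠] 0)
      (𝓝 ((1 - (β : ℂ) ^ 2) / 2)) := by
  have e1 := analyticAt_logDeriv_den (k := k) (a := 0) (by simp [den_zero hk])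
  have e2 := analyticAt_logDeriv_crit hc
  have := tendsto_sq_mul_schwarzian (T := logDerivDeriv β k) (γ := β - 1)
    (e2.sub (analyticAt_const.mul e1)) (Eventually.of_forall fun ζ => rfl)
  convert this using 2
  ring

/-- At a simple zero of `crit` the residue of `f'' / f'` is `1`. -/
lemma tendsto_schwarzian_of_crit (ha : a ≠ 0) (hc : crit β k a = 0)
    (hc' : deriv (crit β k) a ≠ 0) (hd : den k a ≠ 0) :
    Tendsto (fun ζ => ζ ^ 2 * (deriv (logDerivDeriv β k) (a + ζ) - logDerivDeriv β k (a + ζ) ^ 2 / 2))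
      (𝓝[≠] 0) (𝓝 ((1 - (2 : ℂ) ^ 2) / 2)) := by
  set c : ℂ → ℂ := dslope (crit β k) a with hcdef
  have hca : AnalyticAt ℂ c a := by
    obtain ⟨p, hp⟩ := analyticAt_crit β k a
    exact ⟨_, hp.has_fpower_series_dslope_fslope⟩
  have hc0 : c a ≠ 0 := by rwa [hcdef, dslope_same]
  have hfac : crit β k = fun z => (z - a) * c z := by
    ext z
    have := sub_smul_dslope (crit β k) a z
    rw [hc, sub_zero, smul_eq_mul] at this
    exact this.symm
  have hm : AnalyticAt ℂ (fun z => (β - 1) / z + (deriv c z / c z -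
      2 * (deriv (den k) z / den k z))) a :=
    (analyticAt_const.div analyticAt_id ha).add ((hca.deriv.div hca hc0).sub
      (analyticAt_const.mul (analyticAt_logDeriv_den hd)))
  have hshift : AnalyticAt ℂ (fun ζ : ℂ => a + ζ) 0 := by fun_prop
  rw [← add_zero a] at hm
  have hcan : ∀ᶠ ζ in 𝓝 (0 : ℂ), AnalyticAt ℂ c (a + ζ) ∧ c (a + ζ) ≠ 0 := by
    have h1 := hca.eventually_analyticAt.and (hca.continuousAt.eventually_ne hc0)
    rw [← add_zero a] at h1
    exact hshift.continuousAt.eventually h1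
  have := tendsto_sq_mul_schwarzian (T := fun ζ => logDerivDeriv β k (a + ζ)) (γ := 1)
    (AnalyticAt.comp hm hshift) ?_
  · simp only [deriv_comp_const_add] at this
    convert this using 2
    norm_num
  · filter_upwards [self_mem_nhdsWithin, hcan.filter_mono nhdsWithin_le_nhds] with ζ hζ h
    have hζ0 : ζ ≠ 0 := hζ
    have hderiv : deriv (crit β k) (a + ζ) = c (a + ζ) + ζ * deriv c (a + ζ) := by
      have h1 := ((hasDerivAt_id (a + ζ)).sub_const a).mul h.1.differentiableAt.hasDerivAt
      rw [hfac]
      refine HasDerivAt.deriv (h1.congr_deriv ?_)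
      simp
    have hval : crit β k (a + ζ) = ζ * c (a + ζ) := by rw [hfac]; simp
    have hc1 := h.2
    rw [logDerivDeriv, hderiv, hval, Function.comp_apply]
    field_simp
    ring

end Schwarzian

/-! ### The monodromy of the developing map -/

/-- The diagonal matrix with entries `c` and `conj c`. -/
def diagMatrix (c : ℂ) : Matrix (Fin 2) (Fin 2) ℂ := !![c, 0; 0, conj c]

lemma diagMatrix_mem {c : ℂ} (hc : ‖c‖ = 1) :
    diagMatrix c ∈ Matrix.specialUnitaryGroup (Fin 2) ℂ := by
  have h1 : c * conj c = 1 := by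
    rw [Complex.mul_conj, Complex.normSq_eq_norm_sq, hc]; simp
  have h2 : conj c * c = 1 := by rw [mul_comm, h1]
  rw [Matrix.mem_specialUnitaryGroup_iff, Matrix.mem_unitaryGroup_iff]
  constructor
  · ext i j
    fin_cases i <;> fin_cases j <;>
      simp [diagMatrix, Matrix.mul_apply, Fin.sum_univ_two, Matrix.star_apply, h1, h2]
  · simp [diagMatrix, Matrix.det_fin_two, h1]

lemma smul_ratio_of_coe_eq {c : ℂ} (hc : ‖c‖ = 1) {A : GL (Fin 2) ℂ}
    (hA : (A : Matrix (Fin 2) (Fin 2) ℂ) = diagMatrix c) (D G : ℂ → ℂ) (z : ℂ) :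
    A • ratio D G z = ratio D (fun z => c ^ 2 * G z) z := by
  have hc0 : conj c ≠ 0 := by
    rw [← norm_pos_iff, Complex.norm_conj, hc]; exact one_pos
  have h1 : c * conj c = 1 := by
    rw [Complex.mul_conj, Complex.normSq_eq_norm_sq, hc]; simp
  have e00 : A 0 0 = c := by rw [hA]; rfl
  have e01 : A 0 1 = 0 := by rw [hA]; rfl
  have e10 : A 1 0 = 0 := by rw [hA]; rfl
  have e11 : A 1 1 = conj c := by rw [hA]; rfl
  rw [ratio, ratio]
  split_ifs with h
  · rw [OnePoint.smul_infty_eq_ite, if_pos e10]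
  · rw [OnePoint.smul_some_eq_ite, e00, e01, e10, e11, if_neg (by simpa using hc0)]
    congr 1
    simp only [add_zero, zero_mul, zero_add]
    rw [div_eq_iff hc0]
    linear_combination (-(c * G z / D z)) * h1

section Monodromy

variable {β : ℝ} {k : ℕ} {P : Finset (OnePoint ℂ)}

/-- Two lifts of the same point by `exp` differ by `2 π i n`, and the corresponding branches of the
developing map by the rotation with factor `exp (2 π i n β)`. -/
lemma devMap_monodromy (e e' : ExpCover P) (h : expProj P e = expProj P e') :
    ∃ A : GL (Fin 2) ℂ, (A : Matrix (Fin 2) (Fin 2) ℂ) ∈ Matrix.specialUnitaryGroup (Fin 2) ℂ ∧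
      ∀ s s' : ℂ → ExpCover P, s 0 = e → s' 0 = e' →
        IsLocalLift (expProj P) (expProj P e) s 0 → IsLocalLift (expProj P) (expProj P e) s' 0 →
          ∀ᶠ ζ in 𝓝 (0 : ℂ), devMap β k P (s' ζ) = A • devMap β k P (s ζ) := by
  obtain ⟨n, hn⟩ := Complex.exp_eq_exp_iff_exists_int.1 (OnePoint.coe_injective h.symm)
  -- a square root of the factor, since `diagMatrix c` acts by `w ↦ c² w`
  set c : ℂ := Complex.exp ((n * Real.pi * β : ℝ) * Complex.I) with hc
  have hc1 : ‖c‖ = 1 := Complex.norm_exp_ofReal_mul_I _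
  have hmem := diagMatrix_mem hc1
  have hdet : (diagMatrix c).det ≠ 0 := by
    rw [(Matrix.mem_specialUnitaryGroup_iff.1 hmem).2]; exact one_ne_zero
  refine ⟨Matrix.GeneralLinearGroup.mkOfDetNeZero _ hdet, hmem, fun s s' hs0 hs0' hs hs' => ?_⟩
  change IsLocalLift (expProj P) ((Complex.exp e.1 : ℂ) : OnePoint ℂ) s 0 at hs
  change IsLocalLift (expProj P) ((Complex.exp e.1 : ℂ) : OnePoint ℂ) s' 0 at hs'
  set a := Complex.exp e.1
  have h1 := eventually_eq_add_log hs.continuousAt_log hs.eventually_exp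
  have h2 := eventually_eq_add_log hs'.continuousAt_log hs'.eventually_exp
  have hshift : ContinuousAt (fun ζ : ℂ => a + ζ) 0 := by fun_prop
  filter_upwards [hshift.eventually h1, hshift.eventually h2, hs.2, hs'.2] with ζ e1 e2 e3 e4
  simp only [add_zero, sub_self, add_sub_cancel_left, hs0, hs0'] at e1 e2
  have e5 : (s' ζ).1 = (s ζ).1 + n * (2 * Real.pi * Complex.I) := by rw [e1, e2, hn]; ring
  rw [devMap_eq_ratio (E := fun _ => Complex.exp (β * (s ζ).1)) (OnePoint.coe_injective e3) rfl,
    devMap_eq_ratio (E := fun _ => Complex.exp (β * (s' ζ).1)) (OnePoint.coe_injective e4) rfl,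
    smul_ratio_of_coe_eq hc1 rfl]
  congr 1
  ext z
  have e6 : Complex.exp (β * (s' ζ).1) = c ^ 2 * Complex.exp (β * (s ζ).1) := by
    rw [e5, hc, ← Complex.exp_nat_mul, ← Complex.exp_add]
    congr 1
    push_cast
    ring
  rw [e6]
  ring

end Monodromy

/-! ### The developing map and the extra eigenfunctions -/

lemma isDevelopingMap_devMap {β : ℝ} {k : ℕ} (hβ : 0 < β) (hk : β < k) :
    IsDevelopingMap (coneMetric β k) (conePoints β k) (coneAngle β) (expProj (conePoints β k))
      (devMap β k (conePoints β k)) := by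
  have hk0 : 0 < k := by exact_mod_cast hβ.trans hk
  have h0 : ((0 : ℂ) : OnePoint ℂ) ∈ conePoints β k := (coe_mem_conePoints hβ hk0 0).2 (Or.inl rfl)
  refine ⟨connectedSpace_expCover _, range_expProj h0 (infty_mem_conePoints β k),
    isCoveringMapOn_expProj h0 (infty_mem_conePoints β k), ?_, ?_, devMap_monodromy, ?_⟩
  · intro p hp s hs
    obtain ⟨a, rfl, ha, -⟩ := (notMem_conePoints hβ hk0).1 hp
    rw [← add_zero a] at ha
    obtain ⟨E, hE, hF⟩ := hs.exists_ratio ha β k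
    have hEa := hE.analyticAt
    exact (isHolomorphicAt_ratio (by fun_prop) (by fun_prop)
      (den_ne_zero_or hE hk0 ha)).comp_const_add.congr hF.symm
  · intro p hp s hs
    obtain ⟨a, rfl, ha, -⟩ := (notMem_conePoints hβ hk0).1 hp
    rw [← add_zero a] at ha
    obtain ⟨E, hE, hF⟩ := hs.exists_ratio ha β k
    have hEa := hE.analyticAt
    rw [pullbackRound_congr hF,
      pullbackRound_comp_const_add (B := ratio (den k) fun z => E z * num β k z),
      pullbackRound_ratio (by fun_prop) (by fun_prop) (den_ne_zero_or hE hk0 ha),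
      hE.metric_eq hk0 ha, density_coe, coneMetric_coe]
  · intro p hp
    have hcrit0 := crit_zero_ne_zero hβ hk0
    induction p using OnePoint.rec with
    | infty =>
      refine ⟨fun ζ => deriv (logDerivDeriv (-β) k) ζ - logDerivDeriv (-β) k ζ ^ 2 / 2, ?_, ?_⟩
      · have h1 := (analyticAt_den k 0).continuousAt.eventually_ne (y := 0) (by simp [den_zero hk0])
        have h2 := (analyticAt_crit (-β) k 0).continuousAt.eventually_ne
          (crit_neg_zero_ne_zero hβ hk)
        filter_upwards [self_mem_nhdsWithin, h1.filter_mono nhdsWithin_le_nhds,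
          h2.filter_mono nhdsWithin_le_nhds] with ζ hζ hd hc s hs
        obtain ⟨E, hE, hF⟩ := hs.exists_ratio_infty hζ β k
        rw [schwarzian_congr hF, schwarzian_ratio hE hk0 hζ hc hd]
      · simpa using tendsto_schwarzian_zero (crit_neg_zero_ne_zero hβ hk) hk0
    | coe a =>
      have ha := (coe_mem_conePoints hβ hk0 a).1 hp
      have hda : den k a ≠ 0 := by
        rcases ha with rfl | ha
        · simp [den_zero hk0]
        · exact fun h => crit_ne_zero_of_den_eq_zero hk0 h ha
      have hloc : ∀ᶠ z in 𝓝[≠] a, z ≠ 0 ∧ crit β k z ≠ 0 := by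
        rcases eq_or_ne a 0 with rfl | ha0
        · have hc := ((analyticAt_crit β k 0).continuousAt.eventually_ne hcrit0).filter_mono
            (nhdsWithin_le_nhds (s := {0}ᶜ))
          filter_upwards [self_mem_nhdsWithin, hc] with z hz hzc
          exact ⟨hz, hzc⟩
        · have hca := ha.resolve_left ha0
          refine ((eventually_ne_nhds ha0).filter_mono nhdsWithin_le_nhds).and ?_
          exact (hasDerivAt_crit β k a).eventually_ne (by
            rw [← (hasDerivAt_crit β k a).deriv]; exact deriv_crit_ne_zero hβ hk hca)
      have hshift : Tendsto (fun ζ : ℂ => a + ζ) (𝓝[≠] 0) (𝓝[≠] a) := by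
        refine tendsto_nhdsWithin_of_tendsto_nhds_of_eventually_within _ ?_ ?_
        · have : ContinuousAt (fun ζ : ℂ => a + ζ) 0 := by fun_prop
          simpa [ContinuousAt] using this.tendsto.mono_left nhdsWithin_le_nhds
        · filter_upwards [self_mem_nhdsWithin] with ζ hζ
          simpa using hζ
      refine ⟨fun ζ => deriv (logDerivDeriv β k) (a + ζ) - logDerivDeriv β k (a + ζ) ^ 2 / 2, ?_, ?_⟩
      · have h1 := ((analyticAt_den k a).continuousAt.eventually_ne hda).filter_mono
          (nhdsWithin_le_nhds (s := {a}ᶜ))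
        filter_upwards [hshift.eventually hloc, hshift.eventually h1] with ζ ⟨hz, hc⟩ hd s hs
        obtain ⟨E, hE, hF⟩ := hs.exists_ratio hz β k
        rw [schwarzian_congr hF,
          schwarzian_comp_const_add (B := ratio (den k) fun z => E z * num β k z),
          schwarzian_ratio hE hk0 hz hc hd]
      · rcases eq_or_ne a 0 with rfl | ha0
        · simpa using tendsto_schwarzian_zero hcrit0 hk0
        · rw [coneAngle_of_ne_zero β ha0]
          have hca := ha.resolve_left ha0
          simpa using tendsto_schwarzian_of_crit ha0 hca (deriv_crit_ne_zero hβ hk hca) hda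

lemma isExtraEigenfunction_re_mul_hQuot {β : ℝ} {k : ℕ} {l : ℂ} (hl : l ≠ 0) (hβ : 0 < β)
    (hk : β < k) : IsExtraEigenfunction (coneMetric β k) (conePoints β k) (coneAngle β)
      fun p => (l * hQuot β k p).re :=
  ⟨isTwoEigenfunction_re_mul_hQuot l hβ hk, not_isFromDevelopingMap_re_mul_hQuot hl hβ hk⟩

end SphericalConical

end

theorem mainTheorem4 (β : ℝ) (k : ℕ) (hβ : 0 < β) (hk : β < k) :
    ∃ (g : OnePoint ℂ → ℝ) (P : Finset (OnePoint ℂ)) (b : OnePoint ℂ → ℝ),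
      SphericalConical.IsSphericalConicalMetric g P b ∧
      SphericalConical.IsDevelopingMap g P b (SphericalConical.expProj P)
        (SphericalConical.devMap β k P) ∧
      (∃ C : ℝ, ∀ p, ‖SphericalConical.hQuot β k p‖ ≤ C) ∧
      (∀ z : ℂ, SphericalConical.h₂ β k z ≠ 0) ∧
      SphericalConical.IsExtraEigenfunction g P b
        (fun p => (SphericalConical.hQuot β k p).re) ∧
      SphericalConical.IsExtraEigenfunction g P b
        (fun p => (SphericalConical.hQuot β k p).im) ∧
      ∀ x y : ℝ, (x, y) ≠ (0, 0) →
        SphericalConical.IsExtraEigenfunction g P b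
          (fun p => x * (SphericalConical.hQuot β k p).re
            + y * (SphericalConical.hQuot β k p).im) := by
  have hk0 : 0 < k := by exact_mod_cast hβ.trans hk
  have key : ∀ x y : ℝ, (x, y) ≠ (0, 0) →
      SphericalConical.IsExtraEigenfunction (SphericalConical.coneMetric β k)
        (SphericalConical.conePoints β k) (SphericalConical.coneAngle β)
        (fun p => x * (SphericalConical.hQuot β k p).re
          + y * (SphericalConical.hQuot β k p).im) := by
    intro x y hxy
    -- `x Re h + y Im h = Re ((x - i y) h)`
    have hl : (⟨x, -y⟩ : ℂ) ≠ 0 := by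
      contrapose! hxy
      simpa [Complex.ext_iff] using hxy
    simpa using SphericalConical.isExtraEigenfunction_re_mul_hQuot hl hβ hk
  refine ⟨_, _, _, SphericalConical.isSphericalConicalMetric_coneMetric hβ hk,
    SphericalConical.isDevelopingMap_devMap hβ hk, SphericalConical.exists_norm_hQuot_le hβ hk,
    SphericalConical.h₂_ne_zero hk0, ?_, ?_, key⟩
  · simpa using key 1 0 (by simp)
  · simpa using key 0 1 (by simp)
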